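/- Let $V_5$ be a complex vector space of dimension $5$, let $n\ge 3$, let $W\subseteq \bigwedge^2V_5$ be a subspace of dimension $n+5$ (so $n\in\{3,4,5\}$), let $Q\subseteq \mathbf P(\bigwedge^2V_5)$ be a quadric, and assume that the scheme-theoretic intersection $X=\mathrm{Gr}(2,V_5)\cap\mathbf P(W)\cap Q\subseteq\mathbf P(\bigwedge^2V_5)$ is smooth of dimension $n$ ($X$ is a smooth ordinary Gushel–Mukai variety). Let $\mathcal U_X$ be the restriction to $X$ of the tautological rank-$2$ subbundle on $\mathrm{Gr}(2,V_5)$, and let $\rho\colon\mathbf P(\mathcal U_X)\to\mathbf P(V_5)$ be the map $(U_2,U_1)\mapsto U_1$ (where $U_1\subseteq U_2\subseteq V_5$ and $[U_2]\in X$). For $r\in\{1,2,3\}$, let $F_r(X)$ be the Hilbert scheme of linear $r$-spaces of $\sigma$-type contained in $X$, that is, of the form $\mathbf P(V_1\wedge V_{r+2})$ for some flag $V_1\subseteq V_{r+2}\subseteq V_5$ of subspaces of dimensions $1$ and $r+2$, and let $\mathrm{Hilb}^{\mathbf P^r}(\mathbf P(\mathcal U_X)/\mathbf P(V_5))$ be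 the relative Hilbert scheme of linear $\mathbf P^r$'s in the fibres of $\rho$, where the fibre $\rho^{-1}([U_1])$ is embedded in $\mathbf P(\bigwedge^2V_5)$ by $U_2\mapsto\bigwedge^2U_2$. For each $r\in\{1,2,3\}$, the rule $[\mathbf P(V_1\wedge V_{r+2})]\mapsto[V_1]$ defines a morphism $\sigma\colon F_r(X)\to\mathbf P(V_5)$, and $\sigma$ lifts to an isomorphism $$F_r(X)\;\simeq\;\mathrm{Hilb}^{\mathbf P^r}(\mathbf P(\mathcal U_X)/\mathbf P(V_5))$$ of schemes over $\mathbf P(V_5)$, whose inverse maps a family of $\mathbf P^r$'s in the fibres of $\rho$ to its image under the projection $\mathbf P(\mathcal U_X)\to X$. Moreover, $F_3(X)=\varnothing$ and, if $n\le 3$, $F_2(X)=\varnothing$. -/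

import Mathlib

open CategoryTheory TensorProduct
open AlgebraicGeometry (Scheme Spec SmoothOfRelativeDimension)

namespace GushelMukai

noncomputable section

/-! ### Grassmannians of subspaces and extension of scalars

Schemes over `ℂ` are described by their functors of points on commutative `ℂ`-algebras. -/

lemma map_one_apply (F : CommAlgCat.{0} ℂ ⥤ Type) {R : CommAlgCat.{0} ℂ} (x : F.obj R) :
    F.map (𝟙 R) x = x := by
  rw [F.map_id]; rfl

lemma map_map_apply (F : CommAlgCat.{0} ℂ ⥤ Type) {R S T : CommAlgCat.{0} ℂ} (f : R ⟶ S) (g : S ⟶ T)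
    (x : F.obj R) : F.map (f ≫ g) x = F.map g (F.map f x) := by
  rw [F.map_comp]; rfl

/-- The Grassmannian `Gr(k, M)` of `k`-dimensional subspaces of a complex vector space `M` (for
`k ≤ dim M < ∞`): its points over `R` are the submodules of `R ⊗ M` whose quotient is locally free
of rank `dim M - k`, that is, the rank-`k` subbundles of the trivial bundle `M` on `Spec R`.  The
transition maps are pullbacks of subbundles.  For `k = 1` this is the projective space `P(M)` of
lines in `M`. -/
abbrev Gr (k : ℕ) (M : Type) [AddCommGroup M] [Module ℂ M] : CommAlgCat.{0} ℂ ⥤ Type :=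
  Module.Grassmannian.functor (R := ℂ) (M := M) (Module.finrank ℂ M - k)

/-- The projective space of lines in `M`. -/
abbrev PP (M : Type) [AddCommGroup M] [Module ℂ M] : CommAlgCat.{0} ℂ ⥤ Type := Gr 1 M

section Extension

variable {M : Type} [AddCommGroup M] [Module ℂ M]

/-- A point of `Gr(k, M)` over `R`, as a submodule of `R ⊗ M`. -/
def toSub {k : ℕ} {R : CommAlgCat.{0} ℂ} (N : (Gr k M).obj R) : Submodule R (R ⊗[ℂ] M) :=
  Module.Grassmannian.toSubmodule N

/-- The map `R ⊗ M → S ⊗ M` induced by a map of algebras `R → S`. -/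
def extendScalars {R S : CommAlgCat.{0} ℂ} (f : R ⟶ S) : R ⊗[ℂ] M →ₗ[ℂ] S ⊗[ℂ] M :=
  LinearMap.rTensor M f.hom.toLinearMap

lemma extendScalars_tmul {R S : CommAlgCat.{0} ℂ} (f : R ⟶ S) (r : R) (m : M) :
    extendScalars f (r ⊗ₜ[ℂ] m) = f.hom r ⊗ₜ[ℂ] m := rfl

lemma extendScalars_smul {R S : CommAlgCat.{0} ℂ} (f : R ⟶ S) (r : R) (x : R ⊗[ℂ] M) :
    extendScalars f (r • x) = f.hom r • extendScalars f x := by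
  induction x with
  | zero => simp
  | tmul a m => simp [extendScalars_tmul, TensorProduct.smul_tmul']
  | add x y hx hy => simp [smul_add, hx, hy]

lemma baseChange_exact {R S M : Type} [CommRing R] [CommRing S] [Algebra R S] [AddCommGroup M]
    [Module R M] (N : Submodule R M) :
    Function.Exact (N.subtype.baseChange S) (N.mkQ.baseChange S) :=
  lTensor_exact S (LinearMap.exact_subtype_mkQ N) (Submodule.mkQ_surjective _)

/-- The pullback of a subbundle is spanned by the image of the subbundle. -/
lemma map_toSub_eq_span (k : ℕ) {R S : CommAlgCat.{0} ℂ} (f : R ⟶ S) (N : (Gr k M).obj R) :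
    toSub ((Gr k M).map f N) = Submodule.span S (extendScalars f '' (toSub N)) := by
  let _ : Algebra R S := f.hom.toRingHom.toAlgebra
  have _ : IsScalarTower ℂ R S :=
    IsScalarTower.of_algebraMap_eq' (f.hom.comp_algebraMap).symm
  have h1 : toSub ((Gr k M).map f N) =
      ((toSub N).baseChange S).map
        (AlgebraTensorModule.cancelBaseChange ℂ R S S M).toLinearMap := by
    change (Module.Grassmannian.baseChangeMkQ S (toSub N)).ker = _
    have hex : Function.Exact ((toSub N).subtype.baseChange S) ((toSub N).mkQ.baseChange S) :=
      baseChange_exact _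
    ext y
    rw [LinearMap.mem_ker, Submodule.mem_map]
    change ((toSub N).mkQ.baseChange S)
      ((AlgebraTensorModule.cancelBaseChange ℂ R S S M).symm y) = 0 ↔ _
    rw [hex]
    constructor
    · intro hy
      exact ⟨_, hy, LinearEquiv.apply_symm_apply _ _⟩
    · rintro ⟨z, hz, rfl⟩
      rw [LinearEquiv.coe_coe, LinearEquiv.symm_apply_apply]
      exact hz
  have h2 (n : R ⊗[ℂ] M) : AlgebraTensorModule.cancelBaseChange ℂ R S S M (1 ⊗ₜ[R] n) =
      extendScalars f n := by
    induction n with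
    | zero => simp
    | add x y hx hy => simp [tmul_add, hx, hy]
    | tmul r m =>
      rw [AlgebraTensorModule.cancelBaseChange_tmul, extendScalars_tmul]
      simp [Algebra.smul_def]
      rfl
  rw [h1, Submodule.baseChange_eq_span, Submodule.map_span]
  congr 1
  ext y
  simp only [Submodule.map_coe, Set.mem_image, exists_exists_and_eq_and, TensorProduct.mk_apply,
    LinearEquiv.coe_coe, h2]

lemma map_mono {k l : ℕ} {R S : CommAlgCat.{0} ℂ} (f : R ⟶ S)
    {N : (Gr k M).obj R} {N' : (Gr l M).obj R} (h : (toSub N) ≤ (toSub N')) :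
    toSub ((Gr k M).map f N) ≤ toSub ((Gr l M).map f N') := by
  rw [map_toSub_eq_span, map_toSub_eq_span]
  exact Submodule.span_mono (Set.image_mono h)

lemma extendScalars_mem_baseChange {R S : CommAlgCat.{0} ℂ} (f : R ⟶ S) (W : Submodule ℂ M)
    {x : R ⊗[ℂ] M} (hx : x ∈ W.baseChange R) : extendScalars f x ∈ W.baseChange S := by
  rw [Submodule.baseChange_eq_span] at hx
  induction hx using Submodule.span_induction with
  | mem x hx =>
    obtain ⟨m, hm, rfl⟩ := hx
    exact Submodule.tmul_mem_baseChange_of_mem _ hm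
  | zero => simp
  | add x y _ _ hx hy => rw [map_add]; exact Submodule.add_mem _ hx hy
  | smul a x _ hx => rw [extendScalars_smul]; exact Submodule.smul_mem _ _ hx

lemma extendScalars_quadratic {R S : CommAlgCat.{0} ℂ} (f : R ⟶ S) (Q : QuadraticForm ℂ M)
    (x : R ⊗[ℂ] M) : Q.baseChange S (extendScalars f x) = f.hom (Q.baseChange R x) := by
  have key (x y : R ⊗[ℂ] M) :
      QuadraticMap.polar (Q.baseChange S) (extendScalars f x) (extendScalars f y) =
        f.hom (QuadraticMap.polar (Q.baseChange R) x y) := by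
    let _ (A : CommAlgCat.{0} ℂ) : Invertible (2 : A) :=
      (Invertible.map (algebraMap ℂ A) 2).copy 2 (map_ofNat _ 2).symm
    have e (A : CommAlgCat.{0} ℂ) (u v : A ⊗[ℂ] M) :
        QuadraticMap.polar (Q.baseChange A) u v =
          LinearMap.BilinForm.baseChange A (QuadraticMap.polarBilin Q) u v := by
      rw [← QuadraticForm.polarBilin_baseChange]; rfl
    rw [e, e]
    induction x with
    | zero => simp
    | add x x' hx hx' => simp only [map_add, LinearMap.add_apply, hx, hx']
    | tmul a v =>
      induction y with
      | zero => simp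
      | add y y' hy hy' => simp only [map_add, hy, hy']
      | tmul b w => simp [extendScalars_tmul]
  induction x with
  | zero => simp
  | tmul a m => simp [extendScalars_tmul]
  | add x y hx hy =>
    have h1 := key x y
    simp only [QuadraticMap.polar, map_sub, hx, hy, ← map_add] at h1
    simpa using h1

lemma quadratic_vanish {R S : CommAlgCat.{0} ℂ} (f : R ⟶ S) (Q : QuadraticForm ℂ M)
    (N : Submodule R (R ⊗[ℂ] M)) (hN : ∀ x ∈ N, Q.baseChange R x = 0) :
    ∀ x ∈ Submodule.span S (extendScalars f '' N), Q.baseChange S x = 0 := by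
  have hp (x y : S ⊗[ℂ] M) (hx : x ∈ Submodule.span S (extendScalars f '' N))
      (hy : y ∈ Submodule.span S (extendScalars f '' N)) :
      QuadraticMap.polarBilin (Q.baseChange S) x y = 0 := by
    induction hx, hy using Submodule.span_induction₂ with
    | mem_mem x y hx hy =>
      obtain ⟨x, hx, rfl⟩ := hx
      obtain ⟨y, hy, rfl⟩ := hy
      rw [QuadraticMap.polarBilin_apply_apply, QuadraticMap.polar, ← map_add,
        extendScalars_quadratic, extendScalars_quadratic, extendScalars_quadratic,
        hN _ hx, hN _ hy, hN _ (N.add_mem hx hy)]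
      simp
    | zero_left => simp
    | zero_right => simp
    | add_left x y z _ _ _ hx hy => rw [map_add, LinearMap.add_apply, hx, hy, add_zero]
    | add_right x y z _ _ _ hx hy => rw [map_add, hx, hy, add_zero]
    | smul_left a x y _ _ hx => rw [map_smul, LinearMap.smul_apply, hx, smul_zero]
    | smul_right a x y _ _ hx => rw [map_smul, hx, smul_zero]
  intro x hx
  have h := hp x x hx hx
  rw [QuadraticMap.polarBilin_apply_apply, QuadraticMap.polar_self, two_smul, ← two_mul] at h
  have h2 : IsUnit (2 : S) := by
    have := (IsUnit.mk0 (2 : ℂ) two_ne_zero).map (algebraMap ℂ S)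
    rwa [map_ofNat] at this
  exact (h2.mul_right_eq_zero).1 h

end Extension

/-! ### The wedge product -/

section Wedge

variable (V : Type) [AddCommGroup V] [Module ℂ V]

/-- The wedge product `V × V → ⋀² V`. -/
def wedge : LinearMap.BilinMap ℂ V (⋀[ℂ]^2 V) :=
  LinearMap.mk₂ ℂ (fun v w => exteriorPower.ιMulti ℂ 2 ![v, w])
    (fun v v' w => AlternatingMap.map_vecCons_add _ _ _ _)
    (fun c v w => AlternatingMap.map_vecCons_smul _ _ _ _)
    (fun v w w' => by
      have h (x : V) : Function.update ![v, 0] 1 x = ![v, x] := by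
        ext i; fin_cases i <;> simp
      have := (exteriorPower.ιMulti ℂ 2 (M := V)).map_update_add ![v, 0] 1 w w'
      rwa [h, h, h] at this)
    (fun c v w => by
      have h (x : V) : Function.update ![v, 0] 1 x = ![v, x] := by
        ext i; fin_cases i <;> simp
      have := (exteriorPower.ιMulti ℂ 2 (M := V)).map_update_smul ![v, 0] 1 c w
      rwa [h, h] at this)

/-- For submodules `A`, `B` of `R ⊗ V`, the submodule `A ∧ B` of `R ⊗ ⋀² V` spanned by all the
products `a ∧ b`; in particular `wedgeSub V U U` is `⋀² U`. -/
def wedgeSub {R : CommAlgCat.{0} ℂ} (A B : Submodule R (R ⊗[ℂ] V)) :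
    Submodule R (R ⊗[ℂ] (⋀[ℂ]^2 V)) :=
  Submodule.map₂ (LinearMap.BilinMap.baseChange R (wedge V)) A B

variable {V}

lemma extendScalars_wedge {R S : CommAlgCat.{0} ℂ} (f : R ⟶ S) (x y : R ⊗[ℂ] V) :
    extendScalars f (LinearMap.BilinMap.baseChange R (wedge V) x y) =
      LinearMap.BilinMap.baseChange S (wedge V) (extendScalars f x) (extendScalars f y) := by
  induction x with
  | zero => simp
  | add x x' hx hx' => simp [hx, hx']
  | tmul a v =>
    induction y with
    | zero => simp
    | add y y' hy hy' => simp only [map_add, hy, hy']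
    | tmul b w => simp [extendScalars_tmul]

lemma wedgeSub_span {R S : CommAlgCat.{0} ℂ} (f : R ⟶ S) (A B : Submodule R (R ⊗[ℂ] V)) :
    wedgeSub V (Submodule.span S (extendScalars f '' A)) (Submodule.span S (extendScalars f '' B)) =
      Submodule.span S (extendScalars f '' (wedgeSub V A B)) := by
  unfold wedgeSub
  rw [Submodule.map₂_span_span]
  apply le_antisymm
  · refine Submodule.span_mono ?_
    rintro _ ⟨_, ⟨a, ha, rfl⟩, _, ⟨b, hb, rfl⟩, rfl⟩
    exact ⟨_, Submodule.apply_mem_map₂ _ ha hb, extendScalars_wedge f a b⟩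
  · rw [Submodule.span_le]
    rintro _ ⟨x, hx, rfl⟩
    rw [SetLike.mem_coe, Submodule.map₂_eq_span_image2] at hx
    induction hx using Submodule.span_induction with
    | mem x hx =>
      obtain ⟨a, ha, b, hb, rfl⟩ := hx
      exact Submodule.subset_span
        ⟨_, ⟨a, ha, rfl⟩, _, ⟨b, hb, rfl⟩, (extendScalars_wedge f a b).symm⟩
    | zero => simp
    | add x y _ _ hx hy => rw [map_add]; exact Submodule.add_mem _ hx hy
    | smul a x _ hx => rw [extendScalars_smul]; exact Submodule.smul_mem _ _ hx

end Wedge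

/-! ### Ordinary Gushel--Mukai varieties -/

section GM

variable (V : Type) [AddCommGroup V] [Module ℂ V]
  (W : Submodule ℂ (⋀[ℂ]^2 V)) (Q : QuadraticForm ℂ (⋀[ℂ]^2 V))

/-- `X = Gr(2, V) ∩ P(W) ∩ {Q = 0} ⊆ P(⋀² V)`, as a subscheme of `Gr(2, V)`: a rank-2 subbundle `U`
is a point of `X` when its Plücker image `⋀² U` lies in `W` and in the quadric `Q = 0`. -/
def gmSub : Subfunctor (Gr 2 V) where
  obj R := {U | wedgeSub V (toSub U) (toSub U) ≤ W.baseChange R ∧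
    ∀ x ∈ wedgeSub V (toSub U) (toSub U), Q.baseChange R x = 0}
  map {R S} f U hU := by
    refine ⟨?_, ?_⟩
    · rw [map_toSub_eq_span, wedgeSub_span, Submodule.span_le]
      rintro _ ⟨x, hx, rfl⟩
      exact extendScalars_mem_baseChange f W (hU.1 hx)
    · rw [map_toSub_eq_span, wedgeSub_span]
      exact quadratic_vanish f Q _ hU.2

/-- The scheme `X`, through its functor of points. -/
abbrev gm : CommAlgCat.{0} ℂ ⥤ Type := (gmSub V W Q).toFunctor

/-- The projectivization `P(𝒰_X)` of the tautological rank-2 bundle, as a subscheme of `X × P(V)`: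
its points are the pairs `(U, ℓ)` of a point `U` of `X` and a rank-1 subbundle `ℓ ⊆ U`. -/
def projTautSub : Subfunctor (FunctorToTypes.prod (gm V W Q) (PP V)) where
  obj R := {p | toSub p.2 ≤ toSub p.1.1}
  map f _ hp := map_mono f hp

/-- The scheme `P(𝒰_X)`, through its functor of points. -/
abbrev projTaut : CommAlgCat.{0} ℂ ⥤ Type := (projTautSub V W Q).toFunctor

/-- The projection `P(𝒰_X) → X`, `(U, ℓ) ↦ U`. -/
def projTautToGM : projTaut V W Q ⟶ gm V W Q :=
  (projTautSub V W Q).ι ≫ FunctorToTypes.prod.fst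

/-- The quadric fibration `ρ : P(𝒰_X) → P(V)`, `(U, ℓ) ↦ ℓ`. -/
def rho : projTaut V W Q ⟶ PP V :=
  (projTautSub V W Q).ι ≫ FunctorToTypes.prod.snd

/-- The map `X → P(⋀² V)`, `U ↦ ⋀² U`, on points. -/
def pluecker (R : CommAlgCat.{0} ℂ) (U : (gm V W Q).obj R) : Submodule R (R ⊗[ℂ] (⋀[ℂ]^2 V)) :=
  wedgeSub V (toSub U.1) (toSub U.1)

end GM

/-! ### Smoothness -/

/-- The functor of points of a scheme over `ℂ`, on commutative `ℂ`-algebras. -/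
def pointsFunctor (X : Scheme.{0}) (p : X ⟶ Spec (CommRingCat.of ℂ)) :
    CommAlgCat.{0} ℂ ⥤ Type where
  obj R := {x : Spec (CommRingCat.of R) ⟶ X //
    x ≫ p = Spec.map (CommRingCat.ofHom (algebraMap ℂ R))}
  map {R S} f := ↾fun x => ⟨Spec.map (CommRingCat.ofHom f.hom.toRingHom) ≫ x.1, by
    rw [Category.assoc, x.2, ← Spec.map_comp, ← CommRingCat.ofHom_comp]
    exact congrArg (fun g => Spec.map (CommRingCat.ofHom g)) f.hom.comp_algebraMap⟩
  map_id R := by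
    refine ConcreteCategory.hom_ext _ _ fun x => Subtype.ext ?_
    exact (congrArg (· ≫ x.1) (Spec.map_id _)).trans (Category.id_comp _)
  map_comp f g := by
    refine ConcreteCategory.hom_ext _ _ fun x => Subtype.ext ?_
    refine (congrArg (· ≫ x.1) ?_).trans (Category.assoc _ _ _)
    exact Spec.map_comp (CommRingCat.ofHom f.hom.toRingHom) (CommRingCat.ofHom g.hom.toRingHom)

/-- The functor `F` is (represented by) a scheme smooth of dimension `n` over `ℂ`. -/
def IsSmoothOfDim (n : ℕ) (F : CommAlgCat.{0} ℂ ⥤ Type) : Prop :=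
  ∃ (X : Scheme.{0}) (p : X ⟶ Spec (CommRingCat.of ℂ)),
    SmoothOfRelativeDimension n p ∧ Nonempty (pointsFunctor X p ≅ F)

/-! ### Relative Hilbert schemes of linear spaces -/

section Hilbert

variable {Y S : CommAlgCat.{0} ℂ ⥤ Type} (ρ : Y ⟶ S) {M : Type} [AddCommGroup M] [Module ℂ M]
  (h : ∀ R : CommAlgCat.{0} ℂ, Y.obj R → Submodule R (R ⊗[ℂ] M)) (r : ℕ)

/-- A point over `R` of the relative Hilbert scheme of linear `P^r`'s in the fibres of `ρ : Y → S`,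
where "linear" refers to a map `h : Y → P(M)`: a point `base` of `S` over `R`, and a subscheme
(`carrier`, given by its points `Spec R' → Y` over `Spec R' → Spec R`) of the fibre product
`Y ×_S Spec R`, which `h` maps isomorphically onto the linear subspace `P(span) ⊆ P(M) × Spec R`
for a rank-`(r+1)` subbundle `span` of the trivial bundle with fibre `M` on `Spec R`.  (The flat
families of `r`-dimensional linear subspaces of `P(M)` over `Spec R` are the `P(span)`, and `span` is
determined by `carrier`.) -/
@[ext]
structure LinearFamily (R : CommAlgCat.{0} ℂ) where
  base : S.obj R
  span : (Gr (r + 1) M).obj R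
  carrier : ∀ ⦃R' : CommAlgCat.{0} ℂ⦄, (R ⟶ R') → Set (Y.obj R')
  carrier_over : ∀ ⦃R' : CommAlgCat.{0} ℂ⦄ (f : R ⟶ R'), ∀ y ∈ carrier f,
    ρ.app R' y = S.map f base
  carrier_map : ∀ ⦃R' R'' : CommAlgCat.{0} ℂ⦄ (f : R ⟶ R') (g : R' ⟶ R''), ∀ y ∈ carrier f,
    Y.map g y ∈ carrier (f ≫ g)
  bijOn : ∀ ⦃R' : CommAlgCat.{0} ℂ⦄ (f : R ⟶ R'), Set.BijOn (h R') (carrier f)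
    {N | ∃ m : (PP M).obj R', toSub m ≤ toSub ((Gr (r + 1) M).map f span) ∧ N = toSub m}

variable {ρ h r} in
/-- Pullback of a family along `Spec R₁ → Spec R`. -/
def LinearFamily.pullback {R R₁ : CommAlgCat.{0} ℂ} (φ : R ⟶ R₁) (Z : LinearFamily ρ h r R) :
    LinearFamily ρ h r R₁ where
  base := S.map φ Z.base
  span := (Gr (r + 1) M).map φ Z.span
  carrier _ f := Z.carrier (φ ≫ f)
  carrier_over _ f y hy := by
    rw [Z.carrier_over _ y hy]; exact map_map_apply S _ _ _
  carrier_map _ _ f g y hy := by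
    rw [← Category.assoc]
    exact Z.carrier_map _ g y hy
  bijOn _ f := by
    rw [← map_map_apply]
    exact Z.bijOn (φ ≫ f)

/-- The relative Hilbert scheme of linear `P^r`'s in the fibres of `ρ : Y → S`. -/
def relHilb : CommAlgCat.{0} ℂ ⥤ Type 1 where
  obj R := LinearFamily ρ h r R
  map φ := ↾LinearFamily.pullback φ
  map_id R := by
    refine ConcreteCategory.hom_ext _ _ fun Z => LinearFamily.ext ?_ ?_ ?_
    · exact map_one_apply S Z.base
    · exact map_one_apply (Gr (r + 1) M) Z.span
    · funext R' f
      exact congrArg (Z.carrier (R' := R')) (Category.id_comp f)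
  map_comp φ ψ := by
    refine ConcreteCategory.hom_ext _ _ fun Z => LinearFamily.ext ?_ ?_ ?_
    · exact map_map_apply S φ ψ Z.base
    · exact map_map_apply (Gr (r + 1) M) φ ψ Z.span
    · funext R' f
      exact congrArg (Z.carrier (R' := R')) (Category.assoc φ ψ f)

/-- The structure morphism of the relative Hilbert scheme. -/
def relHilbToBase : relHilb ρ h r ⟶ S ⋙ uliftFunctor.{1} where
  app R := ↾fun Z => ⟨Z.base⟩

end Hilbert

section Fano

variable (V : Type) [AddCommGroup V] [Module ℂ V]
  (W : Submodule ℂ (⋀[ℂ]^2 V)) (Q : QuadraticForm ℂ (⋀[ℂ]^2 V)) (r : ℕ)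

/-- The structure morphism of `X`, with values in the terminal functor `Spec ℂ`. -/
def gmToPoint : gm V W Q ⟶ (Functor.const _).obj PUnit.{1} where
  app R := ↾fun _ => PUnit.unit

/-- The Hilbert scheme of linear `P^r`'s in `X ⊆ P(⋀² V)`. -/
abbrev hilbGM : CommAlgCat.{0} ℂ ⥤ Type 1 := relHilb (gmToPoint V W Q) (pluecker V W Q) r

/-- The locus `F_r(X)` of linear spaces of `σ`-type: over each geometric point, the linear space is
`P(V₁ ∧ V_{r+2})` for some flag `V₁ ⊆ V_{r+2} ⊆ V` of subspaces of dimensions `1` and `r + 2`. -/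
def fanoSub : Subfunctor (hilbGM V W Q r) where
  obj R := {Z | ∀ (K : Type) [Field K] [IsAlgClosed K] [Algebra ℂ K] (f : R ⟶ CommAlgCat.of ℂ K),
    ∃ (V₁ : (PP V).obj (CommAlgCat.of ℂ K)) (V₂ : (Gr (r + 2) V).obj (CommAlgCat.of ℂ K)),
      toSub V₁ ≤ toSub V₂ ∧
      toSub ((Gr (r + 1) _).map f (LinearFamily.span Z)) = wedgeSub V (toSub V₁) (toSub V₂)}
  map {R R₁} φ Z hZ K _ _ _ f := by
    obtain ⟨V₁, V₂, h, e⟩ := hZ K (φ ≫ f)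
    refine ⟨V₁, V₂, h, ?_⟩
    rw [← e, map_map_apply]
    rfl

/-- The Hilbert scheme `F_r(X)` of linear `P^r`'s of `σ`-type in `X`. -/
abbrev fano : CommAlgCat.{0} ℂ ⥤ Type 1 := (fanoSub V W Q r).toFunctor

/-- The relative Hilbert scheme `Hilb^{P^r}(P(𝒰_X)/P(V))` of linear `P^r`'s in the fibres of `ρ`. The
fibre of `ρ` over `ℓ` is mapped to `P(⋀² V)` by `(U, ℓ) ↦ ⋀² U`. -/
abbrev hilbRho : CommAlgCat.{0} ℂ ⥤ Type 1 :=
  relHilb (rho V W Q) (fun R y => pluecker V W Q R ((projTautToGM V W Q).app R y)) r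

/-- The structure morphism of `Hilb^{P^r}(P(𝒰_X)/P(V))` to `P(V)`. -/
abbrev hilbRhoToPP : hilbRho V W Q r ⟶ PP V ⋙ uliftFunctor.{1} := relHilbToBase _ _ _

end Fano

end

end GushelMukai

namespace GushelMukai

noncomputable section

/-! ### Common zeros of homogeneous polynomials satisfying a syzygy -/

section Syzygy

open MvPolynomial

/-! The isomorphism. A σ-type family over `R` is a subbundle `E` of `R ⊗ ⋀² V`, and what has to be
produced is its vertex: a line subbundle `V₁` with `E ≤ V₁ ∧ V`. Over a local ring every line in `E`
is the Plücker image of a plane, so the polarized Plücker forms vanish on `E`, and two basis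
bivectors share a factor `v` (`exists_common_factor`). For `r = 1` that is all. For `r ≥ 2` the
σ-type condition at the closed point rules out the net `⋀² ⟨v, a, b⟩`, and the Plücker relations
then force `v` to divide all of `E` (`exists_vertex_of_isLocalRing`). The local vertices glue
because `vertexSub` recovers `v` from `E` by a formula compatible with base change, and the vertex
is unique (`vertex_unique`), which makes it functorial. A plane whose Plücker line lies in `V₁ ∧ V`
contains `V₁`, so each point of the family lifts uniquely to `P(𝒰_X)` over `V₁`. Conversely, a
family in the fibres of `ρ` is divisible by its base, hence equals `V₁ ∧ V₂` for a flag
(`exists_flag`) and is of σ-type.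

The emptiness. Smoothness of dimension `n` bounds tangent spaces: `n + 1` first-order deformations
of a point are dependent (`IsSmoothOfDim.exists_functional`). Hence `X` is a transverse intersection
at each field-valued point (`transverse`): at `p = v ∧ a`, no nonzero combination of an equation `ω`
of `W` and the differential of `Q` vanishes on all `x ∧ a + v ∧ y`. A linear space `v ∧ H` in `X`
with `H` too large always contains a point violating this. For `F₃`, `H = V`, and the task is to
find `z` in `V / v` with `B(v ∧ z, x ∧ z) = 0` for all `x`. These are four quadrics `q_i` on `P³`
satisfying `∑ x_i q_i = 0`. For `F₂` with `n = 3`, the equations of `W` form a pencil. Either a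
degenerate alternating form in the pencil gives the point, or eliminating one unknown leaves three
forms of degrees 2, 3, 3 on `P²` with a similar syzygy.

Both systems have a nontrivial zero by `exists_common_zero_of_syzygy`. That is proved by deforming
to a model system with a nondegenerate zero, lifting this zero formally in the parameter `u`, and
specializing to `u = 1`: elimination theory in the form of Nakayama's lemma says that absence of a
zero at `u = 1` would forbid formal solutions at `u = 0`. -/

lemma dvd_aeval_sub_aeval {σ K A : Type*} [CommRing K] [CommRing A] [Algebra K A]
    {c : A} {a b : σ → A} (h : ∀ i, c ∣ a i - b i) (q : MvPolynomial σ K) :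
    c ∣ aeval a q - aeval b q := by
  induction q using MvPolynomial.induction_on with
  | C r => simp
  | add p q hp hq =>
    rw [map_add, map_add, add_sub_add_comm]
    exact dvd_add hp hq
  | mul_X p i hp =>
    have e : aeval a (p * X i) - aeval b (p * X i) =
        (aeval a p - aeval b p) * a i + aeval b p * (a i - b i) := by
      simp only [map_mul, aeval_X]; ring
    rw [e]
    exact dvd_add (hp.mul_right _) ((h i).mul_left _)

variable {K : Type*} [Field K] {σ : Type*}

/-- The module of forms of degree `N`, as the span of the monomials. -/
def formSpan (σ R : Type*) [CommRing R] (N : ℕ) : Submodule R (MvPolynomial σ R) :=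
  Submodule.span R ((fun α => monomial α (1 : R)) '' {α | α.degree = N})

lemma formSpan_fg [Finite σ] (R : Type*) [CommRing R] (N : ℕ) : (formSpan σ R N).FG := by
  refine Submodule.fg_span (Set.Finite.image _ ?_)
  refine (Finsupp.finite_of_degree_le (σ := σ) N).subset fun α hα => ?_
  exact le_of_eq hα

lemma mem_formSpan {R : Type*} [CommRing R] {N : ℕ} {p : MvPolynomial σ R}
    (hp : p.IsHomogeneous N) : p ∈ formSpan σ R N := by
  rw [← support_sum_monomial_coeff p]
  refine Submodule.sum_mem _ fun α hα => ?_
  have : monomial α (coeff α p) = coeff α p • monomial α (1 : R) := by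
    rw [smul_monomial, smul_eq_mul, mul_one]
  rw [this]
  refine Submodule.smul_mem _ _ (Submodule.subset_span ⟨α, ?_, rfl⟩)
  by_contra h
  exact mem_support_iff.1 hα (hp.coeff_eq_zero h)

/-- Graded Nullstellensatz: without a common nontrivial zero, all monomials of some degree lie in
the ideal. -/
lemma exists_monomial_mem_span [Finite σ] [IsAlgClosed K] {ι : Type*} (P : ι → MvPolynomial σ K)
    (h : ∀ a : σ → K, (∀ j, eval a (P j) = 0) → a = 0) :
    ∃ N : ℕ, ∀ α : σ →₀ ℕ, α.degree = N → monomial α 1 ∈ Ideal.span (Set.range P) := by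
  have h1 : Ideal.span (Set.range (X : σ → MvPolynomial σ K)) ≤
      (Ideal.span (Set.range P)).radical := by
    rw [← vanishingIdeal_zeroLocus_eq_radical (K := K), Ideal.span_le]
    rintro _ ⟨i, rfl⟩
    rw [SetLike.mem_coe, mem_vanishingIdeal_iff]
    intro a ha
    rw [mem_zeroLocus_iff] at ha
    have : a = 0 := h a fun j => by
      have := ha (P j) (Ideal.subset_span ⟨j, rfl⟩)
      rwa [aeval_eq_eval] at this
    simp [this]
  obtain ⟨N, hN⟩ := Ideal.exists_pow_le_of_le_radical_of_fg h1
    (Submodule.fg_span (Set.finite_range _))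
  refine ⟨N, fun α hα => hN ?_⟩
  have : (monomial α (1 : K)) = ∏ i ∈ α.support, (X i) ^ α i := by
    rw [monomial_eq]; simp [Finsupp.prod]
  rw [this, ← hα, Finsupp.degree_apply, ← Finset.prod_pow_eq_pow_sum]
  exact Ideal.prod_mem_prod fun i _ => Ideal.pow_mem_pow
    (Ideal.subset_span (Set.mem_range_self i)) _

/-- If a pencil of systems of forms has approximate solutions at `u = 0` to any order, then its
member at `u = 1` has a nontrivial zero. -/
lemma exists_zero_of_approx [Finite σ] [IsAlgClosed K] {ι : Type*} [Fintype ι] (P P₀ : ι → MvPolynomial σ K)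
    (d : ι → ℕ) (hP : ∀ j, (P j).IsHomogeneous (d j)) (hP₀ : ∀ j, (P₀ j).IsHomogeneous (d j))
    (i₀ : σ) (β : ℕ → σ → Polynomial K) (hβ : ∀ m, β m i₀ = 1)
    (happ : ∀ m j, Polynomial.X ^ m ∣
      (1 - Polynomial.X) * aeval (β m) (P₀ j) + Polynomial.X * aeval (β m) (P j)) :
    ∃ a : σ → K, a ≠ 0 ∧ ∀ j, eval a (P j) = 0 := by
  classical
  let _ := MvPolynomial.gradedAlgebra (σ := σ) (R := Polynomial K)
  by_contra hcon
  obtain ⟨N, hN⟩ := exists_monomial_mem_span P fun a ha => by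
    by_contra h0
    exact hcon ⟨a, h0, ha⟩
  let u : Polynomial K := Polynomial.X
  let f : MvPolynomial σ K →+* MvPolynomial σ (Polynomial K) := map Polynomial.C
  let G : ι → MvPolynomial σ (Polynomial K) := fun j => C (1 - u) * f (P₀ j) + C u * f (P j)
  have hf {q : MvPolynomial σ K} {n : ℕ} (hq : q.IsHomogeneous n) : (f q).IsHomogeneous n :=
    hq.map _
  have hC (c : Polynomial K) {q : MvPolynomial σ (Polynomial K)} {n : ℕ} (hq : q.IsHomogeneous n) :
      (C c * q).IsHomogeneous n := by
    have := (isHomogeneous_C σ c).mul hq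
    rwa [zero_add] at this
  have hG (j) : (G j).IsHomogeneous (d j) := (hC _ (hf (hP₀ j))).add (hC _ (hf (hP j)))
  have hhom : (Ideal.span (Set.range G)).IsHomogeneous (homogeneousSubmodule σ (Polynomial K)) := by
    refine Ideal.homogeneous_span _ _ ?_
    rintro _ ⟨j, rfl⟩
    exact ⟨d j, hG j⟩
  -- Modulo `1 - u` the pencil is the system `P`, whose ideal contains all monomials of degree `N`.
  -- Taking degree-`N` components stays inside a finitely generated module, as Nakayama requires.
  have key : formSpan σ (Polynomial K) N ≤
      (Ideal.span (Set.range G)).restrictScalars (Polynomial K) ⊔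
        Ideal.span {1 - u} • formSpan σ (Polynomial K) N := by
    rw [formSpan, Submodule.span_le]
    rintro _ ⟨α, hα, rfl⟩
    obtain ⟨h, hh⟩ := (Ideal.mem_span_range_iff_exists_fun).1 (hN α hα)
    have e1 : monomial α (1 : Polynomial K) = f (monomial α 1) := by
      simp [f, map_monomial]
    have e2 : monomial α (1 : Polynomial K) = ∑ j, f (h j) * G j +
        (1 - u) • ∑ j, f (h j) * (f (P j) - f (P₀ j)) := by
      rw [e1, ← hh, map_sum, smul_eq_C_mul, Finset.mul_sum, ← Finset.sum_add_distrib]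
      refine Finset.sum_congr rfl fun j _ => ?_
      simp only [G, map_mul, map_sub, map_one]
      ring
    have e3 := congrArg (homogeneousComponent N) e2
    rw [homogeneousComponent_eq_self (by
      refine isHomogeneous_monomial _ ?_; exact hα), map_add, map_smul] at e3
    dsimp only
    rw [SetLike.mem_coe, e3]
    refine Submodule.add_mem_sup ?_ ?_
    · refine homogeneousComponent_mem_of_mem hhom ?_ _
      exact Ideal.sum_mem _ fun j _ => Ideal.mul_mem_left _ _ (Ideal.subset_span ⟨j, rfl⟩)
    · refine Submodule.smul_mem_smul (Ideal.mem_span_singleton_self _) ?_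
      exact mem_formSpan (homogeneousComponent_isHomogeneous _ _)
  -- Nakayama: `D ≡ 1` modulo `1 - u`, and `D` multiplies every form of degree `N` into the ideal of
  -- the pencil. Evaluating `D x_{i₀} ^ N` at the approximate solutions, where `x_{i₀} = 1`, shows
  -- that every power of `u` divides `D`; so `D = 0`, although its value at `u = 1` is `1`.
  obtain ⟨D, hD, hDle⟩ := Submodule.exists_sub_one_mem_and_smul_le_of_fg_of_le_sup
    (formSpan_fg _ N) le_rfl key
  have h1 : D • monomial (Finsupp.single i₀ N) (1 : Polynomial K) ∈ Ideal.span (Set.range G) := by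
    refine hDle (Submodule.smul_mem_pointwise_smul _ _ _ (Submodule.subset_span ⟨_, ?_, rfl⟩))
    simp
  have h2 (m : ℕ) : u ^ m ∣ D := by
    have := Ideal.mem_map_of_mem (aeval (β m) : MvPolynomial σ (Polynomial K) →ₐ[Polynomial K] _) h1
    rw [Ideal.map_span, map_smul, aeval_monomial] at this
    simp only [Finsupp.prod_single_index, pow_zero, hβ, one_pow, map_one, mul_one,
      smul_eq_mul] at this
    rw [← Ideal.mem_span_singleton]
    refine (Ideal.span_le.2 ?_) this
    rintro _ ⟨_, ⟨j, rfl⟩, rfl⟩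
    rw [SetLike.mem_coe, Ideal.mem_span_singleton]
    have e (q : MvPolynomial σ K) : aeval (β m) (f q) = aeval (β m) q := by
      exact aeval_map_algebraMap (Polynomial K) (β m) q
    have := happ m j
    simp only [G, map_add, map_mul, e]
    simpa [u] using this
  have h3 : D = 0 := by
    by_contra h0
    have := Polynomial.degree_le_of_dvd (h2 (D.natDegree + 1)) h0
    rw [Polynomial.degree_X_pow, Polynomial.degree_eq_natDegree h0] at this
    norm_cast at this
    omega
  rw [h3, Ideal.mem_span_singleton] at hD
  have := (Polynomial.eval_dvd (x := (1 : K)) hD)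
  simp [u] at this

/-- A system of `k + 1` forms `P₀, …, P_k` in `k + 1` variables with the syzygy
`x₀ ^ s P₀ + ∑ xᵢ Pᵢ = 0` has a nontrivial zero. -/
theorem exists_common_zero_of_syzygy [IsAlgClosed K] (k s : ℕ)
    (P : Fin (k + 1) → MvPolynomial (Fin (k + 1)) K) (h0 : (P 0).IsHomogeneous 2)
    (hi : ∀ i : Fin k, (P i.succ).IsHomogeneous (s + 1))
    (hrel : X 0 ^ s * P 0 + ∑ i : Fin k, X i.succ * P i.succ = 0) :
    ∃ a : Fin (k + 1) → K, a ≠ 0 ∧ ∀ j, eval a (P j) = 0 := by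
  classical
  -- A model system with the same degrees and the same syzygy. In the chart `x₀ = 1` its last `k`
  -- equations read `xᵢ = 0`, so the zero `(1, 0, …, 0)` is nondegenerate.
  let P₀ : Fin (k + 1) → MvPolynomial (Fin (k + 1)) K :=
    Fin.cons (-∑ i : Fin k, X i.succ ^ 2) fun i => X 0 ^ s * X i.succ
  -- With `b₀ = 1`, the equation `(1 - u) bᵢ + u Pᵢ(b) = 0` is the fixed-point equation `bᵢ = u (bᵢ
  -- - Pᵢ(b))`. Its right side is a contraction for the `u`-adic topology, so iteration gives
  -- solutions modulo any power of `u`.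
  let step : (Fin (k + 1) → Polynomial K) → (Fin (k + 1) → Polynomial K) := fun b =>
    Fin.cons 1 fun i => Polynomial.X * (b i.succ - aeval b (P i.succ))
  let β : ℕ → (Fin (k + 1) → Polynomial K) := fun m => step^[m] (Fin.cons 1 0)
  have hβs (m) : β (m + 1) = step (β m) := Function.iterate_succ_apply' _ _ _
  have hβ (m) : β m 0 = 1 := by
    cases m with
    | zero => rfl
    | succ m => rw [hβs]; rfl
  have hdiff (m) : ∀ i, Polynomial.X ^ (m + 1) ∣ β (m + 1) i - β m i := by
    induction m with
    | zero =>
      intro i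
      refine Fin.cases ?_ (fun i => ?_) i
      · simp [hβ]
      · rw [hβs]
        simp [β, step]
    | succ m ih =>
      intro i
      refine Fin.cases ?_ (fun i => ?_) i
      · simp [hβ]
      · rw [hβs, hβs m]
        have : step (step (β m)) i.succ - step (β m) i.succ =
            Polynomial.X * ((β (m + 1) i.succ - β m i.succ) -
              (aeval (β (m + 1)) (P i.succ) - aeval (β m) (P i.succ))) := by
          rw [hβs]
          simp only [step, Fin.cons_succ]
          ring
        rw [this, pow_succ' _ (m + 1)]
        exact mul_dvd_mul_left _ (dvd_sub (ih _) (dvd_aeval_sub_aeval ih _))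
  have hsucc (m) (i : Fin k) : Polynomial.X ^ m ∣
      (1 - Polynomial.X) * aeval (β m) (P₀ i.succ) + Polynomial.X * aeval (β m) (P i.succ) := by
    have e : (1 - Polynomial.X) * aeval (β m) (P₀ i.succ) +
        Polynomial.X * aeval (β m) (P i.succ) = -(β (m + 1) i.succ - β m i.succ) := by
      rw [hβs]
      simp only [P₀, step, Fin.cons_succ, map_mul, map_pow, aeval_X, hβ, one_pow, one_mul]
      ring
    rw [e, dvd_neg]
    exact (pow_dvd_pow _ (Nat.le_succ m)).trans (hdiff m i.succ)
  refine exists_zero_of_approx P P₀ (Fin.cons 2 fun _ => s + 1) ?_ ?_ 0 β hβ ?_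
  · exact fun j => Fin.cases h0 hi j
  · intro j
    refine Fin.cases ?_ (fun i => ?_) j
    · refine IsHomogeneous.neg (IsHomogeneous.sum _ _ _ fun i _ => ?_)
      simpa using (isHomogeneous_X K i.succ).pow 2
    · have := ((isHomogeneous_X K (0 : Fin (k + 1))).pow s).mul (isHomogeneous_X K i.succ)
      simpa [P₀] using this
  · intro m j
    -- At `b₀ = 1` the syzygy expresses the equation of index `0` through the others, so it is
    -- solved to the same order.
    refine Fin.cases ?_ (fun i => hsucc m i) j
    have e := congrArg (aeval (β m)) hrel
    simp only [map_add, map_mul, map_pow, aeval_X, hβ, one_pow, one_mul, map_sum, map_zero] at e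
    have : (1 - Polynomial.X) * aeval (β m) (P₀ 0) + Polynomial.X * aeval (β m) (P 0) =
        -∑ i : Fin k, β m i.succ * ((1 - Polynomial.X) * aeval (β m) (P₀ i.succ) +
          Polynomial.X * aeval (β m) (P i.succ)) := by
      rw [eq_neg_of_add_eq_zero_left e]
      simp only [P₀, Fin.cons_zero, Fin.cons_succ, map_neg, map_sum, map_mul, map_pow, aeval_X, hβ,
        one_pow, one_mul, mul_neg, Finset.mul_sum, ← neg_add, ← Finset.sum_add_distrib]
      congr 1
      refine Finset.sum_congr rfl fun i _ => ?_
      ring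
    rw [this, dvd_neg]
    exact Finset.dvd_sum fun i _ => (hsucc m i).mul_left _

end Syzygy

end

end GushelMukai

namespace GushelMukai

noncomputable section

/-! ### Extension of scalars of submodules -/

section ExtSub

variable {M N P : Type} [AddCommGroup M] [Module ℂ M] [AddCommGroup N] [Module ℂ N]
  [AddCommGroup P] [Module ℂ P] {R S T : CommAlgCat.{0} ℂ}

/-- The submodule of `S ⊗ M` spanned by the image of a submodule of `R ⊗ M`. -/
def extSub (f : R ⟶ S) (A : Submodule R (R ⊗[ℂ] M)) : Submodule S (S ⊗[ℂ] M) :=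
  Submodule.span S (extendScalars f '' A)

lemma toSub_map {k : ℕ} (f : R ⟶ S) (A : (Gr k M).obj R) :
    toSub ((Gr k M).map f A) = extSub f (toSub A) :=
  map_toSub_eq_span k f A

lemma mem_extSub (f : R ⟶ S) {A : Submodule R (R ⊗[ℂ] M)} {x : R ⊗[ℂ] M} (hx : x ∈ A) :
    extendScalars f x ∈ extSub f A :=
  Submodule.subset_span ⟨x, hx, rfl⟩

lemma extSub_le {f : R ⟶ S} {A : Submodule R (R ⊗[ℂ] M)} {B : Submodule S (S ⊗[ℂ] M)} :
    extSub f A ≤ B ↔ ∀ x ∈ A, extendScalars f x ∈ B := by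
  rw [extSub, Submodule.span_le, Set.image_subset_iff]; rfl

lemma extSub_mono (f : R ⟶ S) {A B : Submodule R (R ⊗[ℂ] M)} (h : A ≤ B) :
    extSub f A ≤ extSub f B :=
  Submodule.span_mono (Set.image_mono h)

lemma extendScalars_id (x : R ⊗[ℂ] M) : extendScalars (𝟙 R) x = x := by
  induction x with
  | zero => simp
  | tmul a m => rfl
  | add x y hx hy => rw [map_add, hx, hy]

lemma extendScalars_comp (f : R ⟶ S) (g : S ⟶ T) (x : R ⊗[ℂ] M) :
    extendScalars (f ≫ g) x = extendScalars g (extendScalars f x) := by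
  induction x with
  | zero => simp
  | tmul a m => rfl
  | add x y hx hy => simp only [map_add, hx, hy]

lemma extSub_span (f : R ⟶ S) (s : Set (R ⊗[ℂ] M)) :
    extSub f (Submodule.span R s) = Submodule.span S (extendScalars f '' s) := by
  refine le_antisymm (extSub_le.2 fun x hx => ?_) (Submodule.span_mono
    (Set.image_mono Submodule.subset_span))
  induction hx using Submodule.span_induction with
  | mem x hx => exact Submodule.subset_span ⟨x, hx, rfl⟩
  | zero => simp
  | add x y _ _ hx hy => rw [map_add]; exact Submodule.add_mem _ hx hy
  | smul a x _ hx => rw [extendScalars_smul]; exact Submodule.smul_mem _ _ hx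

lemma extSub_extSub (f : R ⟶ S) (g : S ⟶ T) (A : Submodule R (R ⊗[ℂ] M)) :
    extSub g (extSub f A) = extSub (f ≫ g) A := by
  refine (extSub_span g _).trans ?_
  rw [extSub, ← Set.image_comp]
  congr 1
  exact Set.image_congr fun x _ => (extendScalars_comp f g x).symm

lemma extSub_iSup {ι : Sort*} (f : R ⟶ S) (A : ι → Submodule R (R ⊗[ℂ] M)) :
    extSub f (⨆ i, A i) = ⨆ i, extSub f (A i) := by
  refine le_antisymm (extSub_le.2 fun x hx => ?_)
    (iSup_le fun i => extSub_mono f (le_iSup A i))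
  induction hx using Submodule.iSup_induction' with
  | mem i x hx => exact (le_iSup (fun i => extSub f (A i)) i) (mem_extSub f hx)
  | zero => simp
  | add x y _ _ hx hy => rw [map_add]; exact Submodule.add_mem _ hx hy

lemma extSub_top (f : R ⟶ S) : extSub f (⊤ : Submodule R (R ⊗[ℂ] M)) = ⊤ := by
  refine top_unique fun x _ => ?_
  induction x with
  | zero => exact Submodule.zero_mem _
  | add x y hx hy => exact Submodule.add_mem _ (hx trivial) (hy trivial)
  | tmul a m =>
    have : a ⊗ₜ[ℂ] m = a • extendScalars f ((1 : R) ⊗ₜ[ℂ] m) := by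
      rw [extendScalars_tmul, map_one, TensorProduct.smul_tmul', smul_eq_mul, mul_one]
    rw [this]
    exact Submodule.smul_mem _ _ (mem_extSub f trivial)

lemma extSub_map (f : R ⟶ S) (c : R ⊗[ℂ] M →ₗ[R] R ⊗[ℂ] N) (c' : S ⊗[ℂ] M →ₗ[S] S ⊗[ℂ] N)
    (h : ∀ x, extendScalars f (c x) = c' (extendScalars f x)) (A : Submodule R (R ⊗[ℂ] M)) :
    extSub f (A.map c) = (extSub f A).map c' := by
  rw [extSub, extSub, Submodule.map_span, ← Set.image_comp, Submodule.map_coe, ← Set.image_comp]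
  congr 1
  exact Set.image_congr fun x _ => h x

lemma extSub_map₂ (f : R ⟶ S) (c : R ⊗[ℂ] M →ₗ[R] R ⊗[ℂ] N →ₗ[R] R ⊗[ℂ] P)
    (c' : S ⊗[ℂ] M →ₗ[S] S ⊗[ℂ] N →ₗ[S] S ⊗[ℂ] P)
    (h : ∀ x y, extendScalars f (c x y) = c' (extendScalars f x) (extendScalars f y))
    (A : Submodule R (R ⊗[ℂ] M)) (B : Submodule R (R ⊗[ℂ] N)) :
    extSub f (Submodule.map₂ c A B) = Submodule.map₂ c' (extSub f A) (extSub f B) := by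
  rw [extSub.eq_1 f A, extSub.eq_1 f B, Submodule.map₂_span_span, Submodule.map₂_eq_span_image2]
  refine (extSub_span f _).trans ?_
  congr 1
  ext z
  constructor
  · rintro ⟨_, ⟨a, ha, b, hb, rfl⟩, rfl⟩
    exact ⟨_, ⟨a, ha, rfl⟩, _, ⟨b, hb, rfl⟩, (h a b).symm⟩
  · rintro ⟨_, ⟨a, ha, rfl⟩, _, ⟨b, hb, rfl⟩, rfl⟩
    exact ⟨_, ⟨a, ha, b, hb, rfl⟩, h a b⟩

lemma extSub_wedgeSub (f : R ⟶ S) (A B : Submodule R (R ⊗[ℂ] M)) :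
    extSub f (wedgeSub M A B) = wedgeSub M (extSub f A) (extSub f B) :=
  extSub_map₂ f _ _ (extendScalars_wedge f) A B

end ExtSub

/-! ### Linear functionals and their base change -/

section Functionals

variable {M : Type} [AddCommGroup M] [Module ℂ M] {R S : CommAlgCat.{0} ℂ}

/-- The base change of a linear functional. -/
def extDual (f : R ⟶ S) (φ : Module.Dual R (R ⊗[ℂ] M)) : Module.Dual S (S ⊗[ℂ] M) :=
  LinearMap.liftBaseChange S
    (f.hom.toLinearMap ∘ₗ φ.restrictScalars ℂ ∘ₗ TensorProduct.mk ℂ R M 1)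

lemma extDual_extendScalars (f : R ⟶ S) (φ : Module.Dual R (R ⊗[ℂ] M)) (x : R ⊗[ℂ] M) :
    extDual f φ (extendScalars f x) = f.hom (φ x) := by
  induction x with
  | zero => simp
  | add x y hx hy => simp only [map_add, hx, hy]
  | tmul a m =>
    have : a ⊗ₜ[ℂ] m = a • ((1 : R) ⊗ₜ[ℂ] m) := by
      rw [TensorProduct.smul_tmul', smul_eq_mul, mul_one]
    conv_rhs => rw [this, map_smul, smul_eq_mul, map_mul]
    simp [extendScalars_tmul, extDual]

/-- A basis of a finite dimensional space. -/
def stdBasis (M : Type) [AddCommGroup M] [Module ℂ M] [Module.Finite ℂ M] :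
    Module.Basis (Fin (Module.finrank ℂ M)) ℂ M :=
  Module.finBasis ℂ M

/-- The basis of `R ⊗ M` given by a basis of `M`. -/
def stdBasisExt (R : CommAlgCat.{0} ℂ) (M : Type) [AddCommGroup M] [Module ℂ M]
    [Module.Finite ℂ M] : Module.Basis (Fin (Module.finrank ℂ M)) R (R ⊗[ℂ] M) :=
  Algebra.TensorProduct.basis R (stdBasis M)

lemma extendScalars_stdBasisExt [Module.Finite ℂ M] (f : R ⟶ S) (i) :
    extendScalars f (stdBasisExt R M i) = stdBasisExt S M i := by
  simp [stdBasisExt, extendScalars_tmul]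

/-- The coordinate functionals on `R ⊗ M`. -/
def coordExt (R : CommAlgCat.{0} ℂ) (M : Type) [AddCommGroup M] [Module ℂ M]
    [Module.Finite ℂ M] (i : Fin (Module.finrank ℂ M)) : Module.Dual R (R ⊗[ℂ] M) :=
  (stdBasisExt R M).coord i

lemma extDual_coordExt [Module.Finite ℂ M] (f : R ⟶ S) (i) :
    extDual f (coordExt R M i) = coordExt S M i := by
  refine (stdBasisExt S M).ext fun j => ?_
  rw [← extendScalars_stdBasisExt f, extDual_extendScalars, extendScalars_stdBasisExt]
  simp only [coordExt, Module.Basis.coord_apply, Module.Basis.repr_self, Finsupp.single_apply]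
  split_ifs <;> simp

lemma coordExt_extendScalars [Module.Finite ℂ M] (f : R ⟶ S) (i) (x : R ⊗[ℂ] M) :
    coordExt S M i (extendScalars f x) = f.hom (coordExt R M i x) := by
  rw [← extDual_coordExt f, extDual_extendScalars]

lemma dual_eq_sum_coordExt [Module.Finite ℂ M] (φ : Module.Dual R (R ⊗[ℂ] M)) :
    φ = ∑ i, φ (stdBasisExt R M i) • coordExt R M i := by
  refine (stdBasisExt R M).ext fun j => ?_
  simp [coordExt]

lemma eq_of_coordExt [Module.Finite ℂ M] {x y : R ⊗[ℂ] M}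
    (h : ∀ i, coordExt R M i x = coordExt R M i y) : x = y :=
  (stdBasisExt R M).ext_elem h

end Functionals

/-! ### Families with a dual family -/

section Split

/-- A finite family in a module is split when it has a dual family of functionals, that is, when it
is a basis of a free direct summand. -/
def IsSplit {R P : Type*} [CommRing R] [AddCommGroup P] [Module R P] {k : ℕ} (e : Fin k → P) :
    Prop :=
  ∃ d : Fin k → Module.Dual R P, ∀ i j, d i (e j) = if i = j then 1 else 0

variable {M : Type} [AddCommGroup M] [Module ℂ M] {R S : CommAlgCat.{0} ℂ} {k : ℕ}

/-- Linear independence over a ring may be lost under base change; a dual family is not, since the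
base changes of its functionals are again dual. -/
lemma IsSplit.ext (f : R ⟶ S) {e : Fin k → R ⊗[ℂ] M} (h : IsSplit (R := R) e) :
    IsSplit (R := S) fun i => extendScalars f (e i) := by
  obtain ⟨d, hd⟩ := h
  refine ⟨fun i => extDual f (d i), fun i j => ?_⟩
  rw [extDual_extendScalars, hd]
  split_ifs <;> simp

lemma IsSplit.linearIndependent {R P : Type*} [CommRing R] [AddCommGroup P] [Module R P]
    {e : Fin k → P} (h : IsSplit (R := R) e) : LinearIndependent R e := by
  obtain ⟨d, hd⟩ := h
  rw [Fintype.linearIndependent_iff]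
  intro g hg i
  have := congrArg (d i) hg
  simpa [map_sum, hd] using this

lemma IsSplit.comp {R P : Type*} [CommRing R] [AddCommGroup P] [Module R P] {l : ℕ}
    {e : Fin k → P} (h : IsSplit (R := R) e) (g : Fin l → Fin k) (hg : Function.Injective g) :
    IsSplit (R := R) fun i => e (g i) := by
  obtain ⟨d, hd⟩ := h
  exact ⟨fun i => d (g i), fun i j => by rw [hd]; simp [hg.eq_iff]⟩

/-- The span of a split family is a point of the Grassmannian. -/
lemma IsSplit.exists_gr [Module.Finite ℂ M] {e : Fin k → R ⊗[ℂ] M} (h : IsSplit (R := R) e) :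
    ∃ N : (Gr k M).obj R, toSub N = Submodule.span R (Set.range e) := by
  obtain ⟨d, hd⟩ := h
  let A := Submodule.span R (Set.range e)
  let π : R ⊗[ℂ] M →ₗ[R] R ⊗[ℂ] M := ∑ i, (d i).smulRight (e i)
  have hπ (x) : π x = ∑ i, d i x • e i := by simp [π, LinearMap.sum_apply]
  have hπA (x) : π x ∈ A := by
    rw [hπ]
    exact Submodule.sum_mem _ fun i _ => Submodule.smul_mem _ _ (Submodule.subset_span ⟨i, rfl⟩)
  have hπe {x} (hx : x ∈ A) : π x = x := by
    induction hx using Submodule.span_induction with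
    | mem x hx => obtain ⟨j, rfl⟩ := hx; simp [hπ, hd]
    | zero => simp
    | add x y _ _ hx hy => rw [map_add, hx, hy]
    | smul a x _ hx => rw [map_smul, hx]
  let s : ((R ⊗[ℂ] M) ⧸ A) →ₗ[R] R ⊗[ℂ] M := A.liftQ (LinearMap.id - π) fun x hx => by
    simp [hπe hx]
  have hs : A.mkQ ∘ₗ s = LinearMap.id := by
    refine LinearMap.ext fun x => ?_
    obtain ⟨x, rfl⟩ := Submodule.mkQ_surjective _ x
    simp only [s, LinearMap.comp_apply, Submodule.mkQ_apply, Submodule.liftQ_apply,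
      LinearMap.sub_apply, LinearMap.id_apply, Submodule.Quotient.mk_sub]
    rw [(Submodule.Quotient.mk_eq_zero A).2 (hπA x), sub_zero]
  have hproj : Module.Projective R ((R ⊗[ℂ] M) ⧸ A) := Module.Projective.of_split s A.mkQ hs
  let eq : (R ⊗[ℂ] M) ≃ₗ[R] ((R ⊗[ℂ] M) ⧸ A) × (Fin k → R) := LinearEquiv.ofLinearMap
    (A.mkQ.prod (LinearMap.pi d))
    (s.coprod (Fintype.linearCombination R e))
    (by
      refine LinearMap.prod_ext ?_ ?_
      · refine LinearMap.ext fun x => ?_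
        obtain ⟨x, rfl⟩ := Submodule.mkQ_surjective _ x
        refine Prod.ext ?_ ?_
        · simpa using LinearMap.congr_fun hs (A.mkQ x)
        · funext i
          change d i ((x - π x) + Fintype.linearCombination R e 0) = 0
          rw [map_zero, add_zero, hπ]
          simp [map_sum, hd]
      · refine LinearMap.pi_ext' fun j => LinearMap.ext_ring ?_
        refine Prod.ext ?_ ?_
        · simp [Fintype.linearCombination_apply_single]
          exact Submodule.subset_span ⟨j, rfl⟩
        · funext i
          simp [Fintype.linearCombination_apply_single, hd, Pi.single_apply])
    (by
      refine LinearMap.ext fun x => ?_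
      simp [s, hπ, Fintype.linearCombination_apply])
  refine ⟨⟨A, inferInstance, hproj, fun p => ?_⟩, rfl⟩
  have h1 := congrFun (Module.rankAtStalk_eq_of_equiv eq) p
  have : Nontrivial R := ⟨0, 1, fun h => p.2.ne_top ((Ideal.eq_top_iff_one _).2 (h ▸ p.1.zero_mem))⟩
  rw [Module.rankAtStalk_prod, Pi.add_apply,
    Module.rankAtStalk_eq_finrank_of_free (M := R ⊗[ℂ] M),
    Module.rankAtStalk_eq_finrank_of_free (M := Fin k → R), Module.finrank_baseChange] at h1
  simp only [Pi.natCast_apply, Nat.cast_id, Module.finrank_fin_fun] at h1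
  change Module.rankAtStalk ((R ⊗[ℂ] M) ⧸ A) p = _
  omega

/-- Over a local ring, points of the Grassmannian are spanned by split families. -/
lemma exists_isSplit_span [Module.Finite ℂ M] [IsLocalRing R] (hk : k ≤ Module.finrank ℂ M)
    (N : (Gr k M).obj R) :
    ∃ e : Fin k → R ⊗[ℂ] M, IsSplit (R := R) e ∧ toSub N = Submodule.span R (Set.range e) := by
  have h1 : Module.Finite R ((R ⊗[ℂ] M) ⧸ toSub N) := N.finite_quotient
  have h2 : Module.Projective R ((R ⊗[ℂ] M) ⧸ toSub N) := N.projective_quotient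
  have h3 := N.rankAtStalk_eq (IsLocalRing.closedPoint R)
  generalize hA : toSub N = A at *
  replace h3 : Module.rankAtStalk ((R ⊗[ℂ] M) ⧸ A) (IsLocalRing.closedPoint R) =
    Module.finrank ℂ M - k := by rw [← hA]; exact h3
  obtain ⟨s, hs⟩ := Module.projective_lifting_property A.mkQ LinearMap.id
    (Submodule.mkQ_surjective A)
  let π : R ⊗[ℂ] M →ₗ[R] A := LinearMap.codRestrict A (LinearMap.id - s ∘ₗ A.mkQ) fun x => by
    rw [← Submodule.Quotient.mk_eq_zero A, ← Submodule.mkQ_apply, LinearMap.sub_apply, map_sub,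
      LinearMap.comp_apply]
    have := LinearMap.congr_fun hs (A.mkQ x)
    rw [LinearMap.comp_apply] at this
    rw [this]; simp
  have hπ : π ∘ₗ A.subtype = LinearMap.id := by
    refine LinearMap.ext fun x => Subtype.ext ?_
    simp [π, (Submodule.Quotient.mk_eq_zero A).2 x.2]
  have hAp : Module.Projective R A := Module.Projective.of_split A.subtype π hπ
  have hAf : Module.Finite R A := Module.Finite.of_surjective π fun x =>
    ⟨x, LinearMap.congr_fun hπ x⟩
  have hfree : Module.Free R A := Module.free_of_flat_of_isLocalRing (R := R) (P := A)
  have hfree' : Module.Free R ((R ⊗[ℂ] M) ⧸ A) := Module.free_of_flat_of_isLocalRing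
  let eq : (R ⊗[ℂ] M) ≃ₗ[R] ((R ⊗[ℂ] M) ⧸ A) × A := LinearEquiv.ofLinearMap
    (A.mkQ.prod π) (s.coprod A.subtype)
    (by
      refine LinearMap.prod_ext ?_ ?_
      · refine LinearMap.ext fun x => ?_
        have := LinearMap.congr_fun hs x
        refine Prod.ext ?_ (Subtype.ext ?_)
        · simpa using this
        · simp only [LinearMap.comp_apply, LinearMap.id_apply, Submodule.mkQ_apply] at this
          simp [π, this]
      · refine LinearMap.ext fun x => ?_
        refine Prod.ext ?_ (Subtype.ext ?_)
        · simp
        · simp [π, (Submodule.Quotient.mk_eq_zero A).2 x.2])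
    (by
      refine LinearMap.ext fun x => ?_
      simp [π])
  have hr := eq.finrank_eq
  rw [Module.finrank_prod, Module.finrank_baseChange] at hr
  rw [Module.rankAtStalk_eq_finrank_of_free] at h3
  simp only [Pi.natCast_apply, Nat.cast_id] at h3
  -- The codimension `dim M - k` is a truncated subtraction, so `k ≤ dim M` is what allows `k` to be
  -- recovered.
  have hrk : Module.finrank R A = k := by omega
  let b := Module.finBasisOfFinrankEq R A hrk
  refine ⟨fun i => (b i : R ⊗[ℂ] M), ⟨fun i => b.coord i ∘ₗ π, fun i j => ?_⟩, ?_⟩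
  · have := LinearMap.congr_fun hπ (b j)
    simp only [LinearMap.comp_apply, Submodule.subtype_apply, LinearMap.id_apply] at this
    rw [LinearMap.comp_apply, this]
    simp [Finsupp.single_apply, eq_comm]
  · have := congrArg (Submodule.map A.subtype) b.span_eq
    rw [Submodule.map_span, ← Set.range_comp, Submodule.map_subtype_top] at this
    exact this.symm

/-- A family whose image over a field is linearly independent is split, when the ring maps to the
field by a local homomorphism. -/
lemma isSplit_of_linearIndependent [Module.Finite ℂ M] {K : Type} [Field K] [Algebra ℂ K]
    (f : R ⟶ CommAlgCat.of ℂ K) [IsLocalHom f.hom.toRingHom] {e : Fin k → R ⊗[ℂ] M}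
    (h : LinearIndependent K fun i => (extendScalars f (e i) : K ⊗[ℂ] M)) :
    IsSplit (R := R) e := by
  classical
  let row : Fin (Module.finrank ℂ M) → (Fin k → K) := fun l j =>
    coordExt (CommAlgCat.of ℂ K) M l (extendScalars f (e j))
  -- Row rank equals column rank: a functional `c` vanishing on all coordinate rows is a linear
  -- relation among the given vectors.
  have hspan : Submodule.span K (Set.range row) = ⊤ := by
    by_contra hne
    obtain ⟨c, hc0, hc⟩ := Submodule.exists_le_ker_of_lt_top _ (lt_top_iff_ne_top.2 hne)
    apply hc0
    have h0 : ∑ j, c (Pi.single j 1) • (extendScalars f (e j) : K ⊗[ℂ] M) = 0 := by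
      refine eq_of_coordExt (R := CommAlgCat.of ℂ K) fun l => ?_
      have := hc (Submodule.subset_span ⟨l, rfl⟩)
      rw [LinearMap.mem_ker, LinearMap.pi_apply_eq_sum_univ c] at this
      rw [map_sum, map_zero, ← this]
      refine Finset.sum_congr rfl fun j _ => ?_
      rw [map_smul, smul_eq_mul, smul_eq_mul, mul_comm]
      congr 2
      funext i
      simp [Pi.single_apply, eq_comm]
    refine LinearMap.pi_ext' fun j => LinearMap.ext_ring ?_
    exact Fintype.linearIndependent_iff.1 h _ h0 j
  obtain ⟨t, ht, hts, hti⟩ := exists_linearIndependent K (Set.range row)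
  rw [hspan] at hts
  let b : Module.Basis t K (Fin k → K) := Module.Basis.mk hti (by
    rw [Subtype.range_coe_subtype]; exact hts.ge)
  have : Finite t := Module.Finite.finite_basis b
  have : Fintype t := Fintype.ofFinite t
  have hcard : Fintype.card t = k := by
    rw [← Module.finrank_eq_card_basis b, Module.finrank_fin_fun]
  let eq : Fin k ≃ t := (Fintype.equivFinOfCardEq hcard).symm
  choose l hl using fun i : Fin k => ht (eq i).2
  -- A `k × k` minor invertible over `K`. Its determinant is a unit of `R` because the map to `K` is
  -- local, and the rows of the inverse matrix provide the dual functionals.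
  let N : Matrix (Fin k) (Fin k) R := Matrix.of fun i j => coordExt R M (l i) (e j)
  have hN : N.map f.hom.toRingHom = Matrix.of fun i => ((eq i : t) : Fin k → K) := by
    ext i j
    rw [Matrix.of_apply, ← hl i]
    exact (coordExt_extendScalars f _ _).symm
  have hunit : IsUnit (N.map f.hom.toRingHom) := by
    rw [hN, ← Matrix.linearIndependent_rows_iff_isUnit]
    exact hti.comp eq eq.injective
  have hdet : IsUnit N.det := by
    refine isUnit_of_map_unit f.hom.toRingHom _ ?_
    rw [RingHom.map_det]
    exact (Matrix.isUnit_iff_isUnit_det _).1 hunit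
  refine ⟨fun i => ∑ m, N⁻¹ i m • coordExt R M (l m), fun i j => ?_⟩
  have := congrFun (congrFun (Matrix.nonsing_inv_mul N hdet) i) j
  rw [Matrix.mul_apply, Matrix.one_apply] at this
  rw [← this]
  simp [LinearMap.sum_apply, N]

end Split

end

end GushelMukai

namespace GushelMukai

noncomputable section

/-! ### Localization -/

section Localization

variable {M : Type} [AddCommGroup M] [Module ℂ M] {R : CommAlgCat.{0} ℂ}

/-- The local ring of `R` at a prime. -/
def atPrime (R : CommAlgCat.{0} ℂ) (p : Ideal R) [p.IsPrime] : CommAlgCat.{0} ℂ :=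
  CommAlgCat.of ℂ (Localization.AtPrime p)

instance (p : Ideal R) [p.IsPrime] : IsLocalRing (atPrime R p) :=
  inferInstanceAs (IsLocalRing (Localization.AtPrime p))

instance algebraAtPrime (p : Ideal R) [p.IsPrime] : Algebra R (atPrime R p) :=
  inferInstanceAs (Algebra R (Localization.AtPrime p))

instance (p : Ideal R) [p.IsPrime] : IsScalarTower ℂ R (atPrime R p) :=
  inferInstanceAs (IsScalarTower ℂ R (Localization.AtPrime p))

instance (p : Ideal R) [p.IsPrime] : IsLocalization.AtPrime (atPrime R p) p :=
  inferInstanceAs (IsLocalization.AtPrime (Localization.AtPrime p) p)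

/-- The localization map. -/
def toAtPrime (R : CommAlgCat.{0} ℂ) (p : Ideal R) [p.IsPrime] : R ⟶ atPrime R p :=
  CommAlgCat.ofHom (IsScalarTower.toAlgHom ℂ R (Localization.AtPrime p))

lemma cancelBaseChange_one_tmul (p : Ideal R) [p.IsPrime] (x : R ⊗[ℂ] M) :
    AlgebraTensorModule.cancelBaseChange ℂ R (atPrime R p) (atPrime R p) M (1 ⊗ₜ[R] x) =
      extendScalars (toAtPrime R p) x := by
  induction x with
  | zero => simp
  | add x y hx hy => simp [tmul_add, hx, hy]
  | tmul r m =>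
    rw [AlgebraTensorModule.cancelBaseChange_tmul, extendScalars_tmul]
    simp [Algebra.smul_def]
    rfl

/-- Right exactness of the tensor product. This translates between localizing the quotient module,
where the local criteria for vanishing and projectivity live, and extending the submodule itself. -/
lemma ker_baseChangeMkQ (p : Ideal R) [p.IsPrime] (A : Submodule R (R ⊗[ℂ] M)) :
    (Module.Grassmannian.baseChangeMkQ (atPrime R p) A).ker = extSub (toAtPrime R p) A := by
  have h1 : (Module.Grassmannian.baseChangeMkQ (atPrime R p) A).ker =
      (A.baseChange (atPrime R p)).map (AlgebraTensorModule.cancelBaseChange ℂ R (atPrime R p)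
        (atPrime R p) M).toLinearMap := by
    have hex : Function.Exact (A.subtype.baseChange (atPrime R p))
      (A.mkQ.baseChange (atPrime R p)) := baseChange_exact _
    ext y
    rw [LinearMap.mem_ker, Submodule.mem_map]
    change (A.mkQ.baseChange (atPrime R p))
      ((AlgebraTensorModule.cancelBaseChange ℂ R (atPrime R p) (atPrime R p) M).symm y) = 0 ↔ _
    rw [hex]
    constructor
    · intro hy
      exact ⟨_, hy, LinearEquiv.apply_symm_apply _ _⟩
    · rintro ⟨z, hz, rfl⟩
      rw [LinearEquiv.coe_coe, LinearEquiv.symm_apply_apply]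
      exact hz
  rw [h1, Submodule.baseChange_eq_span, Submodule.map_span]
  refine congrArg _ ?_
  ext y
  simp only [Submodule.map_coe, Set.mem_image, exists_exists_and_eq_and, TensorProduct.mk_apply,
    LinearEquiv.coe_coe, cancelBaseChange_one_tmul, SetLike.mem_coe]

lemma isLocalizedModule_mk (p : Ideal R) [p.IsPrime] (N : Type) [AddCommGroup N] [Module R N] :
    IsLocalizedModule p.primeCompl (TensorProduct.mk R (atPrime R p) N 1) :=
  (isLocalizedModule_iff_isBaseChange p.primeCompl (atPrime R p) _).2
    (TensorProduct.isBaseChange R N (atPrime R p))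

/-- Membership in a submodule can be checked on local rings. -/
lemma mem_of_atPrime {A : Submodule R (R ⊗[ℂ] M)} {x : R ⊗[ℂ] M}
    (h : ∀ (p : Ideal R) [p.IsPrime],
      extendScalars (toAtPrime R p) x ∈ extSub (toAtPrime R p) A) : x ∈ A := by
  rw [← Submodule.Quotient.mk_eq_zero]
  have (p : Ideal R) [p.IsMaximal] := isLocalizedModule_mk p ((R ⊗[ℂ] M) ⧸ A)
  refine Module.eq_zero_of_localization_maximal (fun p _ => atPrime R p ⊗[R] ((R ⊗[ℂ] M) ⧸ A))
    (fun p _ => TensorProduct.mk R (atPrime R p) ((R ⊗[ℂ] M) ⧸ A) 1) _ fun p _ => ?_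
  have := h p
  rw [← ker_baseChangeMkQ, LinearMap.mem_ker, ← cancelBaseChange_one_tmul] at this
  simpa [Module.Grassmannian.baseChangeMkQ] using this

lemma le_of_atPrime {A B : Submodule R (R ⊗[ℂ] M)}
    (h : ∀ (p : Ideal R) [p.IsPrime], extSub (toAtPrime R p) A ≤ extSub (toAtPrime R p) B) :
    A ≤ B :=
  fun _ hx => mem_of_atPrime fun p _ => h p (mem_extSub _ hx)

lemma eq_of_atPrime {A B : Submodule R (R ⊗[ℂ] M)}
    (h : ∀ (p : Ideal R) [p.IsPrime], extSub (toAtPrime R p) A = extSub (toAtPrime R p) B) :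
    A = B :=
  le_antisymm (le_of_atPrime fun p _ => (h p).le) (le_of_atPrime fun p _ => (h p).ge)

/-- A finitely generated submodule which is locally a point of the Grassmannian is one. -/
lemma exists_gr_of_atPrime [Module.Finite ℂ M] {k : ℕ} {A : Submodule R (R ⊗[ℂ] M)} (hA : A.FG)
    (h : ∀ (p : Ideal R) [p.IsPrime], ∃ N : (Gr k M).obj (atPrime R p),
      toSub N = extSub (toAtPrime R p) A) :
    ∃ N : (Gr k M).obj R, toSub N = A := by
  have hfp' : Module.FinitePresentation R (R ⊗[ℂ] M) := Module.finitePresentation_of_projective _ _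
  -- Finite generation of `A` makes the quotient finitely presented, so that its projectivity can be
  -- tested at maximal ideals.
  have hfp : Module.FinitePresentation R ((R ⊗[ℂ] M) ⧸ A) :=
    Module.finitePresentation_of_surjective A.mkQ (Submodule.mkQ_surjective A)
      (by rwa [Submodule.ker_mkQ])
  have key (p : Ideal R) [p.IsPrime] :
      Module.Projective (atPrime R p) (atPrime R p ⊗[R] ((R ⊗[ℂ] M) ⧸ A)) ∧
      ∀ q, Module.rankAtStalk (R := atPrime R p) (atPrime R p ⊗[R] ((R ⊗[ℂ] M) ⧸ A)) q =
        Module.finrank ℂ M - k := by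
    obtain ⟨N, hN⟩ := h p
    let eq := Module.Grassmannian.baseChangeMkQEquiv (B := atPrime R p) A
    have h1 : toSub N = (Module.Grassmannian.baseChangeMkQ (atPrime R p) A).ker := by
      rw [hN, ker_baseChangeMkQ]
    let eq' := (Submodule.quotEquivOfEq _ _ h1).trans eq
    have : Module.Projective (atPrime R p) ((atPrime R p ⊗[ℂ] M) ⧸ toSub N) :=
      N.projective_quotient
    refine ⟨Module.Projective.of_equiv eq', fun q => ?_⟩
    rw [← Module.rankAtStalk_eq_of_equiv eq']
    exact N.rankAtStalk_eq q
  have (p : Ideal R) [p.IsMaximal] := isLocalizedModule_mk p ((R ⊗[ℂ] M) ⧸ A)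
  have hproj : Module.Projective R ((R ⊗[ℂ] M) ⧸ A) :=
    Module.projective_of_localization_maximal' (fun p _ => atPrime R p)
      (fun p _ => atPrime R p ⊗[R] ((R ⊗[ℂ] M) ⧸ A))
      (fun p _ => TensorProduct.mk R (atPrime R p) ((R ⊗[ℂ] M) ⧸ A) 1)
      (fun p _ => (key p).1)
  refine ⟨⟨A, inferInstance, hproj, fun p => ?_⟩, rfl⟩
  have h2 := (key p.asIdeal).2 (IsLocalRing.closedPoint _)
  rw [Module.rankAtStalk_baseChange] at h2
  rw [← h2]
  congr 1
  refine PrimeSpectrum.ext ?_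
  exact (IsLocalization.AtPrime.under_maximalIdeal (atPrime R p.asIdeal) p.asIdeal).symm

end Localization

/-! ### Wedge products and contractions -/

section Contraction

variable {V : Type} [AddCommGroup V] [Module ℂ V] {R S : CommAlgCat.{0} ℂ}

lemma isUnit_two (R : CommAlgCat.{0} ℂ) : IsUnit (2 : R) := by
  have := (IsUnit.mk0 (2 : ℂ) two_ne_zero).map (algebraMap ℂ R)
  rwa [map_ofNat] at this

/-- The wedge product on `R ⊗ V`. -/
def wdg (x y : R ⊗[ℂ] V) : R ⊗[ℂ] (⋀[ℂ]^2 V) :=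
  LinearMap.BilinMap.baseChange R (wedge V) x y

lemma wdg_add_left (x x' y : R ⊗[ℂ] V) : wdg (x + x') y = wdg x y + wdg x' y := by
  simp [wdg]

lemma wdg_add_right (x y y' : R ⊗[ℂ] V) : wdg x (y + y') = wdg x y + wdg x y' := by
  simp [wdg]

lemma wdg_neg_right (x y : R ⊗[ℂ] V) : wdg x (-y) = -wdg x y := by
  simp [wdg]

lemma wdg_sub_left (x x' y : R ⊗[ℂ] V) : wdg (x - x') y = wdg x y - wdg x' y := by
  simp [wdg]

lemma wdg_sub_right (x y y' : R ⊗[ℂ] V) : wdg x (y - y') = wdg x y - wdg x y' := by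
  simp [wdg]

lemma wdg_smul_left (r : R) (x y : R ⊗[ℂ] V) : wdg (r • x) y = r • wdg x y := by
  simp [wdg]

lemma wdg_smul_right (r : R) (x y : R ⊗[ℂ] V) : wdg x (r • y) = r • wdg x y := by
  simp [wdg]

lemma wdg_zero_right (y : R ⊗[ℂ] V) : wdg y 0 = 0 := by simp [wdg]

lemma wdg_tmul (a b : R) (v w : V) : wdg (a ⊗ₜ[ℂ] v) (b ⊗ₜ[ℂ] w) = (a * b) ⊗ₜ[ℂ] wedge V v w :=
  LinearMap.BilinMap.baseChange_tmul _ _ _ _ _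

lemma wedge_self (v : V) : wedge V v v = 0 :=
  (exteriorPower.ιMulti ℂ 2).map_eq_zero_of_eq ![v, v] (i := 0) (j := 1) rfl (by decide)

lemma wedge_swap (v w : V) : wedge V v w = -wedge V w v := by
  have := wedge_self (v + w)
  simp only [map_add, LinearMap.add_apply, wedge_self, zero_add, add_zero] at this
  exact eq_neg_of_add_eq_zero_right this

lemma wdg_swap (x y : R ⊗[ℂ] V) : wdg x y = -wdg y x := by
  induction x with
  | zero => simp [wdg]
  | add x x' hx hx' => rw [wdg_add_left, wdg_add_right, hx, hx', neg_add]
  | tmul a v =>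
    induction y with
    | zero => simp [wdg]
    | add y y' hy hy' => rw [wdg_add_left, wdg_add_right, hy, hy', neg_add]
    | tmul b w => rw [wdg_tmul, wdg_tmul, wedge_swap, mul_comm, tmul_neg]

lemma wdg_self (x : R ⊗[ℂ] V) : wdg x x = 0 := by
  have h := wdg_swap x x
  have h2 : (2 : R) • wdg x x = 0 := by rw [two_smul]; nth_rewrite 1 [h]; simp
  exact (isUnit_two R).smul_eq_zero.1 h2

lemma extendScalars_wdg (f : R ⟶ S) (x y : R ⊗[ℂ] V) :
    extendScalars f (wdg x y) = wdg (extendScalars f x) (extendScalars f y) :=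
  extendScalars_wedge f x y

/-- Induction on elements of `R ⊗ ⋀² V`. -/
lemma wdg_induction {p : R ⊗[ℂ] (⋀[ℂ]^2 V) → Prop} (h0 : p 0)
    (hadd : ∀ x y, p x → p y → p (x + y)) (hw : ∀ x y, p (wdg x y)) (e : R ⊗[ℂ] (⋀[ℂ]^2 V)) :
    p e := by
  induction e with
  | zero => exact h0
  | add x y hx hy => exact hadd x y hx hy
  | tmul r w =>
    have hw' : w ∈ Submodule.span ℂ (Set.range (exteriorPower.ιMulti ℂ 2 (M := V))) := by
      rw [exteriorPower.ιMulti_span]; trivial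
    induction hw' using Submodule.span_induction generalizing r with
    | mem w hw' =>
      obtain ⟨v, rfl⟩ := hw'
      have : wdg (r ⊗ₜ[ℂ] v 0) ((1 : R) ⊗ₜ[ℂ] v 1) = r ⊗ₜ[ℂ] exteriorPower.ιMulti ℂ 2 v := by
        rw [wdg_tmul, mul_one]
        congr 1
      rw [← this]; exact hw _ _
    | zero => rw [tmul_zero]; exact h0
    | add x y _ _ hx hy => rw [tmul_add]; exact hadd _ _ (hx r) (hy r)
    | smul a x _ hx => rw [tmul_smul, TensorProduct.smul_tmul']; exact hx _

/-- Contraction of bivectors with a linear functional. -/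
def contr (φ : Module.Dual R (R ⊗[ℂ] V)) : R ⊗[ℂ] (⋀[ℂ]^2 V) →ₗ[R] R ⊗[ℂ] V :=
  LinearMap.liftBaseChange R (exteriorPower.alternatingMapLinearEquiv
    { toFun := fun v => φ (1 ⊗ₜ v 0) • ((1 : R) ⊗ₜ[ℂ] v 1) - φ (1 ⊗ₜ v 1) • ((1 : R) ⊗ₜ[ℂ] v 0)
      map_update_add' := fun v i x y => by
        have : i = 0 ∨ i = 1 := by omega
        rcases this with rfl | rfl <;>
          simp [tmul_add, add_smul] <;> abel
      map_update_smul' := fun v i c x => by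
        have : i = 0 ∨ i = 1 := by omega
        rcases this with rfl | rfl <;>
          simp [smul_sub, smul_comm c]
      map_eq_zero_of_eq' := fun v i j h hij => by
        have : (i = 0 ∧ j = 1) ∨ (i = 1 ∧ j = 0) := by omega
        rcases this with ⟨rfl, rfl⟩ | ⟨rfl, rfl⟩ <;> simp [h] })

lemma contr_wdg (φ : Module.Dual R (R ⊗[ℂ] V)) (x y : R ⊗[ℂ] V) :
    contr φ (wdg x y) = φ x • y - φ y • x := by
  induction x with
  | zero => simp [wdg]
  | add x x' hx hx' => rw [wdg_add_left, map_add, map_add, hx, hx', add_smul, smul_add]; abel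
  | tmul a v =>
    induction y with
    | zero => simp [wdg]
    | add y y' hy hy' => rw [wdg_add_right, map_add, map_add, hy, hy', add_smul, smul_add]; abel
    | tmul b w =>
      have ha : a ⊗ₜ[ℂ] v = a • ((1 : R) ⊗ₜ[ℂ] v) := by
        rw [TensorProduct.smul_tmul', smul_eq_mul, mul_one]
      have hb : b ⊗ₜ[ℂ] w = b • ((1 : R) ⊗ₜ[ℂ] w) := by
        rw [TensorProduct.smul_tmul', smul_eq_mul, mul_one]
      rw [wdg_tmul, contr, LinearMap.liftBaseChange_tmul]
      change (a * b) • exteriorPower.alternatingMapLinearEquiv _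
        (exteriorPower.ιMulti ℂ 2 ![v, w]) = _
      rw [exteriorPower.alternatingMapLinearEquiv_apply_ιMulti, ha, hb]
      change (a * b) • (φ (1 ⊗ₜ v) • ((1 : R) ⊗ₜ[ℂ] w) - φ (1 ⊗ₜ w) • ((1 : R) ⊗ₜ[ℂ] v)) = _
      rw [map_smul, map_smul, smul_sub, smul_smul, smul_smul, smul_smul, smul_smul, smul_eq_mul,
        smul_eq_mul]
      congr 2 <;> ring

lemma extendScalars_contr (f : R ⟶ S) (φ : Module.Dual R (R ⊗[ℂ] V)) (e : R ⊗[ℂ] (⋀[ℂ]^2 V)) :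
    extendScalars f (contr φ e) = contr (extDual f φ) (extendScalars f e) := by
  induction e using wdg_induction with
  | h0 => simp
  | hadd x y hx hy => simp only [map_add, hx, hy]
  | hw x y =>
    rw [contr_wdg, extendScalars_wdg, contr_wdg, map_sub, extendScalars_smul, extendScalars_smul,
      extDual_extendScalars, extDual_extendScalars]

lemma contr_add (φ ψ : Module.Dual R (R ⊗[ℂ] V)) (e : R ⊗[ℂ] (⋀[ℂ]^2 V)) :
    contr (φ + ψ) e = contr φ e + contr ψ e := by
  induction e using wdg_induction with
  | h0 => simp
  | hadd x y hx hy => simp only [map_add, hx, hy]; abel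
  | hw x y => simp only [contr_wdg, LinearMap.add_apply, add_smul]; abel

lemma contr_smul (r : R) (φ : Module.Dual R (R ⊗[ℂ] V)) (e : R ⊗[ℂ] (⋀[ℂ]^2 V)) :
    contr (r • φ) e = r • contr φ e := by
  induction e using wdg_induction with
  | h0 => simp
  | hadd x y hx hy => simp only [map_add, hx, hy, smul_add]
  | hw x y => simp only [contr_wdg, LinearMap.smul_apply, smul_eq_mul, mul_smul, smul_sub]

/-- The pairing of a bivector with two linear functionals. -/
def pair (φ ψ : Module.Dual R (R ⊗[ℂ] V)) : Module.Dual R (R ⊗[ℂ] (⋀[ℂ]^2 V)) :=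
  ψ ∘ₗ contr φ

lemma pair_wdg (φ ψ : Module.Dual R (R ⊗[ℂ] V)) (x y : R ⊗[ℂ] V) :
    pair φ ψ (wdg x y) = φ x * ψ y - φ y * ψ x := by
  simp [pair, contr_wdg]

lemma pair_self (φ : Module.Dual R (R ⊗[ℂ] V)) (e : R ⊗[ℂ] (⋀[ℂ]^2 V)) : pair φ φ e = 0 := by
  induction e using wdg_induction with
  | h0 => simp
  | hadd x y hx hy => rw [map_add, hx, hy, add_zero]
  | hw x y => rw [pair_wdg]; ring

lemma pair_swap (φ ψ : Module.Dual R (R ⊗[ℂ] V)) (e : R ⊗[ℂ] (⋀[ℂ]^2 V)) :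
    pair φ ψ e = -pair ψ φ e := by
  induction e using wdg_induction with
  | h0 => simp
  | hadd x y hx hy => rw [map_add, map_add, hx, hy]; ring
  | hw x y => rw [pair_wdg, pair_wdg]; ring

/-- A bivector is determined by its contractions. -/
lemma eq_zero_of_contr [Module.Finite ℂ V] {e : R ⊗[ℂ] (⋀[ℂ]^2 V)}
    (h : ∀ φ : Module.Dual R (R ⊗[ℂ] V), contr φ e = 0) : e = 0 := by
  -- Euler's identity in degree two: wedging each basis vector with the contraction by its dual
  -- coordinate and summing gives twice the bivector.
  have key : ∑ i, wdg (stdBasisExt R V i) (contr (coordExt R V i) e) = (2 : R) • e := by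
    clear h
    induction e using wdg_induction with
    | h0 => simp [wdg]
    | hadd x y hx hy => simp only [map_add, wdg_add_right, Finset.sum_add_distrib, hx, hy, smul_add]
    | hw x y =>
      have hs (z w : R ⊗[ℂ] V) : ∑ i, wdg (stdBasisExt R V i) (coordExt R V i z • w) = wdg z w := by
        conv_rhs => rw [← (stdBasisExt R V).sum_repr z]
        simp only [wdg, map_sum, LinearMap.sum_apply, map_smul, LinearMap.smul_apply]
        rfl
      simp only [contr_wdg, wdg_sub_right, Finset.sum_sub_distrib, hs]
      rw [wdg_swap y x, two_smul, sub_neg_eq_add]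
  refine (isUnit_two R).smul_eq_zero.1 ?_
  rw [← key]
  exact Finset.sum_eq_zero fun i _ => by rw [h, wdg_zero_right]

lemma eq_of_dual [Module.Finite ℂ V] {x y : R ⊗[ℂ] V}
    (h : ∀ φ : Module.Dual R (R ⊗[ℂ] V), φ x = φ y) : x = y :=
  eq_of_coordExt fun _ => h _

end Contraction

end

end GushelMukai

namespace GushelMukai

noncomputable section

/-! ### Decomposable bivectors -/

section Decomposable

variable {V : Type} [AddCommGroup V] [Module ℂ V] {R S : CommAlgCat.{0} ℂ}

lemma mem_wedgeSub_span_singleton {v : R ⊗[ℂ] V} {A : Submodule R (R ⊗[ℂ] V)}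
    {e : R ⊗[ℂ] (⋀[ℂ]^2 V)} :
    e ∈ wedgeSub V (Submodule.span R {v}) A ↔ ∃ a ∈ A, wdg v a = e := by
  rw [wedgeSub, Submodule.map₂_span_singleton_eq_map]; rfl

lemma wdg_mem_wedgeSub {A B : Submodule R (R ⊗[ℂ] V)} {x y : R ⊗[ℂ] V} (hx : x ∈ A) (hy : y ∈ B) :
    wdg x y ∈ wedgeSub V A B :=
  Submodule.apply_mem_map₂ _ hx hy

lemma wedgeSub_span_pair (x y : R ⊗[ℂ] V) :
    wedgeSub V (Submodule.span R {x, y}) (Submodule.span R {x, y}) =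
      Submodule.span R {wdg x y} := by
  rw [wedgeSub, Submodule.map₂_span_span]
  refine le_antisymm (Submodule.span_le.2 ?_) (Submodule.span_mono ?_)
  · rintro _ ⟨a, ha, b, hb, rfl⟩
    change wdg a b ∈ _
    have h := Submodule.mem_span_singleton_self (R := R) (wdg x y)
    have h' := Submodule.neg_mem _ h
    rw [← wdg_swap] at h'
    rcases ha with rfl | rfl <;> rcases hb with rfl | rfl
    · rw [wdg_self]; exact Submodule.zero_mem _
    · exact h
    · exact h'
    · rw [wdg_self]; exact Submodule.zero_mem _
  · rintro _ rfl
    exact ⟨x, by simp, y, by simp, rfl⟩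

lemma range_fin_two {α : Type*} (e : Fin 2 → α) : Set.range e = {e 0, e 1} := by
  ext x
  simp only [Set.mem_range, Fin.exists_fin_two, Set.mem_insert_iff, Set.mem_singleton_iff,
    eq_comm]

lemma range_fin_one {α : Type*} (e : Fin 1 → α) : Set.range e = {e 0} := by
  ext x
  simp [eq_comm]

/-- A unimodular element spans a point of projective space. -/
lemma exists_pp {M : Type} [AddCommGroup M] [Module ℂ M] [Module.Finite ℂ M] {v : R ⊗[ℂ] M}
    {φ : Module.Dual R (R ⊗[ℂ] M)} (h : φ v = 1) :
    ∃ m : (PP M).obj R, toSub m = Submodule.span R {v} := by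
  have : IsSplit (R := R) fun _ : Fin 1 => v := ⟨fun _ => φ, fun i j => by
    rw [h, if_pos (Subsingleton.elim _ _)]⟩
  obtain ⟨N, hN⟩ := this.exists_gr
  exact ⟨N, by rw [hN, range_fin_one]⟩

lemma exists_unimodular {M : Type} [AddCommGroup M] [Module ℂ M] [Module.Finite ℂ M]
    [IsLocalRing R] (hM : 1 ≤ Module.finrank ℂ M) (m : (PP M).obj R) :
    ∃ (v : R ⊗[ℂ] M) (φ : Module.Dual R (R ⊗[ℂ] M)), φ v = 1 ∧ toSub m = Submodule.span R {v} := by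
  obtain ⟨e, ⟨d, hd⟩, he⟩ := exists_isSplit_span hM m
  exact ⟨e 0, d 0, by simp [hd], by rw [he, range_fin_one]⟩

/-- The functional `x ↦ ε (v ∧ x)`. -/
def wdgDual (ε : Module.Dual R (R ⊗[ℂ] (⋀[ℂ]^2 V))) (v : R ⊗[ℂ] V) : Module.Dual R (R ⊗[ℂ] V) :=
  ε ∘ₗ LinearMap.BilinMap.baseChange R (wedge V) v

lemma wdgDual_apply (ε : Module.Dual R (R ⊗[ℂ] (⋀[ℂ]^2 V))) (v x : R ⊗[ℂ] V) :
    wdgDual ε v x = ε (wdg v x) := rfl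

/-- If the bivectors `v ∧ aᵢ` form a split family and `v` is unimodular, then `v` and the `aᵢ` form
a split family. -/
lemma IsSplit.cons_of_wdg {k : ℕ} {v : R ⊗[ℂ] V} {a : Fin k → R ⊗[ℂ] V}
    {φ : Module.Dual R (R ⊗[ℂ] V)} (hφ : φ v = 1)
    (h : IsSplit (R := R) fun i => wdg v (a i)) :
    IsSplit (R := R) (Fin.cons v a : Fin (k + 1) → R ⊗[ℂ] V) := by
  obtain ⟨d, hd⟩ := h
  refine ⟨Fin.cons (φ - ∑ j, φ (a j) • wdgDual (d j) v) fun i => wdgDual (d i) v, fun i j => ?_⟩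
  refine Fin.cases ?_ (fun i => ?_) i <;> refine Fin.cases ?_ (fun j => ?_) j
  · simp [wdgDual_apply, wdg_self, hφ]
  · simp [wdgDual_apply, hd, (Fin.succ_ne_zero j).symm]
  · simp [wdgDual_apply, wdg_self]
  · simp [wdgDual_apply, hd]

/-- The vanishing contraction says `ψ v • a = ψ a • v`; wedging with `v` and applying `ε` isolates
`ψ v`. Since it refers to the bivector only through its contractions, it applies to every
factorization of the same bivector and so locates its factors. -/
lemma apply_eq_zero_of_contr {v a : R ⊗[ℂ] V} {ε : Module.Dual R (R ⊗[ℂ] (⋀[ℂ]^2 V))}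
    (hε : ε (wdg v a) = 1) {ψ : Module.Dual R (R ⊗[ℂ] V)} (h : contr ψ (wdg v a) = 0) :
    ψ v = 0 := by
  rw [contr_wdg] at h
  have := congrArg (wdgDual ε v) h
  rw [map_sub, map_smul, map_smul, wdgDual_apply, wdgDual_apply, wdg_self, hε, map_zero,
    map_zero, smul_zero, sub_zero, smul_eq_mul, mul_one] at this
  exact this

lemma contr_wdg_eq_zero {ψ : Module.Dual R (R ⊗[ℂ] V)} {x y : R ⊗[ℂ] V} (hx : ψ x = 0)
    (hy : ψ y = 0) : contr ψ (wdg x y) = 0 := by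
  rw [contr_wdg, hx, hy, zero_smul, zero_smul, sub_zero]

/-- A vector is in the span of a split family when it is killed by all functionals killing the
family. -/
lemma eq_sum_of_forall_dual [Module.Finite ℂ V] {k : ℕ} {e : Fin k → R ⊗[ℂ] V}
    {d : Fin k → Module.Dual R (R ⊗[ℂ] V)} (hd : ∀ i j, d i (e j) = if i = j then 1 else 0)
    {x : R ⊗[ℂ] V} (h : ∀ φ : Module.Dual R (R ⊗[ℂ] V), (∀ i, φ (e i) = 0) → φ x = 0) :
    x = ∑ i, d i x • e i := by
  refine eq_of_dual fun φ => ?_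
  have := h (φ - ∑ i, φ (e i) • d i) fun j => by simp [hd]
  simp only [LinearMap.sub_apply, LinearMap.sum_apply, LinearMap.smul_apply, smul_eq_mul,
    sub_eq_zero] at this
  rw [this, map_sum]
  exact Finset.sum_congr rfl fun i _ => by rw [map_smul, smul_eq_mul, mul_comm]

/-- The common factor of two independent decomposable bivectors is unique. -/
lemma mem_span_of_common_factor [Module.Finite ℂ V] {v v' : R ⊗[ℂ] V} {a a' : Fin 2 → R ⊗[ℂ] V}
    {φ : Module.Dual R (R ⊗[ℂ] V)} (hφ : φ v = 1) (h : IsSplit (R := R) fun i => wdg v (a i))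
    (h' : ∀ i, wdg v' (a' i) = wdg v (a i)) : v' ∈ Submodule.span R {v} := by
  obtain ⟨d, hd⟩ := h.cons_of_wdg hφ
  obtain ⟨ε, hε⟩ := h
  have key (i : Fin 2) (ψ : Module.Dual R (R ⊗[ℂ] V)) (hv : ψ v = 0) (ha : ψ (a i) = 0) :
      ψ v' = 0 := by
    refine apply_eq_zero_of_contr (a := a' i) (ε := ε i) ?_ ?_
    · rw [h', hε, if_pos rfl]
    · rw [h']; exact contr_wdg_eq_zero hv ha
  -- The vector `v'` lies in both planes `⟨v, a 0⟩` and `⟨v, a 1⟩`, which meet in `⟨v⟩`: its `a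
  -- 0`-coordinate is killed by the second plane and its `a 1`-coordinate by the first.
  have h1 : d 1 v' = 0 := key 1 _ (hd 1 0) (hd 1 2)
  have h2 : d 2 v' = 0 := key 0 _ (hd 2 0) (hd 2 1)
  have := eq_sum_of_forall_dual hd (x := v') fun ψ hψ => key 0 ψ (hψ 0) (hψ 1)
  rw [Fin.sum_univ_three, h1, h2, zero_smul, zero_smul, add_zero, add_zero] at this
  rw [this]
  exact Submodule.smul_mem _ _ (Submodule.mem_span_singleton_self _)

/-- A factor of a decomposable bivector lies in its plane. -/
lemma mem_span_of_wdg_eq [Module.Finite ℂ V] {e : Fin 2 → R ⊗[ℂ] V} (h : IsSplit (R := R) e)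
    {v a : R ⊗[ℂ] V} (hva : wdg v a = wdg (e 0) (e 1)) :
    v ∈ Submodule.span R (Set.range e) := by
  obtain ⟨d, hd⟩ := h
  have : v = ∑ i, d i v • e i := eq_sum_of_forall_dual hd fun ψ hψ => by
    refine apply_eq_zero_of_contr (a := a) (ε := pair (d 0) (d 1)) ?_ ?_
    · rw [hva, pair_wdg]; simp [hd]
    · rw [hva]; exact contr_wdg_eq_zero (hψ 0) (hψ 1)
  rw [this]
  exact Submodule.sum_mem _ fun i _ => Submodule.smul_mem _ _ (Submodule.subset_span ⟨i, rfl⟩)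

/-- A unimodular vector in the plane of a bivector is a factor of it. -/
lemma wdg_eq_of_mem_span {x y v : R ⊗[ℂ] V} {φ : Module.Dual R (R ⊗[ℂ] V)} (hφ : φ v = 1)
    (hv : v ∈ Submodule.span R {x, y}) : wdg v (φ x • y - φ y • x) = wdg x y := by
  obtain ⟨α, β, rfl⟩ := Submodule.mem_span_pair.1 hv
  simp only [map_add, map_smul, smul_eq_mul] at hφ
  simp only [wdg_sub_right, wdg_add_left, wdg_smul_left, wdg_smul_right, wdg_self, wdg_swap y x]
  conv_rhs => rw [← one_smul R (wdg x y), ← hφ]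
  module

/-- The polarized Plücker relation attached to four functionals. -/
def plueckerForm (φ₁ φ₂ φ₃ φ₄ : Module.Dual R (R ⊗[ℂ] V)) (e e' : R ⊗[ℂ] (⋀[ℂ]^2 V)) : R :=
  pair φ₁ φ₂ e * pair φ₃ φ₄ e' + pair φ₃ φ₄ e * pair φ₁ φ₂ e' -
    pair φ₁ φ₃ e * pair φ₂ φ₄ e' - pair φ₂ φ₄ e * pair φ₁ φ₃ e' +
    pair φ₁ φ₄ e * pair φ₂ φ₃ e' + pair φ₂ φ₃ e * pair φ₁ φ₄ e'

lemma plueckerForm_wdg (φ₁ φ₂ φ₃ φ₄ : Module.Dual R (R ⊗[ℂ] V)) (x y : R ⊗[ℂ] V) :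
    plueckerForm φ₁ φ₂ φ₃ φ₄ (wdg x y) (wdg x y) = 0 := by
  simp only [plueckerForm, pair_wdg]; ring

/-- The quadratic Plücker relation holds at both bivectors and at their sum, so twice its
polarization vanishes, and `2` is invertible. -/
lemma plueckerForm_polar (φ₁ φ₂ φ₃ φ₄ : Module.Dual R (R ⊗[ℂ] V)) (x y z w s t : R ⊗[ℂ] V)
    (h : wdg x y + wdg z w = wdg s t) :
    plueckerForm φ₁ φ₂ φ₃ φ₄ (wdg x y) (wdg z w) = 0 := by
  have h1 := plueckerForm_wdg φ₁ φ₂ φ₃ φ₄ s t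
  have h2 := plueckerForm_wdg φ₁ φ₂ φ₃ φ₄ x y
  have h3 := plueckerForm_wdg φ₁ φ₂ φ₃ φ₄ z w
  rw [← h] at h1
  generalize wdg x y = e at *
  generalize wdg z w = e' at *
  have h4 : (2 : R) * plueckerForm φ₁ φ₂ φ₃ φ₄ e e' = 0 := by
    simp only [plueckerForm, map_add] at *
    linear_combination h1 - h2 - h3
  exact (isUnit_two R).mul_right_eq_zero.1 h4

lemma plueckerForm_add_left (φ₁ φ₂ φ₃ φ₄ : Module.Dual R (R ⊗[ℂ] V))
    (e₁ e₂ e' : R ⊗[ℂ] (⋀[ℂ]^2 V)) :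
    plueckerForm φ₁ φ₂ φ₃ φ₄ (e₁ + e₂) e' =
      plueckerForm φ₁ φ₂ φ₃ φ₄ e₁ e' + plueckerForm φ₁ φ₂ φ₃ φ₄ e₂ e' := by
  simp only [plueckerForm, map_add]; ring

lemma plueckerForm_smul_left (φ₁ φ₂ φ₃ φ₄ : Module.Dual R (R ⊗[ℂ] V)) (r : R)
    (e e' : R ⊗[ℂ] (⋀[ℂ]^2 V)) :
    plueckerForm φ₁ φ₂ φ₃ φ₄ (r • e) e' = r * plueckerForm φ₁ φ₂ φ₃ φ₄ e e' := by
  simp only [plueckerForm, map_smul, smul_eq_mul]; ring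

lemma plueckerForm_comm (φ₁ φ₂ φ₃ φ₄ : Module.Dual R (R ⊗[ℂ] V)) (e e' : R ⊗[ℂ] (⋀[ℂ]^2 V)) :
    plueckerForm φ₁ φ₂ φ₃ φ₄ e e' = plueckerForm φ₁ φ₂ φ₃ φ₄ e' e := by
  simp only [plueckerForm]; ring

lemma plueckerForm_zero_left (φ₁ φ₂ φ₃ φ₄ : Module.Dual R (R ⊗[ℂ] V)) (e : R ⊗[ℂ] (⋀[ℂ]^2 V)) :
    plueckerForm φ₁ φ₂ φ₃ φ₄ 0 e = 0 := by
  simp [plueckerForm]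

lemma plueckerForm_eq_zero_of_span {k : ℕ} {e : Fin k → R ⊗[ℂ] (⋀[ℂ]^2 V)}
    {φ₁ φ₂ φ₃ φ₄ : Module.Dual R (R ⊗[ℂ] V)}
    (h : ∀ i j, plueckerForm φ₁ φ₂ φ₃ φ₄ (e i) (e j) = 0) {x y : R ⊗[ℂ] (⋀[ℂ]^2 V)}
    (hx : x ∈ Submodule.span R (Set.range e)) (hy : y ∈ Submodule.span R (Set.range e)) :
    plueckerForm φ₁ φ₂ φ₃ φ₄ x y = 0 := by
  induction hx using Submodule.span_induction with
  | zero => exact plueckerForm_zero_left _ _ _ _ _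
  | add x x' _ _ hx hx' => rw [plueckerForm_add_left, hx, hx', add_zero]
  | smul r x _ hx => rw [plueckerForm_smul_left, hx, mul_zero]
  | mem x hx =>
    obtain ⟨i, rfl⟩ := hx
    rw [plueckerForm_comm]
    induction hy using Submodule.span_induction with
    | zero => exact plueckerForm_zero_left _ _ _ _ _
    | add x x' _ _ hx hx' => rw [plueckerForm_add_left, hx, hx', add_zero]
    | smul r x _ hx => rw [plueckerForm_smul_left, hx, mul_zero]
    | mem x hx => obtain ⟨j, rfl⟩ := hx; exact h _ _

/-- Two decomposable bivectors with decomposable sum have a common factor: the case where a factor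
of the second one is independent of the first one. -/
lemma exists_common_factor_of_isSplit [Module.Finite ℂ V] [IsLocalRing R]
    {x y z w s t : R ⊗[ℂ] V} {ε : Module.Dual R (R ⊗[ℂ] (⋀[ℂ]^2 V))} (hε : ε (wdg z w) = 1)
    {X Y Z : Module.Dual R (R ⊗[ℂ] V)}
    (hXx : X x = 1) (hXy : X y = 0) (hXz : X z = 0) (hYx : Y x = 0) (hYy : Y y = 1) (hYz : Y z = 0)
    (hZx : Z x = 0) (hZy : Z y = 0) (hZz : Z z = 1) (h : wdg x y + wdg z w = wdg s t) :
    ∃ v a b : R ⊗[ℂ] V, wdg x y = wdg v a ∧ wdg z w = wdg v b ∧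
      ∃ φ : Module.Dual R (R ⊗[ℂ] V), φ v = 1 := by
  have hd : ∀ i j, (![X, Y, Z] : Fin 3 → Module.Dual R (R ⊗[ℂ] V)) i
      ((![x, y, z] : Fin 3 → R ⊗[ℂ] V) j) = if i = j then 1 else 0 := by
    intro i j
    fin_cases i <;> fin_cases j <;> simp [*]
  -- If `ψ` kills `x`, `y`, `z`, the Plücker form of `X, Y, Z, ψ` at the two bivectors reduces to `ψ
  -- w`. So the four vectors lie in a common 3-space, and the common factor is the intersection `α x
  -- + β y` of the two planes.
  have hw : w = X w • x + Y w • y + Z w • z := by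
    have := eq_sum_of_forall_dual hd (x := w) fun ψ hψ => by
      have hx : ψ x = 0 := hψ 0
      have hy : ψ y = 0 := hψ 1
      have hz : ψ z = 0 := hψ 2
      have := plueckerForm_polar X Y Z ψ x y z w s t h
      simpa [plueckerForm, pair_wdg, hx, hy, hz, hXx, hXy, hXz, hYx, hYy, hYz, hZx, hZy, hZz]
        using this
    rw [Fin.sum_univ_three] at this
    exact this
  generalize X w = α at hw
  generalize Y w = β at hw
  generalize Z w = γ at hw
  have hzw : wdg z w = wdg (α • x + β • y) (-z) := by
    rw [hw, wdg_add_right, wdg_smul_right γ, wdg_self, smul_zero, add_zero, wdg_swap,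
      wdg_neg_right]
  -- This makes `α x + β y` part of a basis of `⟨x, y⟩`; it uses that `z ∧ w` is unimodular and that
  -- the ring is local.
  have hunit : IsUnit α ∨ IsUnit β := by
    rw [hzw, wdg_add_left, wdg_smul_left, wdg_smul_left, map_add, map_smul, map_smul, smul_eq_mul,
      smul_eq_mul] at hε
    rcases IsLocalRing.isUnit_or_isUnit_of_add_one hε with h | h
    · exact Or.inl (isUnit_of_mul_isUnit_left h)
    · exact Or.inr (isUnit_of_mul_isUnit_left h)
  rcases hunit with ⟨u, rfl⟩ | ⟨u, rfl⟩
  · refine ⟨(u : R) • x + β • y, ((u⁻¹ : Rˣ) : R) • y, -z, ?_, hzw, ((u⁻¹ : Rˣ) : R) • X, ?_⟩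
    · rw [wdg_smul_right, wdg_add_left, wdg_smul_left, wdg_smul_left, wdg_self, smul_zero,
        add_zero, smul_smul, Units.inv_mul, one_smul]
    · simp [hXx, hXy]
  · refine ⟨α • x + (u : R) • y, (-(u⁻¹ : Rˣ) : R) • x, -z, ?_, hzw, ((u⁻¹ : Rˣ) : R) • Y, ?_⟩
    · rw [wdg_smul_right, wdg_add_left, wdg_smul_left, wdg_smul_left, wdg_self, smul_zero,
        zero_add, smul_smul, neg_mul, Units.inv_mul, wdg_swap y x, neg_smul, one_smul, neg_neg]
    · simp [hYx, hYy]

/-- Two independent decomposable bivectors with decomposable sum have a common factor. -/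
lemma exists_common_factor [Module.Finite ℂ V] [IsLocalRing R] {x y z w s t : R ⊗[ℂ] V}
    {ε ε' : Module.Dual R (R ⊗[ℂ] (⋀[ℂ]^2 V))} (h1 : ε (wdg x y) = 1) (h2 : ε' (wdg x y) = 0)
    (h3 : ε' (wdg z w) = 1) (h : wdg x y + wdg z w = wdg s t) :
    ∃ v a b : R ⊗[ℂ] V, wdg x y = wdg v a ∧ wdg z w = wdg v b ∧
      ∃ φ : Module.Dual R (R ⊗[ℂ] V), φ v = 1 := by
  let X : Module.Dual R (R ⊗[ℂ] V) := -wdgDual ε y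
  let Y : Module.Dual R (R ⊗[ℂ] V) := wdgDual ε x
  have hXx : X x = 1 := by simp [X, wdgDual_apply, wdg_swap y x, h1]
  have hXy : X y = 0 := by simp [X, wdgDual_apply, wdg_self]
  have hYx : Y x = 0 := by simp [Y, wdgDual_apply, wdg_self]
  have hYy : Y y = 1 := by simp [Y, wdgDual_apply, h1]
  have core (z w : R ⊗[ℂ] V) (h3 : ε' (wdg z w) = 1) (h : wdg x y + wdg z w = wdg s t)
      (χ' : Module.Dual R (R ⊗[ℂ] V)) (hu : IsUnit (χ' (z - X z • x - Y z • y))) :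
      ∃ v a b : R ⊗[ℂ] V, wdg x y = wdg v a ∧ wdg z w = wdg v b ∧
        ∃ φ : Module.Dual R (R ⊗[ℂ] V), φ v = 1 := by
    obtain ⟨u, hu⟩ := hu
    let χ : Module.Dual R (R ⊗[ℂ] V) := ((u⁻¹ : Rˣ) : R) • χ'
    have hχ : χ (z - X z • x - Y z • y) = 1 := by
      rw [LinearMap.smul_apply, ← hu, smul_eq_mul, Units.inv_mul]
    let Z : Module.Dual R (R ⊗[ℂ] V) := χ - χ x • X - χ y • Y
    have hZx : Z x = 0 := by simp [Z, hXx, hYx]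
    have hZy : Z y = 0 := by simp [Z, hXy, hYy]
    have hZz : Z z = 1 := by
      simp only [map_sub, map_smul, smul_eq_mul] at hχ
      simp only [Z, LinearMap.sub_apply, LinearMap.smul_apply, smul_eq_mul]
      linear_combination hχ
    exact exists_common_factor_of_isSplit (X := X - X z • Z) (Y := Y - Y z • Z) (Z := Z) h3
      (by simp [hXx, hZx]) (by simp [hXy, hZy]) (by simp [hZz]) (by simp [hYx, hZx])
      (by simp [hYy, hZy]) (by simp [hZz]) hZx hZy hZz h
  -- Modulo `x ∧ y`, on which `ε'` vanishes, `z ∧ w` splits into one term with `z` reduced modulo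
  -- `⟨x, y⟩` and one with `w` reduced. As the values sum to `1`, one of them is a unit, and that
  -- vector is independent of `x, y`.
  have hsum : wdgDual (-ε') w (z - X z • x - Y z • y) +
      wdgDual ε' (X z • x + Y z • y) (w - X w • x - Y w • y) = 1 := by
    have : wdg (z - X z • x - Y z • y) w + wdg (X z • x + Y z • y) (w - X w • x - Y w • y) =
        wdg z w - (X z * Y w - Y z * X w) • wdg x y := by
      simp only [wdg_sub_left, wdg_sub_right, wdg_add_left, wdg_smul_left, wdg_smul_right, wdg_self,
        wdg_swap y x]
      module
    rw [wdgDual_apply (-ε'), wdgDual_apply ε' (X z • x + Y z • y), LinearMap.neg_apply, wdg_swap w,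
      map_neg, neg_neg, ← map_add, this, map_sub, map_smul, h2, h3, smul_zero, sub_zero]
  rcases IsLocalRing.isUnit_or_isUnit_of_add_one hsum with hu | hu
  · exact core z w h3 h _ hu
  -- The second case reduces to the first by writing `z ∧ w = w ∧ (-z)`.
  · have hz' : wdg w (-z) = wdg z w := by rw [wdg_neg_right, ← wdg_swap]
    obtain ⟨v, a, b, e1, e2, e3⟩ := core w (-z) (by rw [hz', h3]) (by rw [hz', h]) _ hu
    exact ⟨v, a, b, e1, by rw [← hz', e2], e3⟩

end Decomposable

end

end GushelMukai

namespace GushelMukai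

noncomputable section

/-! ### Linear spaces of decomposable bivectors -/

section LinearSpaces

variable {V : Type} [AddCommGroup V] [Module ℂ V] {R S : CommAlgCat.{0} ℂ}

lemma pair_add_left (φ φ' ψ : Module.Dual R (R ⊗[ℂ] V)) (e : R ⊗[ℂ] (⋀[ℂ]^2 V)) :
    pair (φ + φ') ψ e = pair φ ψ e + pair φ' ψ e := by
  simp [pair, contr_add]

lemma pair_smul_left (r : R) (φ ψ : Module.Dual R (R ⊗[ℂ] V)) (e : R ⊗[ℂ] (⋀[ℂ]^2 V)) :
    pair (r • φ) ψ e = r * pair φ ψ e := by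
  simp [pair, contr_smul]

lemma pair_add_right (φ ψ ψ' : Module.Dual R (R ⊗[ℂ] V)) (e : R ⊗[ℂ] (⋀[ℂ]^2 V)) :
    pair φ (ψ + ψ') e = pair φ ψ e + pair φ ψ' e := rfl

lemma pair_smul_right (r : R) (φ ψ : Module.Dual R (R ⊗[ℂ] V)) (e : R ⊗[ℂ] (⋀[ℂ]^2 V)) :
    pair φ (r • ψ) e = r * pair φ ψ e := rfl

lemma extendScalars_pair (f : R ⟶ S) (φ ψ : Module.Dual R (R ⊗[ℂ] V))
    (e : R ⊗[ℂ] (⋀[ℂ]^2 V)) :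
    pair (extDual f φ) (extDual f ψ) (extendScalars f e) = f.hom (pair φ ψ e) := by
  rw [pair, LinearMap.comp_apply, ← extendScalars_contr, extDual_extendScalars]
  rfl

/-- A bivector is divisible by a unimodular vector `v` when it is isotropic on the annihilator
of `v`. -/
lemma eq_wdg_contr [Module.Finite ℂ V] {v : R ⊗[ℂ] V} {X : Module.Dual R (R ⊗[ℂ] V)}
    (hX : X v = 1) {e : R ⊗[ℂ] (⋀[ℂ]^2 V)}
    (h : ∀ φ ψ : Module.Dual R (R ⊗[ℂ] V), φ v = 0 → ψ v = 0 → pair φ ψ e = 0) :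
    e = wdg v (contr X e) := by
  rw [← sub_eq_zero]
  refine eq_zero_of_contr fun φ => eq_of_dual fun ψ => ?_
  rw [map_sub, map_sub, map_zero, sub_eq_zero]
  change pair φ ψ e = pair φ ψ _
  rw [pair_wdg]
  have h0 := h (φ - φ v • X) (ψ - ψ v • X) (by simp [hX]) (by simp [hX])
  have hφ : φ = (φ - φ v • X) + φ v • X := by simp
  have hψ : ψ = (ψ - ψ v • X) + ψ v • X := by simp
  have e1 : pair φ ψ e = φ v * pair X ψ e - ψ v * pair X φ e := by
    rw [pair_swap X φ e]
    conv_lhs => rw [hφ, hψ]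
    conv_rhs => rw [hφ, hψ]
    simp only [pair_add_left, pair_add_right, pair_smul_left, pair_smul_right, h0, pair_self,
      LinearMap.add_apply, LinearMap.sub_apply, LinearMap.smul_apply, hX, smul_eq_mul]
    ring_nf
  rw [e1]
  simp only [pair, LinearMap.comp_apply]
  ring

/-- A linear space of decomposable bivectors containing `v ∧ a` and `v ∧ b` consists of multiples of
`v`, provided it contains a bivector which is not in `v ∧ ⟨a, b⟩`. -/
lemma eq_wdg_of_plueckerForm [Module.Finite ℂ V] {E : Submodule R (R ⊗[ℂ] (⋀[ℂ]^2 V))}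
    (hE : ∀ x ∈ E, ∀ y ∈ E, ∀ φ₁ φ₂ φ₃ φ₄ : Module.Dual R (R ⊗[ℂ] V),
      plueckerForm φ₁ φ₂ φ₃ φ₄ x y = 0)
    {v a b : R ⊗[ℂ] V} (ha : wdg v a ∈ E) (hb : wdg v b ∈ E)
    {X Y Z ζ : Module.Dual R (R ⊗[ℂ] V)}
    (hXv : X v = 1) (hXa : X a = 0) (hXb : X b = 0) (hYv : Y v = 0) (hYa : Y a = 1) (hYb : Y b = 0)
    (hZv : Z v = 0) (hZa : Z a = 0) (hZb : Z b = 1) (hζv : ζ v = 0) (hζa : ζ a = 0) (hζb : ζ b = 0)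
    {e₂ : R ⊗[ℂ] (⋀[ℂ]^2 V)} (he₂ : e₂ ∈ E) (hu : IsUnit (pair X ζ e₂)) {e : R ⊗[ℂ] (⋀[ℂ]^2 V)}
    (he : e ∈ E) : e = wdg v (contr X e) := by
  -- Against `v ∧ a`, the Plücker form of `X, Y, ψ, ψ'` is just the pairing of `e` with `ψ, ψ'`; so
  -- `e` is isotropic on the annihilator of `v` and `a`, and `h2` says the same for `v` and `b`.
  have h1 {e} (he : e ∈ E) (ψ ψ' : Module.Dual R (R ⊗[ℂ] V)) (hv : ψ v = 0) (hv' : ψ' v = 0)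
      (ha₁ : ψ a = 0) (ha' : ψ' a = 0) : pair ψ ψ' e = 0 := by
    simpa [plueckerForm, pair_wdg, hXv, hXa, hYv, hYa, hv, hv', ha₁, ha'] using
      hE _ ha _ he X Y ψ ψ'
  have h2 {e} (he : e ∈ E) (ψ ψ' : Module.Dual R (R ⊗[ℂ] V)) (hv : ψ v = 0) (hv' : ψ' v = 0)
      (ha : ψ b = 0) (ha' : ψ' b = 0) : pair ψ ψ' e = 0 := by
    simpa [plueckerForm, pair_wdg, hXv, hXb, hZv, hZb, hv, hv', ha, ha'] using
      hE _ hb _ he X Z ψ ψ'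
  have h3 {e e'} (he : e ∈ E) (he' : e' ∈ E) :
      pair X ζ e * pair Y Z e' + pair Y Z e * pair X ζ e' = 0 := by
    have := hE _ he _ he' X ζ Y Z
    simpa [plueckerForm, h1 he ζ Z hζv hZv hζa hZa, h1 he' ζ Z hζv hZv hζa hZa,
      h2 he ζ Y hζv hYv hζb hYb, h2 he' ζ Y hζv hYv hζb hYb] using this
  -- The only remaining obstruction to divisibility by `v` is the `a ∧ b`-coefficient `pair Y Z`.
  -- Relation `h3` kills it first for `e₂`, whose coefficient `pair X ζ` is a unit, and then for
  -- every element of `E`.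
  have h4 : pair Y Z e₂ = 0 := by
    have := h3 he₂ he₂
    rw [mul_comm (pair Y Z e₂), ← two_mul] at this
    exact hu.mul_right_eq_zero.1 ((isUnit_two R).mul_right_eq_zero.1 this)
  have h5 : pair Y Z e = 0 := by
    have := h3 he he₂
    rw [h4, mul_zero, zero_add] at this
    exact hu.mul_left_eq_zero.1 this
  refine eq_wdg_contr hXv fun φ ψ hφ hψ => ?_
  have hφ' : φ = (φ - φ a • Y - φ b • Z) + (φ a • Y + φ b • Z) := by abel
  have hψ' : ψ = (ψ - ψ a • Y - ψ b • Z) + (ψ a • Y + ψ b • Z) := by abel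
  have k1 : (φ - φ a • Y - φ b • Z) v = 0 := by simp [hφ, hYv, hZv]
  have k2 : (φ - φ a • Y - φ b • Z) a = 0 := by simp [hYa, hZa]
  have k3 : (φ - φ a • Y - φ b • Z) b = 0 := by simp [hYb, hZb]
  have l1 : (ψ - ψ a • Y - ψ b • Z) v = 0 := by simp [hψ, hYv, hZv]
  have l2 : (ψ - ψ a • Y - ψ b • Z) a = 0 := by simp [hYa, hZa]
  have l3 : (ψ - ψ a • Y - ψ b • Z) b = 0 := by simp [hYb, hZb]
  rw [hφ', hψ']
  generalize φ - φ a • Y - φ b • Z = φ₀ at *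
  generalize ψ - ψ a • Y - ψ b • Z = ψ₀ at *
  simp only [pair_add_left, pair_add_right, pair_smul_left, pair_smul_right, pair_self, h5,
    pair_swap Z Y, h1 he φ₀ ψ₀ k1 l1 k2 l2, h2 he φ₀ Y k1 hYv k3 hYb, h1 he φ₀ Z k1 hZv k2 hZa,
    h2 he Y ψ₀ hYv l1 hYb l3, h1 he Z ψ₀ hZv l1 hZa l2]
  simp

/-- A linear space spanned by bivectors with decomposable pairwise sums is totally isotropic for the
Plücker relations. -/
lemma exists_wdg_of_line [Module.Finite ℂ V] [IsLocalRing R] (hV : 2 ≤ Module.finrank ℂ V)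
    {E : Submodule R (R ⊗[ℂ] (⋀[ℂ]^2 V))}
    (hE : ∀ m : (PP (⋀[ℂ]^2 V)).obj R, toSub m ≤ E →
      ∃ U : (Gr 2 V).obj R, toSub m = wedgeSub V (toSub U) (toSub U))
    {e : R ⊗[ℂ] (⋀[ℂ]^2 V)} (he : e ∈ E) {ε : Module.Dual R (R ⊗[ℂ] (⋀[ℂ]^2 V))} (hε : ε e = 1) :
    ∃ x y, e = wdg x y := by
  obtain ⟨m, hm⟩ := exists_pp hε
  obtain ⟨U, hU⟩ := hE m (by rw [hm, Submodule.span_le]; simpa using he)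
  obtain ⟨u, -, hu⟩ := exists_isSplit_span hV U
  rw [hu, range_fin_two, wedgeSub_span_pair, hm] at hU
  have := Submodule.mem_span_singleton_self (R := R) e
  rw [hU] at this
  obtain ⟨c, hc⟩ := Submodule.mem_span_singleton.1 this
  exact ⟨c • u 0, u 1, by rw [wdg_smul_left, hc]⟩

/-- A vector over an extension is in the span of a split family when it is killed by the base changes
of all functionals killing the family. -/
lemma mem_span_extendScalars [Module.Finite ℂ V] (f : R ⟶ S) {k : ℕ} {e : Fin k → R ⊗[ℂ] V}
    {d : Fin k → Module.Dual R (R ⊗[ℂ] V)} (hd : ∀ i j, d i (e j) = if i = j then 1 else 0)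
    {x : S ⊗[ℂ] V}
    (h : ∀ φ : Module.Dual R (R ⊗[ℂ] V), (∀ i, φ (e i) = 0) → extDual f φ x = 0) :
    x ∈ Submodule.span S (Set.range fun j => extendScalars f (e j)) := by
  have : x = ∑ j, extDual f (d j) x • extendScalars f (e j) := by
    refine eq_of_coordExt fun l => ?_
    let ζ := coordExt R V l - ∑ j, coordExt R V l (e j) • d j
    have h := h ζ fun j => by simp [ζ, hd]
    have hlin : extDual f ζ = coordExt S V l - ∑ j,
        f.hom (coordExt R V l (e j)) • extDual f (d j) := by
      refine (stdBasisExt S V).ext fun m => ?_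
      rw [← extendScalars_stdBasisExt f, extDual_extendScalars]
      simp [ζ, extDual_extendScalars, coordExt_extendScalars]
    rw [hlin, LinearMap.sub_apply, sub_eq_zero] at h
    rw [h]
    simp [map_sum, coordExt_extendScalars, mul_comm]
  rw [this]
  exact Submodule.sum_mem _ fun j _ => Submodule.smul_mem _ _ (Submodule.subset_span ⟨j, rfl⟩)

/-- Over a local ring, a linear space of dimension `r ≥ 1` in the Grassmannian of lines, of
`σ`-type at the closed point, consists of the multiples of a vector `v`. -/
theorem exists_vertex_of_isLocalRing [Module.Finite ℂ V] [IsLocalRing R]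
    (hV : Module.finrank ℂ V = 5) {K : Type} [Field K] [Algebra ℂ K]
    (f : R ⟶ CommAlgCat.of ℂ K) [IsLocalHom f.hom.toRingHom] {r : ℕ} (hr : 1 ≤ r) (hr3 : r ≤ 3)
    (E : (Gr (r + 1) (⋀[ℂ]^2 V)).obj R)
    (hE : ∀ m : (PP (⋀[ℂ]^2 V)).obj R, toSub m ≤ toSub E →
      ∃ U : (Gr 2 V).obj R, toSub m = wedgeSub V (toSub U) (toSub U))
    (V₁ : (PP V).obj (CommAlgCat.of ℂ K)) (V₂ : (Gr (r + 2) V).obj (CommAlgCat.of ℂ K))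
    (hσ : extSub f (toSub E) = wedgeSub V (toSub V₁) (toSub V₂)) :
    ∃ (v : R ⊗[ℂ] V) (a : Fin 2 → R ⊗[ℂ] V) (φ : Module.Dual R (R ⊗[ℂ] V)), φ v = 1 ∧
      IsSplit (R := R) (fun i => wdg v (a i)) ∧ (∀ i, wdg v (a i) ∈ toSub E) ∧
      toSub E ≤ wedgeSub V (Submodule.span R {v}) ⊤ := by
  have hdim : Module.finrank ℂ (⋀[ℂ]^2 V) = 10 := by
    rw [exteriorPower.finrank_eq, hV]; rfl
  obtain ⟨e, ⟨d, hd⟩, he⟩ := exists_isSplit_span (by omega) E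
  have hmem (i) : e i ∈ toSub E := by rw [he]; exact Submodule.subset_span ⟨i, rfl⟩
  have hdec {x} (hx : x ∈ toSub E) {ε : Module.Dual R (R ⊗[ℂ] (⋀[ℂ]^2 V))} (hε : ε x = 1) :=
    exists_wdg_of_line (by omega) hE hx hε
  have hdec1 (i) : ∃ x y, e i = wdg x y := hdec (hmem i) (ε := d i) (by simp [hd])
  have hdec2 {i j} (hij : i ≠ j) : ∃ x y, e i + e j = wdg x y :=
    hdec (Submodule.add_mem _ (hmem i) (hmem j)) (ε := d i) (by simp [hd, hij])
  -- All lines in `E` are Plücker images, so basis bivectors and their pairwise sums are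
  -- decomposable, and bilinearity extends the relations to `E`.
  have hpl : ∀ x ∈ toSub E, ∀ y ∈ toSub E, ∀ φ₁ φ₂ φ₃ φ₄ : Module.Dual R (R ⊗[ℂ] V),
      plueckerForm φ₁ φ₂ φ₃ φ₄ x y = 0 := by
    intro x hx y hy φ₁ φ₂ φ₃ φ₄
    rw [he] at hx hy
    refine plueckerForm_eq_zero_of_span (fun i j => ?_) hx hy
    obtain ⟨x, y, h1⟩ := hdec1 i
    obtain ⟨z, w, h2⟩ := hdec1 j
    by_cases hij : i = j
    · subst hij; rw [h1]; exact plueckerForm_wdg _ _ _ _ _ _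
    · obtain ⟨s, t, h3⟩ := hdec2 hij
      rw [h1, h2] at h3 ⊢
      exact plueckerForm_polar _ _ _ _ _ _ _ _ _ _ h3
  let i₀ : Fin (r + 1) := ⟨0, by omega⟩
  let i₁ : Fin (r + 1) := ⟨1, by omega⟩
  have h01 : i₀ ≠ i₁ := by simp [i₀, i₁]
  obtain ⟨x, y, h1⟩ := hdec1 i₀
  obtain ⟨z, w, h2⟩ := hdec1 i₁
  obtain ⟨s, t, h3⟩ := hdec2 h01
  obtain ⟨v, a, b, e1, e2, φ, hφ⟩ := exists_common_factor (ε := d i₀) (ε' := d i₁) (x := x) (y := y)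
    (z := z) (w := w) (s := s) (t := t) (by rw [← h1]; simp [hd]) (by rw [← h1]; simp [hd, h01.symm])
    (by rw [← h2]; simp [hd]) (by rw [← h1, ← h2, h3])
  rw [← h1] at e1
  rw [← h2] at e2
  have hab (i : Fin 2) : wdg v ((![a, b] : Fin 2 → R ⊗[ℂ] V) i) = e (![i₀, i₁] i) := by
    fin_cases i
    · exact e1.symm
    · exact e2.symm
  have hinj : Function.Injective ![i₀, i₁] := by
    intro i j hij
    fin_cases i <;> fin_cases j <;> simp_all
  have hsplit : IsSplit (R := R) fun i => wdg v ((![a, b] : Fin 2 → R ⊗[ℂ] V) i) := by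
    simp only [hab]
    exact IsSplit.comp ⟨d, hd⟩ _ hinj
  refine ⟨v, ![a, b], φ, hφ, hsplit, fun i => by rw [hab]; exact hmem _, ?_⟩
  obtain rfl | hr2 := hr.eq_or_lt
  · rw [he, Submodule.span_le]
    rintro _ ⟨i, rfl⟩
    refine mem_wedgeSub_span_singleton.2 ?_
    have : i = i₀ ∨ i = i₁ := by
      simp only [i₀, i₁, Fin.ext_iff]; omega
    rcases this with rfl | rfl
    · exact ⟨a, trivial, e1.symm⟩
    · exact ⟨b, trivial, e2.symm⟩
  obtain ⟨D, hD⟩ := hsplit.cons_of_wdg hφ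
  have hXv : D 0 v = 1 := hD 0 0
  have hXa : D 0 a = 0 := hD 0 1
  have hXb : D 0 b = 0 := hD 0 2
  have hYv : D 1 v = 0 := hD 1 0
  have hYa : D 1 a = 1 := hD 1 1
  have hYb : D 1 b = 0 := hD 1 2
  have hZv : D 2 v = 0 := hD 2 0
  have hZa : D 2 a = 0 := hD 2 1
  have hZb : D 2 b = 1 := hD 2 2
  -- It remains to find a bivector of `E` leaving `⋀² ⟨v, a, b⟩`. If there is none, every such
  -- coefficient is a nonunit and hence vanishes at the closed point, where `E` becomes `V₁ ∧ V₂`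
  -- with `V₁` spanned by the image of `v`; every `ζ` then kills `V₂`.
  suffices h : ∃ e₂ ∈ toSub E, ∃ ζ : Module.Dual R (R ⊗[ℂ] V), ζ v = 0 ∧ ζ a = 0 ∧ ζ b = 0 ∧
      IsUnit (pair (D 0) ζ e₂) by
    obtain ⟨e₂, he₂, ζ, hζv, hζa, hζb, hu⟩ := h
    intro x hx
    exact mem_wedgeSub_span_singleton.2 ⟨_, trivial, (eq_wdg_of_plueckerForm hpl
      (e1 ▸ hmem i₀) (e2 ▸ hmem i₁) hXv hXa hXb hYv hYa hYb hZv hZa hZb hζv hζa hζb he₂ hu hx).symm⟩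
  by_contra hcon
  push Not at hcon
  have hzero (ζ : Module.Dual R (R ⊗[ℂ] V)) (hζv : ζ v = 0) (hζa : ζ a = 0) (hζb : ζ b = 0)
      {x} (hx : x ∈ extSub f (toSub E)) : pair (extDual f (D 0)) (extDual f ζ) x = 0 := by
    have : extSub f (toSub E) ≤ LinearMap.ker (pair (extDual f (D 0)) (extDual f ζ)) := by
      refine extSub_le.2 fun x hx => ?_
      rw [LinearMap.mem_ker, extendScalars_pair]
      by_contra h0
      refine hcon x hx ζ hζv hζa hζb (isUnit_of_map_unit f.hom.toRingHom _ ?_)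
      exact (Ne.isUnit h0 : IsUnit (M := K) _)
    exact this hx
  have hlocK : IsLocalRing (CommAlgCat.of ℂ K) := inferInstanceAs (IsLocalRing K)
  obtain ⟨v', φ', hφ', hv'⟩ := exists_unimodular (by omega) V₁
  obtain ⟨u, hu, hu'⟩ := exists_isSplit_span (by omega) V₂
  rw [hv'] at hσ
  have hK (i : Fin 2) : ∃ a', wdg v' a' =
      wdg (extendScalars f v) (extendScalars f ((![a, b] : Fin 2 → R ⊗[ℂ] V) i)) := by
    have : extendScalars f (wdg v ((![a, b] : Fin 2 → R ⊗[ℂ] V) i)) ∈ extSub f (toSub E) :=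
      mem_extSub f (by rw [hab]; exact hmem _)
    rw [hσ, mem_wedgeSub_span_singleton] at this
    obtain ⟨a', -, ha'⟩ := this
    exact ⟨a', by rw [ha', extendScalars_wdg]⟩
  choose a' ha' using hK
  have hv'v : v' ∈ Submodule.span (CommAlgCat.of ℂ K) {extendScalars f v} := by
    refine mem_span_of_common_factor (φ := extDual f φ) (a' := a')
      (a := fun i => extendScalars f ((![a, b] : Fin 2 → R ⊗[ℂ] V) i)) ?_ ?_ ha'
    · rw [extDual_extendScalars, hφ, map_one]
    · have := hsplit.ext f
      rwa [funext fun i => extendScalars_wdg f v ((![a, b] : Fin 2 → R ⊗[ℂ] V) i)] at this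
  obtain ⟨c, hc⟩ := Submodule.mem_span_singleton.1 hv'v
  have hc0 : c ≠ 0 := by
    rintro rfl
    rw [zero_smul] at hc
    rw [← hc, map_zero] at hφ'
    exact zero_ne_one hφ'
  have hkill (ζ : Module.Dual R (R ⊗[ℂ] V)) (hζv : ζ v = 0) (hζa : ζ a = 0) (hζb : ζ b = 0)
      (i) : extDual f ζ (u i) = 0 := by
    have hmem' : wdg v' (u i) ∈ extSub f (toSub E) := by
      rw [hσ]
      exact wdg_mem_wedgeSub (Submodule.mem_span_singleton_self _)
        (by rw [hu']; exact Submodule.subset_span ⟨i, rfl⟩)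
    have := hzero ζ hζv hζa hζb hmem'
    rw [pair_wdg, ← hc, map_smul, map_smul, extDual_extendScalars, extDual_extendScalars, hXv, hζv,
      map_one, map_zero, smul_zero, mul_zero, sub_zero, smul_eq_mul, mul_one] at this
    exact (mul_eq_zero.1 (this : (c : K) * _ = 0)).resolve_left hc0
  have hspan (i) : u i ∈ Submodule.span (CommAlgCat.of ℂ K) (Set.range fun j =>
      extendScalars f ((Fin.cons v ![a, b] : Fin 3 → R ⊗[ℂ] V) j)) := by
    refine mem_span_extendScalars f hD fun ζ hζ => ?_
    exact hkill ζ (hζ 0) (hζ 1) (hζ 2) i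
  classical
  let g (j : Fin 3) : K ⊗[ℂ] V :=
    extendScalars f ((Fin.cons v ![a, b] : Fin 3 → R ⊗[ℂ] V) j)
  let _ : Fintype (Set.range g) := Set.fintypeRange g
  -- So `V₂`, of dimension `r + 2 ≥ 4`, would be contained in the span of three vectors.
  have hcard := linearIndependent_le_span_aux' (R := K) (M := K ⊗[ℂ] V) u hu.linearIndependent
    (Set.range g) (by rintro _ ⟨i, rfl⟩; exact hspan i)
  have h6 := Fintype.card_range_le g
  rw [Fintype.card_fin] at hcard h6
  omega

end LinearSpaces

end

end GushelMukai

namespace GushelMukai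

noncomputable section

/-! ### The vertex and the flag of a linear space of `σ`-type -/

section Vertex

variable {V : Type} [AddCommGroup V] [Module ℂ V] {R S : CommAlgCat.{0} ℂ}

/-- The bilinear map sending `(v ∧ a, v ∧ b)` to a multiple of `v`, the coefficient being the
determinant of the functionals `φ₁, φ₂, φ₃` at `v, a, b`. -/
def vertexMap (φ₁ φ₂ φ₃ : Module.Dual R (R ⊗[ℂ] V)) :
    R ⊗[ℂ] (⋀[ℂ]^2 V) →ₗ[R] R ⊗[ℂ] (⋀[ℂ]^2 V) →ₗ[R] R ⊗[ℂ] V :=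
  LinearMap.mk₂ R (fun e e' => pair φ₂ φ₃ e' • contr φ₁ e + pair φ₃ φ₁ e' • contr φ₂ e +
      pair φ₁ φ₂ e' • contr φ₃ e)
    (fun _ _ _ => by simp only [map_add, smul_add]; abel)
    (fun _ _ _ => by simp only [map_smul]; module)
    (fun _ _ _ => by simp only [map_add, add_smul]; abel)
    (fun _ _ _ => by simp only [map_smul, smul_eq_mul]; module)

lemma vertexMap_apply (φ₁ φ₂ φ₃ : Module.Dual R (R ⊗[ℂ] V)) (e e' : R ⊗[ℂ] (⋀[ℂ]^2 V)) :
    vertexMap φ₁ φ₂ φ₃ e e' = pair φ₂ φ₃ e' • contr φ₁ e + pair φ₃ φ₁ e' • contr φ₂ e +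
      pair φ₁ φ₂ e' • contr φ₃ e := rfl

lemma vertexMap_rotate (φ₁ φ₂ φ₃ : Module.Dual R (R ⊗[ℂ] V)) (e e' : R ⊗[ℂ] (⋀[ℂ]^2 V)) :
    vertexMap φ₁ φ₂ φ₃ e e' = vertexMap φ₂ φ₃ φ₁ e e' := by
  simp only [vertexMap_apply]; abel

lemma vertexMap_wdg (φ₁ φ₂ φ₃ : Module.Dual R (R ⊗[ℂ] V)) (v a b : R ⊗[ℂ] V) :
    vertexMap φ₁ φ₂ φ₃ (wdg v a) (wdg v b) =
      -(φ₁ a * (φ₂ v * φ₃ b - φ₂ b * φ₃ v) + φ₂ a * (φ₃ v * φ₁ b - φ₃ b * φ₁ v) +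
        φ₃ a * (φ₁ v * φ₂ b - φ₁ b * φ₂ v)) • v := by
  simp only [vertexMap_apply, pair_wdg, contr_wdg]
  module

lemma extendScalars_vertexMap (f : R ⟶ S) (φ₁ φ₂ φ₃ : Module.Dual R (R ⊗[ℂ] V))
    (e e' : R ⊗[ℂ] (⋀[ℂ]^2 V)) :
    extendScalars f (vertexMap φ₁ φ₂ φ₃ e e') = vertexMap (extDual f φ₁) (extDual f φ₂)
      (extDual f φ₃) (extendScalars f e) (extendScalars f e') := by
  simp only [vertexMap_apply, map_add, extendScalars_smul, extendScalars_contr, extendScalars_pair]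

variable [Module.Finite ℂ V]

lemma induction_dual {p : Module.Dual R (R ⊗[ℂ] V) → Prop} (h0 : p 0)
    (hadd : ∀ φ ψ, p φ → p ψ → p (φ + ψ)) (hsmul : ∀ (r : R) φ, p φ → p (r • φ))
    (hc : ∀ i, p (coordExt R V i)) (φ) : p φ := by
  rw [dual_eq_sum_coordExt φ]
  exact Finset.sum_induction _ p hadd h0 fun i _ => hsmul _ _ (hc i)

/-- The span of the vectors `v` such that `v ∧ a, v ∧ b` are independent elements of `E`. -/
def vertexSub (E : Submodule R (R ⊗[ℂ] (⋀[ℂ]^2 V))) : Submodule R (R ⊗[ℂ] V) :=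
  ⨆ i, ⨆ j, ⨆ l, Submodule.map₂
    (vertexMap (coordExt R V i) (coordExt R V j) (coordExt R V l)) E E

/-- The definition of `vertexSub` uses only coordinate functionals, which makes it visibly
compatible with base change; trilinearity in the functionals recovers all the others. Cyclic
symmetry brings each argument in turn to the first slot. -/
lemma vertexMap_mem_vertexSub {E : Submodule R (R ⊗[ℂ] (⋀[ℂ]^2 V))} {e e' : R ⊗[ℂ] (⋀[ℂ]^2 V)}
    (he : e ∈ E) (he' : e' ∈ E) (φ₁ φ₂ φ₃ : Module.Dual R (R ⊗[ℂ] V)) :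
    vertexMap φ₁ φ₂ φ₃ e e' ∈ vertexSub E := by
  have step {φ₂ φ₃ : Module.Dual R (R ⊗[ℂ] V)}
      (h : ∀ i, vertexMap (coordExt R V i) φ₂ φ₃ e e' ∈ vertexSub E)
      (φ : Module.Dual R (R ⊗[ℂ] V)) : vertexMap φ φ₂ φ₃ e e' ∈ vertexSub E := by
    induction φ using induction_dual with
    | h0 =>
      have : vertexMap 0 φ₂ φ₃ e e' = 0 := by
        have := vertexMap_apply ((0 : R) • φ₂) φ₂ φ₃ e e'
        rw [pair_smul_left, pair_smul_right, contr_smul] at this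
        simpa using this
      rw [this]; exact Submodule.zero_mem _
    | hadd φ ψ hφ hψ =>
      have : vertexMap (φ + ψ) φ₂ φ₃ e e' = vertexMap φ φ₂ φ₃ e e' + vertexMap ψ φ₂ φ₃ e e' := by
        simp only [vertexMap_apply, pair_add_left, pair_add_right, contr_add]
        module
      rw [this]; exact Submodule.add_mem _ hφ hψ
    | hsmul r φ hφ =>
      have : vertexMap (r • φ) φ₂ φ₃ e e' = r • vertexMap φ φ₂ φ₃ e e' := by
        simp only [vertexMap_apply, pair_smul_left, pair_smul_right, contr_smul]
        module
      rw [this]; exact Submodule.smul_mem _ _ hφ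
    | hc i => exact h i
  refine step (fun i => ?_) _
  rw [vertexMap_rotate]
  refine step (fun j => ?_) _
  rw [vertexMap_rotate]
  refine step (fun l => ?_) _
  exact (le_iSup_of_le l <| le_iSup_of_le i <| le_iSup_of_le j le_rfl :
    Submodule.map₂ (vertexMap (coordExt R V l) (coordExt R V i) (coordExt R V j)) E E ≤
      vertexSub E) (Submodule.apply_mem_map₂ _ he he')

lemma extSub_vertexSub (f : R ⟶ S) (E : Submodule R (R ⊗[ℂ] (⋀[ℂ]^2 V))) :
    extSub f (vertexSub E) = vertexSub (extSub f E) := by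
  simp only [vertexSub, extSub_iSup]
  congr! 6 with i j l
  refine extSub_map₂ f _ _ (fun x y => ?_) _ _
  rw [extendScalars_vertexMap, extDual_coordExt, extDual_coordExt, extDual_coordExt]

lemma vertexSub_fg {E : Submodule R (R ⊗[ℂ] (⋀[ℂ]^2 V))} (hE : E.FG) : (vertexSub E).FG :=
  Submodule.fg_iSup _ fun _ => Submodule.fg_iSup _ fun _ => Submodule.fg_iSup _ fun _ =>
    hE.map₂ _ hE

/-- On multiples of `v` all values of `vertexMap` are multiples of `v`, and on `v ∧ a 0`, `v ∧ a 1`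
the functionals dual to `v, a 0, a 1` give exactly `v`. -/
lemma vertexSub_eq_span {E : Submodule R (R ⊗[ℂ] (⋀[ℂ]^2 V))} {v : R ⊗[ℂ] V}
    {a : Fin 2 → R ⊗[ℂ] V} {φ : Module.Dual R (R ⊗[ℂ] V)} (hφ : φ v = 1)
    (ha : IsSplit (R := R) fun i => wdg v (a i)) (haE : ∀ i, wdg v (a i) ∈ E)
    (hE : E ≤ wedgeSub V (Submodule.span R {v}) ⊤) : vertexSub E = Submodule.span R {v} := by
  apply le_antisymm
  · refine iSup_le fun i => iSup_le fun j => iSup_le fun l => Submodule.map₂_le.2 fun x hx y hy => ?_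
    obtain ⟨a, -, rfl⟩ := mem_wedgeSub_span_singleton.1 (hE hx)
    obtain ⟨b, -, rfl⟩ := mem_wedgeSub_span_singleton.1 (hE hy)
    rw [vertexMap_wdg]
    exact Submodule.smul_mem _ _ (Submodule.mem_span_singleton_self v)
  · rw [Submodule.span_singleton_le_iff_mem]
    obtain ⟨d, hd⟩ := ha.cons_of_wdg hφ
    have h := vertexMap_mem_vertexSub (haE 0) (haE 1) (d 0) (d 1) (d 2)
    have hv (i : Fin 3) : d i v = if i = 0 then 1 else 0 := hd i 0
    have h0 (i : Fin 3) : d i (a 0) = if i = 1 then 1 else 0 := hd i 1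
    have h1 (i : Fin 3) : d i (a 1) = if i = 2 then 1 else 0 := hd i 2
    rw [vertexMap_wdg] at h
    simpa [hv, h0, h1] using h

/-- The point of projective space given by locally defined vertices. -/
lemma exists_vertex {E : Submodule R (R ⊗[ℂ] (⋀[ℂ]^2 V))} (hfg : E.FG)
    (h : ∀ (p : Ideal R) [p.IsPrime], ∃ (v : atPrime R p ⊗[ℂ] V) (a : Fin 2 → atPrime R p ⊗[ℂ] V)
      (φ : Module.Dual (atPrime R p) (atPrime R p ⊗[ℂ] V)), φ v = 1 ∧
      IsSplit (R := atPrime R p) (fun i => wdg v (a i)) ∧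
      (∀ i, wdg v (a i) ∈ extSub (toAtPrime R p) E) ∧
      extSub (toAtPrime R p) E ≤ wedgeSub V (Submodule.span (atPrime R p) {v}) ⊤) :
    ∃ V₁ : (PP V).obj R, E ≤ wedgeSub V (toSub V₁) ⊤ := by
  have key (p : Ideal R) [p.IsPrime] : ∃ N : (PP V).obj (atPrime R p),
      toSub N = extSub (toAtPrime R p) (vertexSub E) ∧
      extSub (toAtPrime R p) E ≤ wedgeSub V (toSub N) ⊤ := by
    obtain ⟨v, a, φ, hφ, h1, h2, h3⟩ := h p
    obtain ⟨N, hN⟩ := exists_pp hφ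
    refine ⟨N, ?_, hN ▸ h3⟩
    rw [hN, extSub_vertexSub, vertexSub_eq_span hφ h1 h2 h3]
  obtain ⟨V₁, hV₁⟩ := exists_gr_of_atPrime (vertexSub_fg hfg)
    fun p _ => ⟨_, (key p).choose_spec.1⟩
  refine ⟨V₁, le_of_atPrime fun p _ => ?_⟩
  obtain ⟨N, hN, hE⟩ := key p
  rw [extSub_wedgeSub, hV₁, ← hN, extSub_top]
  exact hE

lemma toSub_fg {M : Type} [AddCommGroup M] [Module ℂ M] [Module.Finite ℂ M] {k : ℕ}
    (N : (Gr k M).obj R) : (toSub N).FG := by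
  have : Module.Finite R ((R ⊗[ℂ] M) ⧸ toSub N) := N.finite_quotient
  have : Module.Projective R ((R ⊗[ℂ] M) ⧸ toSub N) := N.projective_quotient
  have : Module.FinitePresentation R ((R ⊗[ℂ] M) ⧸ toSub N) :=
    Module.finitePresentation_of_projective _ _
  have := Module.FinitePresentation.fg_ker (toSub N).mkQ (Submodule.mkQ_surjective _)
  rwa [Submodule.ker_mkQ] at this

/-- A linear space of multiples of a vector over a local ring. -/
lemma exists_isSplit_wdg [IsLocalRing R] {k : ℕ} (hk : k ≤ Module.finrank ℂ (⋀[ℂ]^2 V))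
    (hV : 1 ≤ Module.finrank ℂ V) (E : (Gr k (⋀[ℂ]^2 V)).obj R) (V₁ : (PP V).obj R)
    (h : toSub E ≤ wedgeSub V (toSub V₁) ⊤) :
    ∃ (v : R ⊗[ℂ] V) (a : Fin k → R ⊗[ℂ] V) (φ : Module.Dual R (R ⊗[ℂ] V)), φ v = 1 ∧
      toSub V₁ = Submodule.span R {v} ∧ IsSplit (R := R) (fun i => wdg v (a i)) ∧
      toSub E = Submodule.span R (Set.range fun i => wdg v (a i)) := by
  obtain ⟨v, φ, hφ, hv⟩ := exists_unimodular hV V₁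
  obtain ⟨e, he, hE⟩ := exists_isSplit_span hk E
  have hdiv (i : Fin k) : ∃ a, wdg v a = e i := by
    have := h (hE ▸ Submodule.subset_span ⟨i, rfl⟩ : e i ∈ toSub E)
    rw [hv, mem_wedgeSub_span_singleton] at this
    obtain ⟨a, -, ha⟩ := this
    exact ⟨a, ha⟩
  choose a ha using hdiv
  obtain rfl : (fun i => wdg v (a i)) = e := funext ha
  exact ⟨v, a, φ, hφ, hv, he, hE⟩

/-- The vertex of a linear space of positive dimension is unique. -/
theorem vertex_unique {k : ℕ} (hk2 : 2 ≤ k) (hk : k ≤ Module.finrank ℂ (⋀[ℂ]^2 V))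
    (hV : 1 ≤ Module.finrank ℂ V) (E : (Gr k (⋀[ℂ]^2 V)).obj R) {V₁ V₁' : (PP V).obj R}
    (h : toSub E ≤ wedgeSub V (toSub V₁) ⊤) (h' : toSub E ≤ wedgeSub V (toSub V₁') ⊤) :
    V₁ = V₁' := by
  have key {V₁ V₁' : (PP V).obj R} (h : toSub E ≤ wedgeSub V (toSub V₁) ⊤)
      (h' : toSub E ≤ wedgeSub V (toSub V₁') ⊤) : toSub V₁' ≤ toSub V₁ := by
    refine le_of_atPrime fun p _ => ?_
    have h := extSub_mono (toAtPrime R p) h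
    have h' := extSub_mono (toAtPrime R p) h'
    rw [extSub_wedgeSub, extSub_top] at h h'
    rw [← toSub_map, ← toSub_map] at h h' ⊢
    obtain ⟨v, a, φ, hφ, hv, hs, hE⟩ := exists_isSplit_wdg hk hV _ _ h
    obtain ⟨v', φ', hφ', hv'⟩ := exists_unimodular hV ((PP V).map (toAtPrime R p) V₁')
    rw [hv, hv', Submodule.span_singleton_le_iff_mem]
    have hdiv (i : Fin k) : ∃ a', wdg v' a' = wdg v (a i) := by
      have := h' (hE ▸ Submodule.subset_span ⟨i, rfl⟩ : wdg v (a i) ∈ _)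
      rw [hv', mem_wedgeSub_span_singleton] at this
      obtain ⟨a', -, ha'⟩ := this
      exact ⟨a', ha'⟩
    choose a' ha' using hdiv
    -- Two members of the basis suffice to determine the vertex, whence `2 ≤ k`.
    exact mem_span_of_common_factor (a := fun i => a (Fin.castLE hk2 i))
      (a' := fun i => a' (Fin.castLE hk2 i)) hφ
      (hs.comp (Fin.castLE hk2) (Fin.castLE_injective hk2)) fun i => ha' _
  exact Module.Grassmannian.ext (le_antisymm (key h' h) (key h h'))

/-- If the Plücker image of a plane is divisible by a line, the line is contained in the plane. -/
theorem le_of_wedgeSub_le (hV : 2 ≤ Module.finrank ℂ V) {U : (Gr 2 V).obj R} {V₁ : (PP V).obj R}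
    (h : wedgeSub V (toSub U) (toSub U) ≤ wedgeSub V (toSub V₁) ⊤) : toSub V₁ ≤ toSub U := by
  refine le_of_atPrime fun p _ => ?_
  have h := extSub_mono (toAtPrime R p) h
  rw [extSub_wedgeSub, extSub_wedgeSub, extSub_top] at h
  rw [← toSub_map, ← toSub_map] at h ⊢
  obtain ⟨v, φ, hφ, hv⟩ := exists_unimodular (by omega) ((PP V).map (toAtPrime R p) V₁)
  obtain ⟨e, he, hU⟩ := exists_isSplit_span hV ((Gr 2 V).map (toAtPrime R p) U)
  rw [hv, hU] at h ⊢
  have := h (wdg_mem_wedgeSub (Submodule.subset_span ⟨0, rfl⟩) (Submodule.subset_span ⟨1, rfl⟩))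
  rw [mem_wedgeSub_span_singleton] at this
  obtain ⟨a, -, ha⟩ := this
  rw [Submodule.span_singleton_le_iff_mem]
  exact mem_span_of_wdg_eq he ha

/-- If a line is contained in a plane, it divides its Plücker image. -/
theorem wedgeSub_le_of_le (hV : 2 ≤ Module.finrank ℂ V) {U : (Gr 2 V).obj R} {V₁ : (PP V).obj R}
    (h : toSub V₁ ≤ toSub U) :
    wedgeSub V (toSub U) (toSub U) ≤ wedgeSub V (toSub V₁) ⊤ := by
  refine le_of_atPrime fun p _ => ?_
  have h := extSub_mono (toAtPrime R p) h
  rw [extSub_wedgeSub, extSub_wedgeSub, extSub_top]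
  rw [← toSub_map, ← toSub_map] at h ⊢
  obtain ⟨v, φ, hφ, hv⟩ := exists_unimodular (by omega) ((PP V).map (toAtPrime R p) V₁)
  obtain ⟨e, he, hU⟩ := exists_isSplit_span hV ((Gr 2 V).map (toAtPrime R p) U)
  rw [hv, hU, range_fin_two] at h ⊢
  rw [wedgeSub_span_pair, Submodule.span_singleton_le_iff_mem, mem_wedgeSub_span_singleton]
  rw [Submodule.span_singleton_le_iff_mem] at h
  exact ⟨_, trivial, wdg_eq_of_mem_span hφ h⟩

/-- The span of all contractions of the elements of `E`. -/
def supportSub (E : Submodule R (R ⊗[ℂ] (⋀[ℂ]^2 V))) : Submodule R (R ⊗[ℂ] V) :=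
  ⨆ i, E.map (contr (coordExt R V i))

lemma contr_mem_supportSub {E : Submodule R (R ⊗[ℂ] (⋀[ℂ]^2 V))} {e : R ⊗[ℂ] (⋀[ℂ]^2 V)}
    (he : e ∈ E) (φ : Module.Dual R (R ⊗[ℂ] V)) : contr φ e ∈ supportSub E := by
  induction φ using induction_dual with
  | h0 =>
    have := contr_smul 0 0 e
    rw [zero_smul, zero_smul] at this
    rw [this]; exact Submodule.zero_mem _
  | hadd φ ψ hφ hψ => rw [contr_add]; exact Submodule.add_mem _ hφ hψ
  | hsmul r φ hφ => rw [contr_smul]; exact Submodule.smul_mem _ _ hφ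
  | hc i => exact (le_iSup (fun i => E.map (contr (coordExt R V i))) i) ⟨e, he, rfl⟩

lemma extSub_supportSub (f : R ⟶ S) (E : Submodule R (R ⊗[ℂ] (⋀[ℂ]^2 V))) :
    extSub f (supportSub E) = supportSub (extSub f E) := by
  simp only [supportSub, extSub_iSup]
  congr! 2 with i
  refine extSub_map f _ _ (fun x => ?_) _
  rw [extendScalars_contr, extDual_coordExt]

/-- Contracting `v ∧ a j` with the functional dual to `v` yields `a j`; contracting `v ∧ a 0` with
the one dual to `a 0` yields `-v`. The latter needs at least one `a j`, hence `NeZero k`. -/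
lemma supportSub_span {k : ℕ} [NeZero k] {v : R ⊗[ℂ] V} {a : Fin k → R ⊗[ℂ] V}
    {φ : Module.Dual R (R ⊗[ℂ] V)} (hφ : φ v = 1) (h : IsSplit (R := R) fun i => wdg v (a i)) :
    supportSub (Submodule.span R (Set.range fun i => wdg v (a i))) =
      Submodule.span R (Set.range (Fin.cons v a : Fin (k + 1) → R ⊗[ℂ] V)) := by
  apply le_antisymm
  · refine iSup_le fun i => ?_
    rw [Submodule.map_span, Submodule.span_le]
    rintro _ ⟨_, ⟨j, rfl⟩, rfl⟩
    dsimp only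
    rw [contr_wdg]
    exact Submodule.sub_mem _ (Submodule.smul_mem _ _ (Submodule.subset_span ⟨j.succ, rfl⟩))
      (Submodule.smul_mem _ _ (Submodule.subset_span ⟨0, rfl⟩))
  · rw [Submodule.span_le]
    rintro _ ⟨i, rfl⟩
    obtain ⟨d, hd⟩ := h.cons_of_wdg hφ
    have hmem (j) := contr_mem_supportSub (e := wdg v (a j))
      (Submodule.subset_span ⟨j, rfl⟩ :
        wdg v (a j) ∈ Submodule.span R (Set.range fun i => wdg v (a i)))
    have hv (i : Fin (k + 1)) : d i v = if i = 0 then 1 else 0 := hd i 0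
    have ha (i : Fin (k + 1)) (j : Fin k) : d i (a j) = if i = j.succ then 1 else 0 := hd i j.succ
    refine Fin.cases ?_ (fun j => ?_) i
    · have := hmem 0 (d (Fin.succ 0))
      rw [contr_wdg, hv, ha, if_pos rfl, if_neg (Fin.succ_ne_zero _), zero_smul, zero_sub,
        one_smul] at this
      exact (Submodule.neg_mem_iff _).1 this
    · have := hmem j (d 0)
      rw [contr_wdg, hv, ha, if_pos rfl, if_neg (Fin.succ_ne_zero _).symm, zero_smul, sub_zero,
        one_smul] at this
      exact this

/-- A linear space all of whose elements are divisible by a line `V₁` is `V₁ ∧ V₂` for a flag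
`V₁ ≤ V₂`. -/
theorem exists_flag {k : ℕ} [NeZero k] (hk : k ≤ Module.finrank ℂ (⋀[ℂ]^2 V))
    (hV : 1 ≤ Module.finrank ℂ V) (E : (Gr k (⋀[ℂ]^2 V)).obj R) {V₁ : (PP V).obj R}
    (h : toSub E ≤ wedgeSub V (toSub V₁) ⊤) :
    ∃ V₂ : (Gr (k + 1) V).obj R, toSub V₁ ≤ toSub V₂ ∧
      toSub E = wedgeSub V (toSub V₁) (toSub V₂) := by
  have key (p : Ideal R) [p.IsPrime] : (∃ N : (Gr (k + 1) V).obj (atPrime R p),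
      toSub N = extSub (toAtPrime R p) (supportSub (toSub E))) ∧
      extSub (toAtPrime R p) (toSub V₁) ≤ extSub (toAtPrime R p) (supportSub (toSub E)) ∧
      extSub (toAtPrime R p) (toSub E) = wedgeSub V (extSub (toAtPrime R p) (toSub V₁))
        (extSub (toAtPrime R p) (supportSub (toSub E))) := by
    have h := extSub_mono (toAtPrime R p) h
    rw [extSub_wedgeSub, extSub_top] at h
    rw [extSub_supportSub]
    rw [← toSub_map, ← toSub_map] at h ⊢
    obtain ⟨v, a, φ, hφ, hv, hs, hE⟩ := exists_isSplit_wdg hk hV _ _ h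
    rw [hE, hv, supportSub_span hφ hs]
    refine ⟨(hs.cons_of_wdg hφ).exists_gr, ?_, ?_⟩
    · rw [Submodule.span_singleton_le_iff_mem]
      exact Submodule.subset_span ⟨0, rfl⟩
    · refine le_antisymm (Submodule.span_le.2 ?_) (fun x hx => ?_)
      · rintro _ ⟨i, rfl⟩
        exact wdg_mem_wedgeSub (Submodule.mem_span_singleton_self _)
          (Submodule.subset_span ⟨i.succ, rfl⟩)
      · obtain ⟨b, hb, rfl⟩ := mem_wedgeSub_span_singleton.1 hx
        clear hx
        induction hb using Submodule.span_induction with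
        | mem b hb =>
          obtain ⟨i, rfl⟩ := hb
          refine Fin.cases ?_ (fun j => ?_) i
          · rw [Fin.cons_zero, wdg_self]; exact Submodule.zero_mem _
          · exact Submodule.subset_span ⟨j, rfl⟩
        | zero => rw [wdg_zero_right]; exact Submodule.zero_mem _
        | add x y _ _ hx hy =>
          rw [wdg_add_right]
          exact Submodule.add_mem _ hx hy
        | smul r x _ hx =>
          rw [wdg_smul_right]
          exact Submodule.smul_mem _ _ hx
  -- The second step `V₂` of the flag is the support of `E`. Being defined by contractions, it
  -- commutes with localization, so the local verification in `key` glues.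
  have hfg : (supportSub (toSub E)).FG := Submodule.fg_iSup _ fun _ => (toSub_fg E).map _
  obtain ⟨V₂, hV₂⟩ := exists_gr_of_atPrime hfg fun p _ => (key p).1
  refine ⟨V₂, le_of_atPrime fun p _ => ?_, eq_of_atPrime fun p _ => ?_⟩
  · rw [hV₂]; exact (key p).2.1
  · rw [extSub_wedgeSub, hV₂]; exact (key p).2.2

end Vertex

end

end GushelMukai

namespace GushelMukai

noncomputable section

/-! ### The isomorphism with the relative Hilbert scheme -/

/-- The geometric closed point of a local algebra. -/
lemma exists_geometric_point (A : CommAlgCat.{0} ℂ) [IsLocalRing A] :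
    ∃ (K : Type) (_ : Field K) (_ : IsAlgClosed K) (_ : Algebra ℂ K) (f : A ⟶ CommAlgCat.of ℂ K),
      IsLocalHom f.hom.toRingHom := by
  let k := IsLocalRing.ResidueField A
  let K := AlgebraicClosure k
  refine ⟨K, inferInstance, inferInstance, inferInstance,
    CommAlgCat.ofHom (IsScalarTower.toAlgHom ℂ A K), ?_⟩
  have h1 : IsLocalHom (IsLocalRing.residue A) := inferInstance
  have h2 : IsLocalHom (algebraMap k K) := inferInstance
  refine ⟨fun a ha => ?_⟩
  have : (algebraMap A K a) = algebraMap k K (IsLocalRing.residue A a) :=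
    IsScalarTower.algebraMap_apply A k K a
  have ha : IsUnit (algebraMap A K a) := ha
  rw [this] at ha
  exact isUnit_of_map_unit _ _ (isUnit_of_map_unit _ _ ha)

lemma finrank_exteriorPower_two {V : Type} [AddCommGroup V] [Module ℂ V]
    (hV : Module.finrank ℂ V = 5) : Module.finrank ℂ (⋀[ℂ]^2 V) = 10 := by
  have : Module.Finite ℂ V := Module.finite_of_finrank_pos (by omega)
  rw [exteriorPower.finrank_eq, hV]; rfl

section Families

variable {V : Type} [AddCommGroup V] [Module ℂ V] [Module.Finite ℂ V]
  {W : Submodule ℂ (⋀[ℂ]^2 V)} {Q : QuadraticForm ℂ (⋀[ℂ]^2 V)} {r : ℕ} {R R' : CommAlgCat.{0} ℂ}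

omit [Module.Finite ℂ V] in
lemma projTaut_ext {y y' : (projTaut V W Q).obj R}
    (h : (projTautToGM V W Q).app R y = (projTautToGM V W Q).app R y')
    (h' : (rho V W Q).app R y = (rho V W Q).app R y') : y = y' :=
  Subtype.ext (Prod.ext h h')

lemma exists_mem_carrier_of_le {Y S : CommAlgCat.{0} ℂ ⥤ Type} {ρ : Y ⟶ S} {M : Type}
    [AddCommGroup M] [Module ℂ M]
    {h : ∀ R : CommAlgCat.{0} ℂ, Y.obj R → Submodule R (R ⊗[ℂ] M)} (Z : LinearFamily ρ h r R)
    (f : R ⟶ R') (m : (PP M).obj R') (hm : toSub m ≤ extSub f (toSub Z.span)) :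
    ∃ y ∈ Z.carrier f, h R' y = toSub m := by
  rw [← toSub_map] at hm
  exact (Z.bijOn f).surjOn ⟨m, hm, rfl⟩

lemma le_extSub_of_mem_carrier {Y S : CommAlgCat.{0} ℂ ⥤ Type} {ρ : Y ⟶ S} {M : Type}
    [AddCommGroup M] [Module ℂ M]
    {h : ∀ R : CommAlgCat.{0} ℂ, Y.obj R → Submodule R (R ⊗[ℂ] M)} (Z : LinearFamily ρ h r R)
    (f : R ⟶ R') {y : Y.obj R'} (hy : y ∈ Z.carrier f) : h R' y ≤ extSub f (toSub Z.span) := by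
  obtain ⟨m, hm, e⟩ := (Z.bijOn f).mapsTo hy
  rw [e, ← toSub_map]
  exact hm

/-- A family of linear spaces of `σ`-type has a vertex. -/
theorem exists_vertex_fano (hV : Module.finrank ℂ V = 5) (hr : 1 ≤ r) (hr3 : r ≤ 3)
    (Z : (fano V W Q r).obj R) :
    ∃ V₁ : (PP V).obj R, toSub Z.1.span ≤ wedgeSub V (toSub V₁) ⊤ := by
  refine exists_vertex (toSub_fg _) fun p _ => ?_
  obtain ⟨K, _, _, _, g, _⟩ := exists_geometric_point (atPrime R p)
  obtain ⟨V₁, V₂, -, hσ⟩ := Z.2 K (toAtPrime R p ≫ g)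
  rw [toSub_map, ← extSub_extSub, ← toSub_map] at hσ
  rw [← toSub_map]
  refine exists_vertex_of_isLocalRing hV g hr hr3 _ (fun m hm => ?_) V₁ V₂ hσ
  rw [toSub_map] at hm
  obtain ⟨y, -, hy⟩ := exists_mem_carrier_of_le Z.1 (toAtPrime R p) m hm
  exact ⟨y.1, hy.symm⟩

/-- Locally each basis bivector of the span generates the Plücker line of a plane containing the
base line, and such a line consists of multiples of the base. -/
lemma span_le_wedgeSub_base (hV : Module.finrank ℂ V = 5) (hr3 : r ≤ 3)
    (Z : LinearFamily (rho V W Q)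
      (fun R y => pluecker V W Q R ((projTautToGM V W Q).app R y)) r R) :
    toSub Z.span ≤ wedgeSub V (toSub Z.base) ⊤ := by
  have hdim := finrank_exteriorPower_two hV
  refine le_of_atPrime fun p _ => ?_
  obtain ⟨e, ⟨d, hd⟩, he⟩ :=
    exists_isSplit_span (by omega) ((Gr (r + 1) _).map (toAtPrime R p) Z.span)
  rw [toSub_map] at he
  rw [he, Submodule.span_le]
  rintro _ ⟨i, rfl⟩
  obtain ⟨m, hm⟩ := exists_pp (v := e i) (φ := d i) (by simp [hd])
  obtain ⟨y, hy, e⟩ := exists_mem_carrier_of_le Z (toAtPrime R p) m (by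
    rw [hm, he, Submodule.span_singleton_le_iff_mem]; exact Submodule.subset_span ⟨i, rfl⟩)
  have hb := Z.carrier_over _ y hy
  have h1 : toSub ((rho V W Q).app _ y) ≤ toSub ((projTautToGM V W Q).app _ y).1 := y.2
  have h2 := wedgeSub_le_of_le (by omega) h1
  rw [hb, toSub_map] at h2
  rw [extSub_wedgeSub, extSub_top]
  refine h2 ?_
  have : pluecker V W Q _ ((projTautToGM V W Q).app _ y) = toSub m := e
  rw [pluecker] at this
  rw [this, hm]
  exact Submodule.mem_span_singleton_self _

section

variable (hV : Module.finrank ℂ V = 5) (hr : 1 ≤ r) (hr3 : r ≤ 3)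

/-- The vertex of a family of linear spaces of `σ`-type. -/
def vertex (Z : (fano V W Q r).obj R) : (PP V).obj R :=
  (exists_vertex_fano hV hr hr3 Z).choose

lemma span_le_vertex (Z : (fano V W Q r).obj R) :
    toSub Z.1.span ≤ wedgeSub V (toSub (vertex hV hr hr3 Z)) ⊤ :=
  (exists_vertex_fano hV hr hr3 Z).choose_spec

/-- The vertex is obtained by choice over each ring separately; uniqueness is what makes the choices
compatible. Here `1 ≤ r` guarantees a span of rank at least two. -/
lemma vertex_map (f : R ⟶ R') (Z : (fano V W Q r).obj R) :
    vertex hV hr hr3 ((fano V W Q r).map f Z) = (PP V).map f (vertex hV hr hr3 Z) := by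
  have hdim := finrank_exteriorPower_two hV
  refine vertex_unique (by omega) (by omega) (by omega) _
    (span_le_vertex hV hr hr3 ((fano V W Q r).map f Z)) ?_
  have : ((fano V W Q r).map f Z).1.span = (Gr (r + 1) _).map f Z.1.span := rfl
  rw [this, toSub_map, toSub_map, ← extSub_top f, ← extSub_wedgeSub]
  exact extSub_mono f (span_le_vertex hV hr hr3 Z)

/-- This is what lifts the points of the family from `X` to `P(𝒰_X)`: their Plücker lines are
divisible by the vertex, so their planes contain it. -/
lemma vertex_le_of_mem_carrier (Z : (fano V W Q r).obj R) (f : R ⟶ R') {x : (gm V W Q).obj R'}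
    (hx : x ∈ Z.1.carrier f) : toSub ((PP V).map f (vertex hV hr hr3 Z)) ≤ toSub x.1 := by
  refine le_of_wedgeSub_le (by omega) ((le_extSub_of_mem_carrier Z.1 f hx).trans ?_)
  rw [toSub_map, ← extSub_top f, ← extSub_wedgeSub]
  exact extSub_mono f (span_le_vertex hV hr hr3 Z)

/-- The family of linear spaces in the fibres of `ρ` defined by a family of linear spaces of
`σ`-type. -/
def toHilbRho (Z : (fano V W Q r).obj R) : (hilbRho V W Q r).obj R where
  base := vertex hV hr hr3 Z
  span := Z.1.span
  carrier R' f := {y | (projTautToGM V W Q).app R' y ∈ Z.1.carrier f ∧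
    (rho V W Q).app R' y = (PP V).map f (vertex hV hr hr3 Z)}
  carrier_over _ _ _ hy := hy.2
  carrier_map R' R'' f g y hy := by
    refine ⟨?_, ?_⟩
    · have := Z.1.carrier_map f g _ hy.1
      exact this
    · rw [map_map_apply, ← hy.2]
      rfl
  bijOn R' f := by
    refine ⟨fun y hy => (Z.1.bijOn f).mapsTo hy.1, fun y hy y' hy' h => ?_, fun N hN => ?_⟩
    · exact projTaut_ext ((Z.1.bijOn f).injOn hy.1 hy'.1 h) (hy.2.trans hy'.2.symm)
    · obtain ⟨x, hx, e⟩ := (Z.1.bijOn f).surjOn hN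
      exact ⟨⟨(x, (PP V).map f (vertex hV hr hr3 Z)), vertex_le_of_mem_carrier hV hr hr3 Z f hx⟩,
        ⟨hx, rfl⟩, e⟩

lemma image_carrier_toHilbRho (Z : (fano V W Q r).obj R) (f : R ⟶ R') :
    (projTautToGM V W Q).app R' '' LinearFamily.carrier (toHilbRho hV hr hr3 Z) f =
      Z.1.carrier f := by
  refine Set.Subset.antisymm ?_ fun x hx => ?_
  · rintro _ ⟨y, hy, rfl⟩
    exact hy.1
  · exact ⟨⟨(x, (PP V).map f (vertex hV hr hr3 Z)), vertex_le_of_mem_carrier hV hr hr3 Z f hx⟩,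
      ⟨hx, rfl⟩, rfl⟩

include hV hr3 in
lemma span_le_base (Z : (hilbRho V W Q r).obj R) :
    toSub (LinearFamily.span Z) ≤ wedgeSub V (toSub (LinearFamily.base Z)) ⊤ :=
  span_le_wedgeSub_base hV hr3 Z

/-- The family of linear spaces of `σ`-type obtained from a family in the fibres of `ρ` by
projection to `X`. -/
def ofHilbRho (Z : (hilbRho V W Q r).obj R) : (fano V W Q r).obj R :=
  ⟨{ base := PUnit.unit
     span := LinearFamily.span Z
     carrier := fun R' f => (projTautToGM V W Q).app R' '' LinearFamily.carrier Z f
     carrier_over := fun _ _ _ _ => rfl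
     carrier_map := by
       rintro R' R'' f g _ ⟨y, hy, rfl⟩
       exact ⟨_, LinearFamily.carrier_map Z f g y hy, rfl⟩
     bijOn := fun R' f => by
       refine ⟨?_, ?_, fun N hN => ?_⟩
       · rintro _ ⟨y, hy, rfl⟩
         exact (LinearFamily.bijOn Z f).mapsTo hy
       · rintro _ ⟨y, hy, rfl⟩ _ ⟨y', hy', rfl⟩ h
         rw [(LinearFamily.bijOn Z f).injOn hy hy' h]
       · obtain ⟨y, hy, e⟩ := (LinearFamily.bijOn Z f).surjOn hN
         exact ⟨_, ⟨y, hy, rfl⟩, e⟩ }, fun K _ _ _ f => by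
    have hdim := finrank_exteriorPower_two hV
    obtain ⟨V₂, h1, h2⟩ := exists_flag (by omega) (by omega) _ (span_le_base hV hr3 Z)
    refine ⟨(PP V).map f (LinearFamily.base Z), (Gr (r + 2) V).map f V₂, map_mono f h1, ?_⟩
    rw [toSub_map, toSub_map, toSub_map, ← extSub_wedgeSub, ← h2]⟩

lemma ofHilbRho_toHilbRho (Z : (fano V W Q r).obj R) :
    ofHilbRho hV hr hr3 (toHilbRho hV hr hr3 Z) = Z := by
  refine Subtype.ext (LinearFamily.ext rfl rfl ?_)
  funext R' f
  exact image_carrier_toHilbRho hV hr hr3 Z f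

/-- Both the vertex and the base divide the span, so uniqueness identifies them. -/
lemma vertex_ofHilbRho (Z : (hilbRho V W Q r).obj R) :
    vertex hV hr hr3 (ofHilbRho hV hr hr3 Z) = LinearFamily.base Z := by
  have hdim := finrank_exteriorPower_two hV
  exact vertex_unique (by omega) (by omega) (by omega) _
    (span_le_vertex hV hr hr3 (ofHilbRho hV hr hr3 Z)) (span_le_base hV hr3 Z)

lemma toHilbRho_ofHilbRho (Z : (hilbRho V W Q r).obj R) :
    toHilbRho hV hr hr3 (ofHilbRho hV hr hr3 Z) = Z := by
  refine LinearFamily.ext (vertex_ofHilbRho hV hr hr3 Z) rfl ?_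
  funext R' f
  refine Set.Subset.antisymm ?_ fun y hy => ⟨⟨y, hy, rfl⟩, ?_⟩
  · rintro y ⟨⟨y', hy', e⟩, hy⟩
    rw [vertex_ofHilbRho] at hy
    rwa [projTaut_ext e.symm (hy.trans (LinearFamily.carrier_over Z f y' hy').symm)]
  · rw [vertex_ofHilbRho]
    exact LinearFamily.carrier_over Z f y hy

lemma toHilbRho_map (f : R ⟶ R') (Z : (fano V W Q r).obj R) :
    toHilbRho hV hr hr3 ((fano V W Q r).map f Z) =
      (hilbRho V W Q r).map f (toHilbRho hV hr hr3 Z) := by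
  refine LinearFamily.ext (vertex_map hV hr hr3 f Z) rfl ?_
  funext R'' g
  ext y
  refine and_congr Iff.rfl ?_
  rw [vertex_map, ← map_map_apply]

/-- `F_r(X)` is isomorphic to the relative Hilbert scheme of `P^r`'s in the fibres of `ρ`. -/
def fanoIso : fano V W Q r ≅ hilbRho V W Q r :=
  NatIso.ofComponents (fun R =>
    { hom := ↾toHilbRho hV hr hr3
      inv := ↾ofHilbRho hV hr hr3
      hom_inv_id := by
        refine ConcreteCategory.hom_ext _ _ fun Z => ofHilbRho_toHilbRho hV hr hr3 Z
      inv_hom_id := by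
        refine ConcreteCategory.hom_ext _ _ fun Z => toHilbRho_ofHilbRho hV hr hr3 Z })
    fun f => ConcreteCategory.hom_ext _ _ fun Z => toHilbRho_map hV hr hr3 f Z

include hV hr hr3 in
/-- `F_r(X) ≃ Hilb^{P^r}(P(𝒰_X)/P(V))` over `P(V)`. -/
theorem exists_fanoIso : ∃ σ : fano V W Q r ⟶ PP V ⋙ uliftFunctor.{1},
    (∀ (R : CommAlgCat.{0} ℂ) (Z : (fano V W Q r).obj R),
      ∃ V₂ : (Gr (r + 2) V).obj R, toSub (σ.app R Z).down ≤ toSub V₂ ∧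
        toSub Z.1.span = wedgeSub V (toSub (σ.app R Z).down) (toSub V₂)) ∧
    ∃ e : fano V W Q r ≅ hilbRho V W Q r,
      e.hom ≫ hilbRhoToPP V W Q r = σ ∧
      ∀ (R : CommAlgCat.{0} ℂ) (Z : (fano V W Q r).obj R) (R' : CommAlgCat.{0} ℂ) (f : R ⟶ R'),
        (projTautToGM V W Q).app R' '' (LinearFamily.carrier (e.hom.app R Z) f) =
          Z.1.carrier f := by
  have hdim := finrank_exteriorPower_two hV
  refine ⟨(fanoIso hV hr hr3).hom ≫ hilbRhoToPP V W Q r, fun R Z => ?_, fanoIso hV hr hr3, rfl,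
    fun R Z R' f => image_carrier_toHilbRho hV hr hr3 Z f⟩
  exact exists_flag (by omega) (by omega) _ (span_le_vertex hV hr hr3 Z)

end

end Families

end

end GushelMukai

namespace GushelMukai

noncomputable section

/-! ### First-order deformations of points of smooth schemes -/

section FirstOrder

/-- Derivations with values in a large vector space are degenerate on standard smooth algebras. -/
lemma exists_functional_derivation (n : ℕ) (B A K : Type) [CommRing B] [CommRing A] [Algebra B A]
    [Field K] [Algebra A K] [Algebra B K] [IsScalarTower B A K]
    [Algebra.IsStandardSmoothOfRelativeDimension n B A]
    (D : Derivation B A (Fin (n + 1) → K)) :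
    ∃ l : (Fin (n + 1) → K) →ₗ[K] K, l ≠ 0 ∧ ∀ a, l (D a) = 0 := by
  have hA : Nontrivial A := (algebraMap A K).domain_nontrivial
  have : Algebra.IsStandardSmooth B A :=
    Algebra.IsStandardSmoothOfRelativeDimension.isStandardSmooth n
  have hrank := Algebra.IsStandardSmoothOfRelativeDimension.rank_kaehlerDifferential (R := B)
    (S := A) n
  have hfin : Module.finrank A (Ω[A⁄B]) = n := Module.finrank_eq_of_rank_eq hrank
  have hfinite : Module.Finite A (Ω[A⁄B]) := by
    refine Module.finite_of_rank_eq_nat hrank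
  let b := Module.finBasisOfFinrankEq A (Ω[A⁄B]) hfin
  let S : Submodule K (Fin (n + 1) → K) :=
    Submodule.span K (Set.range fun i => D.liftKaehlerDifferential (b i))
  -- The derivation factors through the Kähler differentials, free of rank `n`, so its values span
  -- at most `n` of the `n + 1` dimensions and some nonzero form kills them.
  have hS : Module.finrank K S < n + 1 :=
    (finrank_range_le_card _).trans_lt (by simp)
  have hSt : S < ⊤ := by
    refine lt_top_iff_ne_top.2 fun h => ?_
    rw [h, finrank_top, Module.finrank_fin_fun] at hS
    exact lt_irrefl _ hS
  obtain ⟨l, hl, hSl⟩ := Submodule.exists_le_ker_of_lt_top S hSt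
  refine ⟨l, hl, fun a => hSl ?_⟩
  rw [← D.liftKaehlerDifferential_comp_D, ← b.sum_repr (KaehlerDifferential.D B A a), map_sum]
  refine Submodule.sum_mem _ fun i _ => ?_
  rw [map_smul, ← algebraMap_smul K]
  exact Submodule.smul_mem _ _ (Submodule.subset_span ⟨i, rfl⟩)

/-- The map `K ⊕ ε Kᵐ → K ⊕ ε K` induced by a linear form. -/
def dualMap {K : Type} [Field K] [Algebra ℂ K] {m : ℕ} (l : (Fin m → K) →ₗ[K] K) :
    CommAlgCat.of ℂ (TrivSqZeroExt K (Fin m → K)) ⟶ CommAlgCat.of ℂ (TrivSqZeroExt K K) :=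
  CommAlgCat.ofHom ((TrivSqZeroExt.map l).restrictScalars ℂ)

/-- The ε-part of a ring map to `K ⊕ ε Kᵐ` is a derivation over the residue map, and `hg` makes it
linear over the base ring `B`. -/
lemma exists_functional_ringHom (n : ℕ) {B A K : Type} [CommRing B] [CommRing A] [Field K]
    (φ : B →+* A) (hφ : φ.IsStandardSmoothOfRelativeDimension n)
    (g : A →+* TrivSqZeroExt K (Fin (n + 1) → K)) (hg : ∀ b, (g (φ b)).snd = 0) :
    ∃ l : (Fin (n + 1) → K) →ₗ[K] K, l ≠ 0 ∧ ∀ a, l (g a).snd = 0 := by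
  let _ : Algebra B A := φ.toAlgebra
  let g₀ : A →+* K := (TrivSqZeroExt.fstHom K K (Fin (n + 1) → K)).toRingHom.comp g
  let _ : Algebra A K := g₀.toAlgebra
  let _ : Algebra B K := (g₀.comp φ).toAlgebra
  have : IsScalarTower B A K := IsScalarTower.of_algebraMap_eq fun _ => rfl
  have : Algebra.IsStandardSmoothOfRelativeDimension n B A := hφ
  have hsmul (a : A) (x : Fin (n + 1) → K) : a • x = (g a).fst • x := by
    funext i
    rw [Pi.smul_apply, Pi.smul_apply, Algebra.smul_def]
    rfl
  let D : Derivation B A (Fin (n + 1) → K) :=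
    Derivation.mk'
      { toFun := fun a => (g a).snd
        map_add' := fun a b => by rw [map_add, TrivSqZeroExt.snd_add]
        map_smul' := fun b a => by
          rw [Algebra.smul_def, map_mul, TrivSqZeroExt.snd_mul, RingHom.id_apply,
            ← algebraMap_smul A b, hsmul]
          have : (g (algebraMap B A b)).snd = 0 := hg b
          rw [this, smul_zero, add_zero] }
      fun a b => by
        change (g (a * b)).snd = a • (g b).snd + b • (g a).snd
        rw [map_mul, TrivSqZeroExt.snd_mul, hsmul, hsmul, op_smul_eq_smul]
  exact exists_functional_derivation n B A K D

/-- On a smooth scheme of dimension `n`, a family of `n + 1` tangent vectors at a point is linearly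
dependent. -/
theorem IsSmoothOfDim.exists_functional {n : ℕ} {F : CommAlgCat.{0} ℂ ⥤ Type}
    (hF : IsSmoothOfDim n F) {K : Type} [Field K] [Algebra ℂ K]
    (ξ : F.obj (CommAlgCat.of ℂ (TrivSqZeroExt K (Fin (n + 1) → K)))) :
    ∃ l : (Fin (n + 1) → K) →ₗ[K] K, l ≠ 0 ∧ F.map (dualMap l) ξ = F.map (dualMap 0) ξ := by
  obtain ⟨X, p, hp, ⟨iso⟩⟩ := hF
  suffices h : ∀ x : (pointsFunctor X p).obj
      (CommAlgCat.of ℂ (TrivSqZeroExt K (Fin (n + 1) → K))),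
      ∃ l : (Fin (n + 1) → K) →ₗ[K] K, l ≠ 0 ∧
        (pointsFunctor X p).map (dualMap l) x = (pointsFunctor X p).map (dualMap 0) x by
    obtain ⟨l, hl, h⟩ := h (iso.inv.app _ ξ)
    refine ⟨l, hl, ?_⟩
    have e (l) : iso.hom.app _ ((pointsFunctor X p).map (dualMap l) (iso.inv.app _ ξ)) =
        F.map (dualMap l) ξ := by
      rw [NatTrans.naturality_apply]
      refine congrArg _ ?_
      exact ConcreteCategory.congr_hom (iso.inv_hom_id_app _) _
    rw [← e, ← e, h]
  rintro ⟨x, hx⟩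
  let T := CommRingCat.of (TrivSqZeroExt K (Fin (n + 1) → K))
  change Spec T ⟶ X at x
  -- A morphism from the spectrum of a local ring lands in any open set containing the image of the
  -- closed point, here an affine chart on which `p` is standard smooth.
  have hloc : IsLocalRing T := by
    refine IsLocalRing.of_isUnit_or_isUnit_one_sub_self (R := TrivSqZeroExt K (Fin (n + 1) → K))
      fun a => ?_
    rw [TrivSqZeroExt.isUnit_iff_isUnit_fst, TrivSqZeroExt.isUnit_iff_isUnit_fst,
      TrivSqZeroExt.fst_sub, TrivSqZeroExt.fst_one]
    exact IsLocalRing.isUnit_or_isUnit_one_sub_self _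
  obtain ⟨U, hU, U', hU', hxU, e, hs⟩ :=
    hp.exists_isStandardSmoothOfRelativeDimension (x (IsLocalRing.closedPoint T))
  have hrange : Set.range x ⊆ Set.range hU'.fromSpec := by
    rw [hU'.range_fromSpec]
    rintro _ ⟨y, rfl⟩
    exact ((IsLocalRing.specializes_closedPoint y).map x.continuous).mem_open U'.isOpen hxU
  obtain ⟨g, hg⟩ := Spec.map_surjective
    (AlgebraicGeometry.IsOpenImmersion.lift hU'.fromSpec x hrange)
  have hgx : Spec.map g ≫ hU'.fromSpec = x := by
    rw [hg]; exact AlgebraicGeometry.IsOpenImmersion.lift_fac _ _ _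
  -- The composite with `p` factors through `Spec ℂ`, hence is unchanged by the endomorphism `π`
  -- that annihilates the infinitesimals. Functions coming from the base therefore have no ε-part.
  have hconst (b) : (g.hom ((p.appLE U U' e).hom b)).snd = 0 := by
    let π : TrivSqZeroExt K (Fin (n + 1) → K) →ₐ[ℂ] TrivSqZeroExt K (Fin (n + 1) → K) :=
      (TrivSqZeroExt.map (0 : (Fin (n + 1) → K) →ₗ[K] (Fin (n + 1) → K))).restrictScalars ℂ
    let π' : T ⟶ T := CommRingCat.ofHom π.toRingHom
    have h1 : Spec.map (p.appLE U U' e ≫ g) ≫ hU.fromSpec =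
        Spec.map (CommRingCat.ofHom (algebraMap ℂ (TrivSqZeroExt K (Fin (n + 1) → K)))) := by
      rw [Spec.map_comp, Category.assoc, AlgebraicGeometry.IsAffineOpen.SpecMap_appLE_fromSpec p hU hU',
        ← Category.assoc, hgx]
      exact hx
    have h2 : Spec.map (p.appLE U U' e ≫ g ≫ π') ≫ hU.fromSpec =
        Spec.map (p.appLE U U' e ≫ g) ≫ hU.fromSpec := by
      rw [← Category.assoc, Spec.map_comp, Category.assoc, h1, ← Spec.map_comp]
      congr 1
      rw [← CommRingCat.ofHom_comp]
      congr 1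
      exact π.comp_algebraMap
    have h3 := Spec.map_injective ((cancel_mono hU.fromSpec).1 h2)
    have h4 := ConcreteCategory.congr_hom h3 b
    have h5 : (π (g.hom ((p.appLE U U' e).hom b))).snd = (g.hom ((p.appLE U U' e).hom b)).snd :=
      congrArg TrivSqZeroExt.snd h4
    rw [← h5]
    simp [π]
  obtain ⟨l, hl, h⟩ := exists_functional_ringHom n _ hs g.hom hconst
  refine ⟨l, hl, Subtype.ext ?_⟩
  change Spec.map (CommRingCat.ofHom (dualMap l).hom.toRingHom) ≫ x =
    Spec.map (CommRingCat.ofHom (dualMap 0).hom.toRingHom) ≫ x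
  rw [← hgx, ← Category.assoc, ← Category.assoc, ← Spec.map_comp, ← Spec.map_comp]
  congr 2
  refine CommRingCat.hom_ext (RingHom.ext fun a => TrivSqZeroExt.ext ?_ ?_)
  · change (TrivSqZeroExt.map l (g.hom a)).fst = (TrivSqZeroExt.map 0 (g.hom a)).fst
    simp
  · change (TrivSqZeroExt.map l (g.hom a)).snd = (TrivSqZeroExt.map 0 (g.hom a)).snd
    simp [h]

end FirstOrder

end

end GushelMukai

namespace GushelMukai

noncomputable section

/-! ### Tangent spaces of Gushel--Mukai varieties -/

section Tangent

/-- The tangent space to a section of the Grassmannian of lines has dimension at least `n + 1` when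
the linear conditions defining it are dependent. -/
lemma exists_independent_solutions {K P E : Type*} [Field K] [AddCommGroup P] [Module K P]
    [AddCommGroup E] [Module K E] [Module.Finite K P] [Module.Finite K E] {n : ℕ}
    (hP : Module.finrank K P = 5) (hE : Module.finrank K E = 10) {v a : P}
    (hva : LinearIndependent K ![v, a]) (w : P →ₗ[K] P →ₗ[K] E) {W : Submodule K E}
    (hW : Module.finrank K W = n + 5) (β ω : Module.Dual K E) (hω : ∀ x ∈ W, ω x = 0) (c : K)
    (h : ∀ x y, ω (w x a + w v y) + c * β (w x a + w v y) = 0) (h0 : ω ≠ 0 ∨ c ≠ 0) :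
    ∃ x y : Fin (n + 1) → P, (∀ i, w (x i) a + w v (y i) ∈ W) ∧
      (∀ i, β (w (x i) a + w v (y i)) = 0) ∧
      ∀ l : Fin (n + 1) → K, ∑ i, l i • x i ∈ Submodule.span K {v, a} →
        ∑ i, l i • y i ∈ Submodule.span K {v, a} → l = 0 := by
  -- With `C ≅ V / U` for the plane `U = ⟨v, a⟩`, the space `C × C` models the six-dimensional
  -- tangent space `Hom(U, V / U)` of the Grassmannian.
  obtain ⟨C, hC⟩ := Submodule.exists_isCompl (Submodule.span K {v, a})
  have hspan : Module.finrank K (Submodule.span K {v, a}) = 2 := by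
    have := finrank_span_eq_card hva
    rwa [Matrix.range_cons, Matrix.range_cons, Matrix.range_empty, Set.union_empty,
      Set.singleton_union, Fintype.card_fin] at this
  have hC3 : Module.finrank K C = 3 := by
    have := Submodule.finrank_add_eq_of_isCompl hC
    omega
  let L : C × C →ₗ[K] E :=
    LinearMap.coprod (w.flip a ∘ₗ C.subtype) (w v ∘ₗ C.subtype)
  have hL (z : C × C) : L z = w z.1 a + w v z.2 := by simp [L]
  let M : C × C →ₗ[K] (E ⧸ W) × K := LinearMap.prod (W.mkQ ∘ₗ L) (β ∘ₗ L)
  have hω' : W ≤ LinearMap.ker ω := hω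
  let θ : (E ⧸ W) × K →ₗ[K] K :=
    LinearMap.coprod (W.liftQ ω hω') (LinearMap.lsmul K K c)
  have hθM : LinearMap.range M ≤ LinearMap.ker θ := by
    rintro _ ⟨z, rfl⟩
    rw [LinearMap.mem_ker]
    have := h z.1 z.2
    rw [← hL] at this
    change (W.liftQ ω hω') (W.mkQ (L z)) + c * β (L z) = 0
    rwa [Submodule.mkQ_apply, Submodule.liftQ_apply]
  have hθ : θ ≠ 0 := by
    intro h1
    have hω0 : ω = 0 := LinearMap.ext fun x => by
      have := LinearMap.congr_fun h1 (W.mkQ x, 0)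
      rwa [LinearMap.coprod_apply, map_zero, add_zero, LinearMap.zero_apply, Submodule.mkQ_apply,
        Submodule.liftQ_apply] at this
    have hc0 : c = 0 := by simpa [θ] using LinearMap.congr_fun h1 (0, 1)
    exact h0.elim (fun h => h hω0) fun h => h hc0
  -- The conditions take values in a space of dimension `(5 - n) + 1`, and the dependence `θ`
  -- confines them to a hyperplane, so the rank of `M` is at most `5 - n` and its kernel has
  -- dimension at least `6 - (5 - n) = n + 1`.
  have hker : Module.finrank K (LinearMap.ker θ) + 1 = 10 - (n + 5) + 1 := by
    have h1 := θ.finrank_range_add_finrank_ker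
    have h2 : LinearMap.range θ = ⊤ :=
      LinearMap.range_eq_top.2 (LinearMap.surjective hθ)
    have h3 := W.finrank_quotient_add_finrank
    rw [h2, finrank_top, Module.finrank_prod, Module.finrank_self] at h1
    omega
  have hle := Submodule.finrank_mono hθM
  have hWE := Submodule.finrank_le W
  have hrank := M.finrank_range_add_finrank_ker
  rw [Module.finrank_prod, hC3] at hrank
  have hn1 : n + 1 ≤ Module.finrank K (LinearMap.ker M) := by omega
  let b := Module.finBasis K (LinearMap.ker M)
  let z (i : Fin (n + 1)) : LinearMap.ker M := b (Fin.castLE hn1 i)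
  have hz : LinearIndependent K z := b.linearIndependent.comp _ (Fin.castLE_injective hn1)
  have hMz (i) : M (z i).1 = 0 := (z i).2
  refine ⟨fun i => (z i).1.1, fun i => (z i).1.2, fun i => ?_, fun i => ?_, fun l h1 h2 => ?_⟩
  · rw [← hL, ← Submodule.Quotient.mk_eq_zero]
    exact congrArg Prod.fst (hMz i)
  · rw [← hL]
    exact congrArg Prod.snd (hMz i)
  · have e1 : ∑ i, l i • ((z i).1.1 : P) = 0 :=
      Submodule.disjoint_def.1 hC.disjoint _ h1
        (Submodule.sum_mem _ fun i _ => C.smul_mem _ (z i).1.1.2)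
    have e2 : ∑ i, l i • ((z i).1.2 : P) = 0 :=
      Submodule.disjoint_def.1 hC.disjoint _ h2
        (Submodule.sum_mem _ fun i _ => C.smul_mem _ (z i).1.2.2)
    have e : ∑ i, l i • z i = 0 := by
      refine Subtype.ext (Prod.ext (Subtype.ext ?_) (Subtype.ext ?_))
      · simpa [Prod.fst_sum] using e1
      · simpa [Prod.snd_sum] using e2
    exact funext (Fintype.linearIndependent_iff.1 hz l e)

/-! ### First-order deformations of vectors, bivectors and points of `X` -/

section Deform

variable {R S T : CommAlgCat.{0} ℂ} {M : Type} [AddCommGroup M] [Module ℂ M]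
  {V : Type} [AddCommGroup V] [Module ℂ V] {m : ℕ}

/-- The deformation `v + ∑ εᵢ xᵢ` of `v`. -/
def deform (f : R ⟶ S) (ε : Fin m → S) (v : R ⊗[ℂ] M) (x : Fin m → R ⊗[ℂ] M) : S ⊗[ℂ] M :=
  extendScalars f v + ∑ i, ε i • extendScalars f (x i)

lemma deform_mem (f : R ⟶ S) (ε : Fin m → S) {W : Submodule ℂ M} {v : R ⊗[ℂ] M}
    {x : Fin m → R ⊗[ℂ] M} (hv : v ∈ W.baseChange R) (hx : ∀ i, x i ∈ W.baseChange R) :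
    deform f ε v x ∈ W.baseChange S :=
  Submodule.add_mem _ (extendScalars_mem_baseChange _ W hv)
    (Submodule.sum_mem _ fun i _ => Submodule.smul_mem _ _ (extendScalars_mem_baseChange _ W (hx i)))

lemma extendScalars_deform (f : R ⟶ S) (g : S ⟶ T) (ε : Fin m → S) (v : R ⊗[ℂ] M)
    (x : Fin m → R ⊗[ℂ] M) :
    extendScalars g (deform f ε v x) = deform (f ≫ g) (fun i => g.hom (ε i)) v x := by
  simp only [deform, map_add, map_sum, extendScalars_smul, extendScalars_comp]

lemma extendScalars_polar (f : R ⟶ S) (Q : QuadraticForm ℂ M) (x y : R ⊗[ℂ] M) :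
    QuadraticMap.polar (Q.baseChange S) (extendScalars f x) (extendScalars f y) =
      f.hom (QuadraticMap.polar (Q.baseChange R) x y) := by
  simp only [QuadraticMap.polar, ← map_add, extendScalars_quadratic, map_sub]

variable {f : R ⟶ S} {ε : Fin m → S} (hε : ∀ i j, ε i * ε j = 0)

include hε in
-- First-order Taylor expansion: the quadratic terms vanish since all `ε i * ε j = 0`, including `i
-- = j`. The computation is made for the polar form, and `2` is invertible.
lemma quadratic_deform {Q : QuadraticForm ℂ M} {p : R ⊗[ℂ] M} {t : Fin m → R ⊗[ℂ] M}
    (hp : Q.baseChange R p = 0) (ht : ∀ i, QuadraticMap.polar (Q.baseChange R) p (t i) = 0) :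
    Q.baseChange S (deform f ε p t) = 0 := by
  let B := QuadraticMap.polarBilin (Q.baseChange S)
  have key : B (deform f ε p t) (deform f ε p t) = 0 := by
    have h (x y) : B (extendScalars f x) (extendScalars f y) =
      f.hom (QuadraticMap.polar (Q.baseChange R) x y) := extendScalars_polar f Q x y
    have hpp : QuadraticMap.polar (Q.baseChange R) p p = 0 := by
      rw [QuadraticMap.polar_self, hp, smul_zero]
    have htp (i) : QuadraticMap.polar (Q.baseChange R) (t i) p = 0 := by
      rw [QuadraticMap.polar_comm, ht]
    simp only [deform, map_add, map_sum, map_smul, LinearMap.add_apply, LinearMap.sum_apply,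
      LinearMap.smul_apply, smul_eq_mul, h, hpp, ht, htp, map_zero, mul_zero,
      Finset.sum_const_zero, add_zero, zero_add]
    refine Finset.sum_eq_zero fun i _ => ?_
    try rw [Finset.mul_sum]
    refine Finset.sum_eq_zero fun j _ => ?_
    rw [← mul_assoc, hε, zero_mul]
  have h : B (deform f ε p t) (deform f ε p t) =
    QuadraticMap.polar (Q.baseChange S) (deform f ε p t) (deform f ε p t) := rfl
  rw [h, QuadraticMap.polar_self, two_smul, ← two_mul] at key
  exact (isUnit_two S).mul_right_eq_zero.1 key

include hε in
-- Leibniz' rule; the products of two infinitesimals drop out.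
lemma wdg_deform (v a : R ⊗[ℂ] V) (x y : Fin m → R ⊗[ℂ] V) :
    wdg (deform f ε v x) (deform f ε a y) =
      deform f ε (wdg v a) fun i => wdg (x i) a + wdg v (y i) := by
  have hsum (s : S ⊗[ℂ] V) (z : Fin m → S ⊗[ℂ] V) : wdg s (∑ i, z i) = ∑ i, wdg s (z i) :=
    map_sum _ _ _
  have hsum' (s : S ⊗[ℂ] V) (z : Fin m → S ⊗[ℂ] V) : wdg (∑ i, z i) s = ∑ i, wdg (z i) s := by
    simp only [wdg, map_sum, LinearMap.sum_apply]
  simp only [deform, wdg_add_left, wdg_add_right, hsum, hsum', wdg_smul_left, wdg_smul_right,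
    map_add, extendScalars_wdg, smul_add, Finset.sum_add_distrib, Finset.smul_sum, smul_smul, hε,
    zero_smul, Finset.sum_const_zero]
  abel

include hε in
/-- First-order deformations of a point of a Gushel--Mukai variety. -/
lemma exists_deformation [Module.Finite ℂ V] {W : Submodule ℂ (⋀[ℂ]^2 V)}
    {Q : QuadraticForm ℂ (⋀[ℂ]^2 V)} {v a : R ⊗[ℂ] V} {x y : Fin m → R ⊗[ℂ] V}
    (hs : IsSplit (R := S) ![deform f ε v x, deform f ε a y])
    (hpW : wdg v a ∈ W.baseChange R) (hpQ : Q.baseChange R (wdg v a) = 0)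
    (hxyW : ∀ i, wdg (x i) a + wdg v (y i) ∈ W.baseChange R)
    (hxyQ : ∀ i, QuadraticMap.polar (Q.baseChange R) (wdg v a) (wdg (x i) a + wdg v (y i)) = 0) :
    ∃ ξ : (gm V W Q).obj S,
      toSub ξ.1 = Submodule.span S {deform f ε v x, deform f ε a y} := by
  obtain ⟨U, hU⟩ := hs.exists_gr
  rw [range_fin_two] at hU
  have hw : wedgeSub V (toSub U) (toSub U) =
      Submodule.span S {wdg (deform f ε v x) (deform f ε a y)} := by
    rw [hU]; exact wedgeSub_span_pair _ _
  refine ⟨⟨U, ?_, fun z hz => ?_⟩, hU⟩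
  · rw [hw, Submodule.span_singleton_le_iff_mem, wdg_deform hε]
    exact deform_mem f ε hpW hxyW
  · rw [hw] at hz
    obtain ⟨r, rfl⟩ := Submodule.mem_span_singleton.1 hz
    rw [QuadraticMap.map_smul, wdg_deform hε, quadratic_deform hε hpQ hxyQ, smul_zero]

lemma deform_mul (f : R ⟶ S) (ε : S) (c : Fin m → R) (v : R ⊗[ℂ] M) (x : Fin m → R ⊗[ℂ] M) :
    deform f (fun i => ε * f.hom (c i)) v x =
      extendScalars f v + ε • extendScalars f (∑ i, c i • x i) := by
  simp only [deform, map_sum, extendScalars_smul, Finset.smul_sum, smul_smul]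

/-- If a deformed vector lies in the span of the undeformed vectors, it is deformed in the direction
of this span. -/
lemma apply_eq_zero_of_deform_mem {v a z x : R ⊗[ℂ] M} (ε : S)
    (h : extendScalars f z + ε • extendScalars f x ∈
      Submodule.span S {extendScalars f v, extendScalars f a}) {ψ : Module.Dual R (R ⊗[ℂ] M)}
    (hv : ψ v = 0) (ha : ψ a = 0) (hz : ψ z = 0) : ε * f.hom (ψ x) = 0 := by
  obtain ⟨α, β, e⟩ := Submodule.mem_span_pair.1 h
  have := congrArg (extDual f ψ) e
  simpa [extDual_extendScalars, hv, ha, hz, eq_comm] using this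

end Deform

/-! ### Smoothness of dimension `n` implies transversality at field-valued points -/

section Transverse

variable {V : Type} [AddCommGroup V] [Module ℂ V] {K : Type} [Field K] [Algebra ℂ K] {m : ℕ}

/-- The inclusion `K → K ⊕ ε Kᵐ`. -/
def toDual (K : Type) [Field K] [Algebra ℂ K] (m : ℕ) :
    CommAlgCat.of ℂ K ⟶ CommAlgCat.of ℂ (TrivSqZeroExt K (Fin m → K)) :=
  CommAlgCat.ofHom (TrivSqZeroExt.inlAlgHom ℂ K (Fin m → K))

/-- The infinitesimals in `K ⊕ ε Kᵐ`. -/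
def infinitesimal (K : Type) [Field K] [Algebra ℂ K] {m : ℕ} (i : Fin m) :
    CommAlgCat.of ℂ (TrivSqZeroExt K (Fin m → K)) :=
  (TrivSqZeroExt.inr (Pi.single i 1) : TrivSqZeroExt K (Fin m → K))

lemma infinitesimal_mul (i j : Fin m) : infinitesimal K i * infinitesimal K j = 0 :=
  TrivSqZeroExt.inr_mul_inr _ _ _

/-- The residue map `K ⊕ ε Kᵐ → K`. -/
def ofDual (K : Type) [Field K] [Algebra ℂ K] (m : ℕ) :
    CommAlgCat.of ℂ (TrivSqZeroExt K (Fin m → K)) ⟶ CommAlgCat.of ℂ K :=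
  CommAlgCat.ofHom (TrivSqZeroExt.fstHom ℂ K (Fin m → K))

instance : IsLocalHom (ofDual K m).hom.toRingHom :=
  ⟨fun _ h => TrivSqZeroExt.isUnit_iff_isUnit_fst.2 h⟩

lemma ofDual_deform {M : Type} [AddCommGroup M] [Module ℂ M] (v : CommAlgCat.of ℂ K ⊗[ℂ] M)
    (x : Fin m → CommAlgCat.of ℂ K ⊗[ℂ] M) :
    extendScalars (ofDual K m) (deform (toDual K m) (infinitesimal K) v x) = v := by
  have h1 : toDual K m ≫ ofDual K m = 𝟙 _ := rfl
  have h2 (i : Fin m) : (ofDual K m).hom (infinitesimal K i) = 0 :=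
    TrivSqZeroExt.fst_inr K (Pi.single i 1 : Fin m → K)
  rw [extendScalars_deform, h1, deform]
  simp only [h2, zero_smul, Finset.sum_const_zero, add_zero]
  exact extendScalars_id v

/-- The inclusion `K → K ⊕ ε K`. -/
def toDualOne (K : Type) [Field K] [Algebra ℂ K] :
    CommAlgCat.of ℂ K ⟶ CommAlgCat.of ℂ (TrivSqZeroExt K K) :=
  CommAlgCat.ofHom (TrivSqZeroExt.inlAlgHom ℂ K K)

lemma dualMap_deform {M : Type} [AddCommGroup M] [Module ℂ M] (l : (Fin m → K) →ₗ[K] K)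
    (v : CommAlgCat.of ℂ K ⊗[ℂ] M) (x : Fin m → CommAlgCat.of ℂ K ⊗[ℂ] M) :
    extendScalars (dualMap l) (deform (toDual K m) (infinitesimal K) v x) =
      extendScalars (toDualOne K) v + (show CommAlgCat.of ℂ (TrivSqZeroExt K K) from
        (TrivSqZeroExt.inr 1 : TrivSqZeroExt K K)) • extendScalars (toDualOne K)
        (∑ i, (show CommAlgCat.of ℂ K from l (Pi.single i 1)) • x i) := by
  have h1 : toDual K m ≫ dualMap l = toDualOne K := by
    refine CommAlgCat.hom_ext (AlgHom.ext fun k => ?_)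
    exact TrivSqZeroExt.map_inl _ _
  rw [extendScalars_deform, h1, ← deform_mul]
  congr 1
  funext i
  refine (TrivSqZeroExt.map_inr l (Pi.single i 1)).trans ?_
  refine Eq.trans ?_ (TrivSqZeroExt.inr_mul_inl (l (Pi.single i 1)) (1 : K)).symm
  simp

lemma finrank_baseChange_submodule {M : Type} [AddCommGroup M] [Module ℂ M]
    (W : Submodule ℂ M) : Module.finrank K (W.baseChange K) = Module.finrank ℂ W := by
  have : Module.Free ℂ W := Module.Free.of_divisionRing ℂ W
  rw [← Module.finrank_baseChange (R := K) (M' := W), Submodule.baseChange]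
  exact LinearMap.finrank_range_of_inj
    (Module.Flat.lTensor_preserves_injective_linearMap W.subtype W.subtype_injective)

/-- A Gushel--Mukai variety which is smooth of dimension `n` is, at each of its points, a
transverse intersection. -/
theorem transverse (hV : Module.finrank ℂ V = 5) {n : ℕ} {W : Submodule ℂ (⋀[ℂ]^2 V)}
    (hW : Module.finrank ℂ W = n + 5) {Q : QuadraticForm ℂ (⋀[ℂ]^2 V)}
    (hX : IsSmoothOfDim n (gm V W Q)) {v a : CommAlgCat.of ℂ K ⊗[ℂ] V}
    (hva : LinearIndependent K (M := K ⊗[ℂ] V) ![v, a])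
    (hpW : wdg v a ∈ W.baseChange (CommAlgCat.of ℂ K))
    (hpQ : Q.baseChange (CommAlgCat.of ℂ K) (wdg v a) = 0)
    (ω : Module.Dual (CommAlgCat.of ℂ K) (CommAlgCat.of ℂ K ⊗[ℂ] (⋀[ℂ]^2 V)))
    (hω : ∀ x ∈ W.baseChange (CommAlgCat.of ℂ K), ω x = 0) (c : CommAlgCat.of ℂ K)
    (h : ∀ x y, ω (wdg x a + wdg v y) + c * QuadraticMap.polar (Q.baseChange (CommAlgCat.of ℂ K))
      (wdg v a) (wdg x a + wdg v y) = 0) :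
    ω = 0 ∧ c = 0 := by
  have : Module.Finite ℂ V := Module.finite_of_finrank_pos (by omega)
  by_contra hcon
  have hdim := finrank_exteriorPower_two hV
  -- A failure of transversality produces `n + 1` tangent directions independent modulo the plane,
  -- assembled below into one deformation `ξ` over `K ⊕ ε Kⁿ⁺¹`.
  obtain ⟨x, y, h1, h2, h3⟩ := exists_independent_solutions (K := K) (P := K ⊗[ℂ] V)
    (E := K ⊗[ℂ] (⋀[ℂ]^2 V)) (by rw [Module.finrank_baseChange, hV])
    (by rw [Module.finrank_baseChange, hdim]) hva (LinearMap.BilinMap.baseChange K (wedge V))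
    (by rw [finrank_baseChange_submodule, hW]) (QuadraticMap.polarBilin (Q.baseChange K) (wdg (R := CommAlgCat.of ℂ K) v a)) ω hω c h
    (by tauto)
  have hs : IsSplit (R := CommAlgCat.of ℂ (TrivSqZeroExt K (Fin (n + 1) → K)))
      ![deform (toDual K (n + 1)) (infinitesimal K) v x,
        deform (toDual K (n + 1)) (infinitesimal K) a y] := by
    refine isSplit_of_linearIndependent (ofDual K (n + 1)) ?_
    convert hva using 1
    funext i
    fin_cases i
    · exact ofDual_deform v x
    · exact ofDual_deform a y
  obtain ⟨ξ, hξ⟩ := exists_deformation (W := W) (Q := Q) infinitesimal_mul hs hpW hpQ h1 h2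
  obtain ⟨l, hl, e⟩ := hX.exists_functional ξ
  have e' (l) : extSub (dualMap l) (toSub ξ.1) = toSub ((gm V W Q).map (dualMap l) ξ).1 :=
    (toSub_map _ _).symm
  have h0 (z : CommAlgCat.of ℂ K ⊗[ℂ] V) (t) :
      extendScalars (dualMap 0) (deform (toDual K (n + 1)) (infinitesimal K) z t) =
        extendScalars (toDualOne K) z := by
    rw [dualMap_deform]
    simp only [LinearMap.zero_apply]
    rw [Finset.sum_eq_zero fun i _ => zero_smul K (t i : K ⊗[ℂ] V), map_zero, smul_zero, add_zero]
  -- Along the nonzero form `l`, the deformation `ξ` becomes the constant one. The deformed vectors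
  -- thus lie in the span of the undeformed `v, a`, which forces the `l`-combination of the
  -- directions into the plane and contradicts their independence.
  have key (z : CommAlgCat.of ℂ K ⊗[ℂ] V) (hz : z = v ∨ z = a)
      (t : Fin (n + 1) → CommAlgCat.of ℂ K ⊗[ℂ] V)
      (ht : deform (toDual K (n + 1)) (infinitesimal K) z t ∈ toSub ξ.1) :
      ∑ i, (show CommAlgCat.of ℂ K from l (Pi.single i 1)) • t i ∈
        Submodule.span K ({v, a} : Set (K ⊗[ℂ] V)) := by
    rw [← Subspace.forall_mem_dualAnnihilator_apply_eq_zero_iff]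
    intro ψ hψ
    rw [Submodule.mem_dualAnnihilator] at hψ
    have hv : ψ v = 0 := hψ v (Submodule.subset_span (by simp))
    have ha : ψ a = 0 := hψ a (Submodule.subset_span (by simp))
    have hz : ψ z = 0 := by rcases hz with rfl | rfl <;> assumption
    have hm := mem_extSub (dualMap l) ht
    rw [e', e, ← e', hξ, extSub_span, Set.image_pair, h0, h0, dualMap_deform] at hm
    have := apply_eq_zero_of_deform_mem (ψ := ψ) _ hm hv ha hz
    have h4 : (TrivSqZeroExt.inr 1 : TrivSqZeroExt K K) * TrivSqZeroExt.inl (ψ (∑ i,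
      (show CommAlgCat.of ℂ K from l (Pi.single i 1)) • t i)) = 0 := this
    rw [TrivSqZeroExt.inr_mul_inl] at h4
    simpa using congrArg TrivSqZeroExt.snd h4
  have hx := key v (.inl rfl) x (hξ ▸ Submodule.subset_span (by simp))
  have hy := key a (.inr rfl) y (hξ ▸ Submodule.subset_span (by simp))
  refine hl (LinearMap.pi_ext' fun i => LinearMap.ext_ring ?_)
  exact congrFun (h3 (fun i => l (Pi.single i 1)) hx hy) i

end Transverse

end Tangent

end

end GushelMukai

namespace GushelMukai

noncomputable section

/-! ### Pencils of quadrics and degenerate points -/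

section Degenerate

open MvPolynomial

variable {K : Type} [Field K]

/-- The homogeneous polynomial of a quadratic form given by a bilinear form. -/
lemma exists_quadratic_polynomial {k : ℕ} (β : (Fin k → K) →ₗ[K] (Fin k → K) →ₗ[K] K) :
    ∃ q : MvPolynomial (Fin k) K, q.IsHomogeneous 2 ∧ ∀ a, eval a q = β a a := by
  refine ⟨∑ i, ∑ j, C (β (Pi.single j 1) (Pi.single i 1)) * (X i * X j), ?_, fun a => ?_⟩
  · refine IsHomogeneous.sum _ _ _ fun i _ => IsHomogeneous.sum _ _ _ fun j _ => ?_
    simpa using (isHomogeneous_C _ _).mul ((isHomogeneous_X K i).mul (isHomogeneous_X K j))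
  · have ha : a = ∑ i, a i • (Pi.single i 1 : Fin k → K) := by
      funext j
      simp [Finset.sum_apply, Pi.single_apply]
    conv_rhs => rw [ha]
    simp only [map_sum, map_smul, LinearMap.sum_apply, LinearMap.smul_apply, smul_eq_mul, map_mul,
      eval_C, eval_X, Finset.mul_sum]
    refine Finset.sum_congr rfl fun i _ => Finset.sum_congr rfl fun j _ => by ring

variable {P E : Type*} [AddCommGroup P] [Module K P] [AddCommGroup E] [Module K E]

lemma exists_linearIndependent_five {v : P} (hv : v ≠ 0) {H : Submodule K P} (hvH : v ∈ H)
    (hP : Module.finrank K P = 5) (hH : 4 ≤ Module.finrank K H) :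
    ∃ c₀ ∈ H, ∃ c₁ ∈ H, ∃ c₂ ∈ H, ∃ d, LinearIndependent K ![d, c₂, c₁, c₀, v] := by
  have h1 : LinearIndependent K ![(⟨v, hvH⟩ : H)] := by
    refine LinearIndependent.of_subsingleton 0 ?_
    simpa using hv
  obtain ⟨c₀, h2⟩ := exists_linearIndependent_cons_of_lt_finrank h1 (by omega)
  obtain ⟨c₁, h3⟩ := exists_linearIndependent_cons_of_lt_finrank h2 (by omega)
  obtain ⟨c₂, h4⟩ := exists_linearIndependent_cons_of_lt_finrank h3 (by omega)
  have h5 : LinearIndependent K ![(c₂ : P), c₁, c₀, v] := by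
    have h := h4.map' H.subtype H.ker_subtype
    have e : H.subtype ∘ (Fin.cons c₂ (Fin.cons c₁ (Fin.cons c₀ ![⟨v, hvH⟩])) : Fin 4 → H) =
        ![(c₂ : P), c₁, c₀, v] := by
      funext i
      fin_cases i <;> rfl
    rwa [e] at h
  obtain ⟨d, h6⟩ := exists_linearIndependent_cons_of_lt_finrank h5 (by omega)
  exact ⟨c₀, c₀.2, c₁, c₁.2, c₂, c₂.2, d, h6⟩

lemma exists_linearIndependent_pair_of_finrank {Ω : Submodule K P} (h : Module.finrank K Ω = 2) :
    ∃ x ∈ Ω, ∃ y ∈ Ω, LinearIndependent K ![x, y] := by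
  have : Module.Finite K Ω := Module.finite_of_finrank_pos (by omega)
  let b := Module.finBasisOfFinrankEq K Ω h
  refine ⟨b 0, (b 0).2, b 1, (b 1).2, ?_⟩
  have h1 := b.linearIndependent.map' Ω.subtype Ω.ker_subtype
  have e : Ω.subtype ∘ b = ![(b 0 : P), (b 1 : P)] := by
    funext i
    fin_cases i <;> rfl
  rwa [e] at h1

lemma dual_eq_zero_of_five {v c₀ c₁ c₂ d : P} (hP : Module.finrank K P = 5)
    (h : LinearIndependent K ![d, c₂, c₁, c₀, v]) {g : P →ₗ[K] K} (hd : g d = 0) (h2 : g c₂ = 0)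
    (h1 : g c₁ = 0) (h0 : g c₀ = 0) (hv : g v = 0) (x : P) : g x = 0 := by
  have : Module.Finite K P := Module.finite_of_finrank_pos (by omega)
  have hs := h.span_eq_top_of_card_eq_finrank' (by rw [Fintype.card_fin, hP])
  have : Submodule.span K (Set.range ![d, c₂, c₁, c₀, v]) ≤ LinearMap.ker g := by
    rw [Submodule.span_le]
    rintro _ ⟨i, rfl⟩
    fin_cases i
    exacts [hd, h2, h1, h0, hv]
  exact this (hs ▸ Submodule.mem_top)

/-! ### Degenerate points, with transversality along the lines through `v` as the hypothesis `hT` -/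

variable {w : P →ₗ[K] P →ₗ[K] E} (hw : ∀ x, w x x = 0) {B : E →ₗ[K] E →ₗ[K] K}
  {W : Submodule K E} {v : P} (hv : v ≠ 0)
  (hT : ∀ a, LinearIndependent K ![v, a] → w v a ∈ W → B (w v a) (w v a) = 0 →
    ∀ ω : E →ₗ[K] K, (∀ x ∈ W, ω x = 0) → ∀ c : K,
    (∀ x y, ω (w x a + w v y) + c * B (w v a) (w x a + w v y) = 0) → ω = 0 ∧ c = 0)

include hw in
lemma alt_swap (x y : P) : w x y = -w y x := by
  have := hw (x + y)
  simp only [map_add, LinearMap.add_apply, hw, zero_add, add_zero] at this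
  exact eq_neg_of_add_eq_zero_right this

include hw hv hT in
/-- The cone over a smooth section of the Grassmannian of lines does not contain all lines through a
point. -/
theorem not_forall_wedge_mem [IsAlgClosed K] (hP : Module.finrank K P = 5)
    (hW : ∀ a, w v a ∈ W) (hB : ∀ a b, B (w v a) (w v b) = 0) : False := by
  obtain ⟨c₀, -, c₁, -, c₂, -, c₃, hli⟩ := exists_linearIndependent_five hv
    (Submodule.mem_top (x := v) (R := K)) hP (by rw [finrank_top, hP]; norm_num)
  let A : (Fin 4 → K) →ₗ[K] P := Fintype.linearCombination K ![c₀, c₁, c₂, c₃]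
  have hA (a) : A a = a 0 • c₀ + a 1 • c₁ + a 2 • c₂ + a 3 • c₃ := by
    simp [A, Fintype.linearCombination_apply, Fin.sum_univ_four]
  let β (x : P) : (Fin 4 → K) →ₗ[K] (Fin 4 → K) →ₗ[K] K :=
    (B.compl₁₂ (w v) (w x)).compl₁₂ A A
  have hβ (x a) : β x a a = B (w v (A a)) (w x (A a)) := rfl
  choose q hq hqe using fun i => exists_quadratic_polynomial (β (![c₀, c₁, c₂, c₃] i))
  -- With `z = A a`, the quadrics are `q i = B(v ∧ z, c_i ∧ z)`, and `∑ a_i q_i = B(v ∧ z, z ∧ z) =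
  -- 0` is the syzygy with `k = 3`, `s = 1`.
  obtain ⟨a, ha0, ha⟩ := exists_common_zero_of_syzygy 3 1 q (hq 0) (fun i => hq i.succ) (by
    refine MvPolynomial.funext fun a => ?_
    have h1 : (B (w v (A a)) ∘ₗ w.flip (A a)) (A a) = 0 := by
      rw [LinearMap.comp_apply, LinearMap.flip_apply, hw, map_zero]
    conv_lhs at h1 => arg 2; rw [hA]
    simp only [map_add, map_smul, smul_eq_mul] at h1
    simp only [Fin.sum_univ_three, map_add, map_mul, eval_X, hqe, map_zero, hβ, pow_one]
    refine Eq.trans ?_ h1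
    rw [add_assoc (a 0 * _), add_assoc (a 0 * _)]
    rfl)
  have hli2 : LinearIndependent K ![v, A a] := by
    rw [LinearIndependent.pair_iff]
    intro s t hst
    rw [Fintype.linearIndependent_iff] at hli
    have := hli ![t * a 3, t * a 2, t * a 1, t * a 0, s] (by
      rw [← hst, hA]
      simp [Fin.sum_univ_five]
      module)
    refine ⟨this 4, ?_⟩
    by_contra ht
    refine ha0 (funext fun i => ?_)
    have h0 : t * a 0 = 0 := this 3
    have h1 : t * a 1 = 0 := this 2
    have h2 : t * a 2 = 0 := this 1
    have h3 : t * a 3 = 0 := this 0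
    fin_cases i
    exacts [(mul_eq_zero.1 h0).resolve_left ht, (mul_eq_zero.1 h1).resolve_left ht,
      (mul_eq_zero.1 h2).resolve_left ht, (mul_eq_zero.1 h3).resolve_left ht]
  simp only [hqe, hβ] at ha
  have hx := dual_eq_zero_of_five hP hli (g := B (w v (A a)) ∘ₗ w.flip (A a)) (ha 3) (ha 2) (ha 1)
    (ha 0) (hB _ _)
  -- At the common zero the differential of the quadric itself vanishes on the tangent space:
  -- transversality fails with `ω = 0` and `c = 1`.
  refine one_ne_zero (hT (A a) hli2 (hW _) (hB _ _) 0 (fun _ _ => rfl) 1 fun x y => ?_).2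
  have := hx x
  rw [LinearMap.comp_apply, LinearMap.flip_apply] at this
  rw [map_add (B _), this, hB]
  simp

variable {H : Submodule K P} (hvH : v ∈ H) (hHW : ∀ a ∈ H, w v a ∈ W)
  (hHB : ∀ a ∈ H, ∀ b ∈ H, B (w v a) (w v b) = 0)

include hT hvH hHW hHB in
/-- Degenerate points of a section of the Grassmannian of lines in a basis. -/
lemma eq_zero_of_degenerate (hP : Module.finrank K P = 5) {c : Fin 3 → P} (hc : ∀ i, c i ∈ H) {d : P}
    (hli : LinearIndependent K ![d, c 2, c 1, c 0, v]) {ω : E →ₗ[K] K} (hω : ∀ x ∈ W, ω x = 0)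
    (s : K) {a : Fin 3 → K} (ha : a ≠ 0) {z : P} (hz : z = a 0 • c 0 + a 1 • c 1 + a 2 • c 2)
    (hvd : ω (w v d) + s * B (w v z) (w v d) = 0)
    (hcz : ∀ i, ω (w (c i) z) + s * B (w v z) (w (c i) z) = 0)
    (hdz : ω (w d z) + s * B (w v z) (w d z) = 0) : ω = 0 ∧ s = 0 := by
  have hzH : z ∈ H := by
    rw [hz]
    exact H.add_mem (H.add_mem (H.smul_mem _ (hc 0)) (H.smul_mem _ (hc 1))) (H.smul_mem _ (hc 2))
  have hli2 : LinearIndependent K ![v, z] := by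
    rw [LinearIndependent.pair_iff]
    intro r t hrt
    rw [Fintype.linearIndependent_iff] at hli
    have := hli ![0, t * a 2, t * a 1, t * a 0, r] (by
      rw [← hrt, hz]
      simp [Fin.sum_univ_five]
      module)
    refine ⟨this 4, ?_⟩
    by_contra ht
    refine ha (funext fun i => ?_)
    have h0 : t * a 0 = 0 := this 3
    have h1 : t * a 1 = 0 := this 2
    have h2 : t * a 2 = 0 := this 1
    fin_cases i
    exacts [(mul_eq_zero.1 h0).resolve_left ht, (mul_eq_zero.1 h1).resolve_left ht,
      (mul_eq_zero.1 h2).resolve_left ht]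
  -- Because `v ∧ H` lies in `W` and is isotropic for `B`, `g` kills it automatically. Only its
  -- values on `v ∧ d` and on the products of `c i` and `d` with `z` are conditions.
  let g : E →ₗ[K] K := ω + s • B (w v z)
  have hg (e) : g e = ω e + s * B (w v z) e := rfl
  have hgH {y} (hy : y ∈ H) : g (w v y) = 0 := by
    rw [hg, hω _ (hHW y hy), hHB z hzH y hy, mul_zero, add_zero]
  have h1 := dual_eq_zero_of_five hP hli (g := g ∘ₗ w.flip z) hdz (hcz 2) (hcz 1) (hcz 0) (hgH hzH)
  have h2 := dual_eq_zero_of_five hP hli (g := g ∘ₗ w v) hvd (hgH (hc 2)) (hgH (hc 1)) (hgH (hc 0))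
    (hgH hvH)
  refine hT z hli2 (hHW z hzH) (hHB z hzH z hzH) ω hω s fun x y => ?_
  rw [← hg, map_add]
  have e1 := h1 x
  have e2 := h2 y
  rw [LinearMap.comp_apply, LinearMap.flip_apply] at e1
  rw [LinearMap.comp_apply] at e2
  rw [e1, e2, add_zero]

/-- The Pfaffian of the alternating form `ω ∘ w` on four vectors. -/
def pfaffian (w : P →ₗ[K] P →ₗ[K] E) (c : Fin 3 → P) (d : P) (ω : E →ₗ[K] K) : K :=
  ω (w (c 1) (c 2)) * ω (w (c 0) d) + ω (w (c 2) (c 0)) * ω (w (c 1) d) +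
    ω (w (c 0) (c 1)) * ω (w (c 2) d)

include hw hT hvH hHW hHB in
-- Since `ω` kills `v ∧ H` and `v ∧ d`, it descends to an alternating form on the four-dimensional
-- quotient by `v`. If its Pfaffian vanishes, its kernel has dimension at least two and meets the
-- hyperplane `H`; a vector there is a degenerate point with `s = 0`.
lemma eq_zero_of_pfaffian (hP : Module.finrank K P = 5) {c : Fin 3 → P} (hc : ∀ i, c i ∈ H) {d : P}
    (hli : LinearIndependent K ![d, c 2, c 1, c 0, v]) {ω : E →ₗ[K] K} (hω : ∀ x ∈ W, ω x = 0)
    (hvd : ω (w v d) = 0) (hpf : pfaffian w c d ω = 0) : ω = 0 := by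
  have key {a : Fin 3 → K} (ha : a ≠ 0)
      (h : ∀ i, a 0 * ω (w (c i) (c 0)) + a 1 * ω (w (c i) (c 1)) + a 2 * ω (w (c i) (c 2)) = 0)
      (h' : a 0 * ω (w (c 0) d) + a 1 * ω (w (c 1) d) + a 2 * ω (w (c 2) d) = 0) : ω = 0 := by
    refine (eq_zero_of_degenerate hT hvH hHW hHB hP hc hli hω 0 ha rfl ?_ (fun i => ?_) ?_).1
    · rw [hvd, zero_mul, add_zero]
    · rw [zero_mul, add_zero, ← h i]
      simp
    · rw [zero_mul, add_zero, alt_swap hw, map_neg, neg_eq_zero, ← h']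
      simp
  have hsw (x y) : ω (w x y) = -ω (w y x) := by rw [alt_swap hw, map_neg]
  have hself (x) : ω (w x x) = 0 := by rw [hw, map_zero]
  -- If `ω` vanishes on the span of the `c i`, any combination of them killed by pairing with `d`
  -- will do. Otherwise the kernel of this restriction is spanned by the vector of its three minors,
  -- whose pairing with `d` is the Pfaffian.
  by_cases h0 : ω (w (c 1) (c 2)) = 0 ∧ ω (w (c 2) (c 0)) = 0 ∧ ω (w (c 0) (c 1)) = 0
  · obtain ⟨h12, h20, h01⟩ := h0
    have hcc (i j) : ω (w (c i) (c j)) = 0 := by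
      have h21 := hsw (c 2) (c 1)
      have h02 := hsw (c 0) (c 2)
      have h10 := hsw (c 1) (c 0)
      rw [h12, neg_zero] at h21
      rw [h20, neg_zero] at h02
      rw [h01, neg_zero] at h10
      fin_cases i <;> fin_cases j <;> first | exact hself _ | assumption
    by_cases hd : ω (w (c 0) d) = 0
    · refine key (a := ![1, 0, 0]) (fun h => one_ne_zero (congrFun h 0)) (fun i => ?_) ?_
      · simp [hcc]
      · simp [hd]
    · refine key (a := ![ω (w (c 1) d), -ω (w (c 0) d), 0])
        (fun h => hd (neg_eq_zero.1 (congrFun h 1))) (fun i => ?_) ?_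
      · simp [hcc]
      · simp; ring
  · refine key (a := ![ω (w (c 1) (c 2)), ω (w (c 2) (c 0)), ω (w (c 0) (c 1))])
      (fun h => h0 ⟨congrFun h 0, congrFun h 1, congrFun h 2⟩) (fun i => ?_) hpf
    fin_cases i
    · simp [hself, hsw (c 0) (c 2)]; ring
    · simp [hself, hsw (c 1) (c 0)]; ring
    · simp [hself, hsw (c 2) (c 1)]; ring

include hw hT hvH hHW hHB in
/-- A pencil of alternating forms on a four-dimensional space contains a degenerate form. -/
lemma not_linearIndependent_pencil [IsAlgClosed K] [NeZero (2 : K)] (hP : Module.finrank K P = 5)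
    {c : Fin 3 → P} (hc : ∀ i, c i ∈ H) {d : P} (hli : LinearIndependent K ![d, c 2, c 1, c 0, v])
    {ω ω' : E →ₗ[K] K} (hω : ∀ x ∈ W, ω x = 0) (hω' : ∀ x ∈ W, ω' x = 0) (hvd : ω (w v d) = 0)
    (hvd' : ω' (w v d) = 0) : ¬ LinearIndependent K ![ω, ω'] := by
  intro h
  have hpf {ω} := eq_zero_of_pfaffian hw hT hvH hHW hHB hP hc hli (ω := ω)
  have hne : pfaffian w c d ω' ≠ 0 := fun h0 => h.ne_zero 1 (hpf hω' hvd' h0)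
  -- The Pfaffian of `ω + t ω'` is quadratic in `t` with nonzero leading coefficient, so it has a
  -- root.
  obtain ⟨β, hβ⟩ : ∃ β, ∀ t, pfaffian w c d (ω + t • ω') =
      pfaffian w c d ω' * (t * t) + β * t + pfaffian w c d ω := by
    refine ⟨ω (w (c 1) (c 2)) * ω' (w (c 0) d) + ω' (w (c 1) (c 2)) * ω (w (c 0) d) +
      (ω (w (c 2) (c 0)) * ω' (w (c 1) d) + ω' (w (c 2) (c 0)) * ω (w (c 1) d)) +
      (ω (w (c 0) (c 1)) * ω' (w (c 2) d) + ω' (w (c 0) (c 1)) * ω (w (c 2) d)), fun t => ?_⟩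
    simp only [pfaffian, LinearMap.add_apply, LinearMap.smul_apply, smul_eq_mul]
    ring
  obtain ⟨t, ht⟩ := exists_quadratic_eq_zero hne
    (IsAlgClosed.exists_eq_mul_self (discrim (pfaffian w c d ω') β (pfaffian w c d ω)))
  rw [← hβ] at ht
  have h0 := hpf (fun x hx => by simp [hω x hx, hω' x hx]) (by simp [hvd, hvd']) ht
  exact one_ne_zero (LinearIndependent.pair_iff.1 h 1 t (by rw [one_smul, h0])).1

include hw hT hv hvH hHW hHB in
/-- A basis in which a nondegenerate alternating form takes its normal form. -/
lemma exists_normal_form (hP : Module.finrank K P = 5) {c : Fin 3 → P} (hc : ∀ i, c i ∈ H) {d : P}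
    (hli : LinearIndependent K ![d, c 2, c 1, c 0, v]) {ω : E →ₗ[K] K} (hω : ∀ x ∈ W, ω x = 0)
    (hvd : ω (w v d) = 0) (h0 : ω ≠ 0) :
    ∃ (c' : Fin 3 → P) (d' : P), (∀ i, c' i ∈ H) ∧ d' - d ∈ H ∧
      LinearIndependent K ![d', c' 2, c' 1, c' 0, v] ∧ ω (w (c' 0) (c' 1)) = 0 ∧
      ω (w (c' 0) (c' 2)) = 0 ∧ ω (w (c' 1) (c' 2)) = 1 ∧ ω (w (c' 0) d') = 1 ∧
      ω (w (c' 1) d') = 0 ∧ ω (w (c' 2) d') = 0 := by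
  have hpf : pfaffian w c d ω ≠ 0 := fun h =>
    h0 (eq_zero_of_pfaffian hw hT hvH hHW hHB hP hc hli hω hvd h)
  have hsw (x y) : ω (w x y) = -ω (w y x) := by rw [alt_swap hw, map_neg]
  have hself (x) : ω (w x x) = 0 := by rw [hw, map_zero]
  obtain ⟨i, j, hij⟩ : ∃ i j, ω (w (c i) (c j)) ≠ 0 := by
    by_contra hcon
    push Not at hcon
    exact hpf (by simp [pfaffian, hcon])
  set π := pfaffian w c d ω with hπ
  -- The vector `k` spans the kernel of `ω` on the span of the `c i`; dividing by the Pfaffian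
  -- normalizes its pairing with `d` to `1`.
  obtain ⟨k, hkH, hkc, hkd⟩ : ∃ k ∈ H, (∀ i, ω (w k (c i)) = 0) ∧ ω (w k d) = 1 := by
    refine ⟨π⁻¹ • (ω (w (c 1) (c 2)) • c 0 + ω (w (c 2) (c 0)) • c 1 + ω (w (c 0) (c 1)) • c 2),
      H.smul_mem _ (H.add_mem (H.add_mem (H.smul_mem _ (hc 0)) (H.smul_mem _ (hc 1)))
        (H.smul_mem _ (hc 2))), fun i => ?_, ?_⟩
    · simp only [map_add, map_smul, LinearMap.add_apply, LinearMap.smul_apply, smul_eq_mul]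
      fin_cases i
      · simp [hself, hsw (c 1) (c 0)]; right; ring
      · simp [hself, hsw (c 2) (c 1)]; right; ring
      · simp [hself, hsw (c 0) (c 2)]; right; ring
    · simp only [map_add, map_smul, LinearMap.add_apply, LinearMap.smul_apply, smul_eq_mul]
      exact inv_mul_cancel₀ hpf
  obtain ⟨p, hpH, q, hqH, hkp, hkq, hpq⟩ : ∃ p ∈ H, ∃ q ∈ H, ω (w k p) = 0 ∧ ω (w k q) = 0 ∧
      ω (w p q) = 1 := by
    refine ⟨c i, hc i, (ω (w (c i) (c j)))⁻¹ • c j, H.smul_mem _ (hc j), hkc i, ?_, ?_⟩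
    · rw [map_smul, map_smul, hkc, smul_zero]
    · rw [map_smul, map_smul, smul_eq_mul, inv_mul_cancel₀ hij]
  -- Correcting `d` inside the hyperbolic plane `⟨p, q⟩` makes it orthogonal to `p` and `q`, without
  -- changing its class modulo `H`.
  let d' := d + (ω (w q d) • p - ω (w p d) • q)
  have hqp : ω (w q p) = -1 := by rw [hsw, hpq]
  have hkd' : ω (w k d') = 1 := by simp [d', hkd, hkp, hkq]
  have hpd' : ω (w p d') = 0 := by simp [d', hself, hpq]
  have hqd' : ω (w q d') = 0 := by simp [d', hself, hqp]
  have hvx {x} (hx : x ∈ H) : ω (w v x) = 0 := hω _ (hHW x hx)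
  have hxv {x} (hx : x ∈ H) : ω (w x v) = 0 := by rw [hsw, hvx hx, neg_zero]
  have hd'H : d' - d ∈ H := by
    simp only [d', add_sub_cancel_left]
    exact H.sub_mem (H.smul_mem _ hpH) (H.smul_mem _ hqH)
  have hd'v : ω (w d' v) = 0 := by
    have := hvx hd'H
    rw [map_sub, map_sub, hvd, sub_zero] at this
    rw [hsw, this, neg_zero]
  refine ⟨![k, p, q], d', ?_, hd'H, ?_, hkp, hkq, hpq, hkd', hpd', hqd'⟩
  · intro i
    fin_cases i
    exacts [hkH, hpH, hqH]
  · rw [Fintype.linearIndependent_iff]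
    intro g hg
    simp only [Fin.sum_univ_five] at hg
    change g 0 • d' + g 1 • q + g 2 • p + g 3 • k + g 4 • v = 0 at hg
    have e (x) := congrArg (fun y => ω (w x y)) hg
    simp only [map_add, map_smul, smul_eq_mul, map_zero] at e
    have g0 : g 0 = 0 := by simpa [hkd', hkq, hkp, hself, hxv hkH] using e k
    have g1 : g 1 = 0 := by simpa [hpd', hpq, hself, hsw p k, hkp, hxv hpH] using e p
    have g2 : g 2 = 0 := by simpa [hqd', hqp, hself, hsw q k, hkq, hxv hqH] using e q
    have g3 : g 3 = 0 := by
      simpa [hself, hsw d' q, hqd', hsw d' p, hpd', hsw d' k, hkd', hd'v] using e d'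
    rw [g0, g1, g2, g3] at hg
    have g4 : g 4 = 0 := by simpa [hv] using hg
    intro i
    fin_cases i
    exacts [g0, g1, g2, g3, g4]

include hw hT hvH hHW hHB in
-- A degenerate point with `s = 1` is sought at `z = ∑ a_i c_i`, for the equation `μ ω - m(a) ω'`,
-- where `m(a) = B(v ∧ z, v ∧ d)` is forced by the condition at `v ∧ d`. The conditions at `c 0, c
-- 1, c 2, d` become `β₀ = 0`, `β₁ + μ a₂ = 0`, `β₂ - μ a₁ = 0`, `β_d - μ a₀ = 0`; eliminating `μ`
-- leaves a system on `P²` to which the syzygy theorem applies.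
lemma false_of_normal_form [IsAlgClosed K] (hP : Module.finrank K P = 5) {c : Fin 3 → P}
    (hc : ∀ i, c i ∈ H) {d : P} (hli : LinearIndependent K ![d, c 2, c 1, c 0, v])
    {ω ω' : E →ₗ[K] K} (hω : ∀ x ∈ W, ω x = 0) (hω' : ∀ x ∈ W, ω' x = 0) (hvd : ω (w v d) = 0)
    (hvd' : ω' (w v d) = 1) (h01 : ω (w (c 0) (c 1)) = 0) (h02 : ω (w (c 0) (c 2)) = 0)
    (h12 : ω (w (c 1) (c 2)) = 1) (h0d : ω (w (c 0) d) = 1) (h1d : ω (w (c 1) d) = 0)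
    (h2d : ω (w (c 2) d) = 0) : False := by
  let A : (Fin 3 → K) →ₗ[K] P := Fintype.linearCombination K c
  have hA (a) : A a = a 0 • c 0 + a 1 • c 1 + a 2 • c 2 := by
    simp [A, Fintype.linearCombination_apply, Fin.sum_univ_three]
  let m : (Fin 3 → K) →ₗ[K] K := B.flip (w v d) ∘ₗ w v ∘ₗ A
  have hm (a) : m a = B (w v (A a)) (w v d) := rfl
  let β (x : P) : (Fin 3 → K) →ₗ[K] (Fin 3 → K) →ₗ[K] K :=
    B.compl₁₂ (w v ∘ₗ A) (w x ∘ₗ A) - (LinearMap.mul K K).compl₁₂ m (ω' ∘ₗ w x ∘ₗ A)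
  have hβ (x a) : β x a a = B (w v (A a)) (w x (A a)) - m a * ω' (w x (A a)) := rfl
  obtain ⟨q₀, hq₀, e₀⟩ := exists_quadratic_polynomial (β (c 0))
  obtain ⟨q₁, hq₁, e₁⟩ := exists_quadratic_polynomial (β (c 1))
  obtain ⟨q₂, hq₂, e₂⟩ := exists_quadratic_polynomial (β (c 2))
  obtain ⟨q₃, hq₃, e₃⟩ := exists_quadratic_polynomial (β d)
  have hrel (a) : a 0 * β (c 0) a a + a 1 * β (c 1) a a + a 2 * β (c 2) a a = 0 := by
    let g : P →ₗ[K] K := (B (w v (A a)) - m a • ω') ∘ₗ w.flip (A a)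
    have h1 : g (A a) = 0 := by
      simp only [g, LinearMap.comp_apply, LinearMap.flip_apply, hw, map_zero]
    rw [hA] at h1
    simp only [map_add, map_smul, smul_eq_mul] at h1
    exact h1
  -- The last two forms are the eliminants of `μ` between the condition at `d` and those at `c 1`,
  -- `c 2`. The syzygy with `k = s = 2` is `x₀` times the relation `hrel`: the `q₃` terms cancel.
  obtain ⟨a, ha0, ha⟩ := exists_common_zero_of_syzygy 2 2
    ![q₀, X 0 * q₁ + X 2 * q₃, X 0 * q₂ - X 1 * q₃] hq₀ (fun i => by
      fin_cases i
      · exact ((isHomogeneous_X K _).mul hq₁).add ((isHomogeneous_X K _).mul hq₃)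
      · exact ((isHomogeneous_X K _).mul hq₂).sub ((isHomogeneous_X K _).mul hq₃)) (by
    refine MvPolynomial.funext fun a => ?_
    have h1 := hrel a
    rw [← e₀, ← e₁, ← e₂] at h1
    rw [Fin.sum_univ_two]
    change eval a (X 0 ^ 2 * q₀ + (X 1 * (X 0 * q₁ + X 2 * q₃) + X 2 * (X 0 * q₂ - X 1 * q₃))) = _
    simp only [map_add, map_mul, map_sub, map_pow, eval_X, map_zero]
    linear_combination a 0 * h1)
  have k0 : β (c 0) a a = 0 := by rw [← e₀]; exact ha 0
  have k1 : a 0 * β (c 1) a a + a 2 * β d a a = 0 := by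
    rw [← e₁, ← e₃]
    simpa using ha 1
  have k2 : a 0 * β (c 2) a a - a 1 * β d a a = 0 := by
    rw [← e₂, ← e₃]
    simpa using ha 2
  have k3 : a 1 * β (c 1) a a + a 2 * β (c 2) a a = 0 := by
    have := hrel a
    rwa [k0, mul_zero, zero_add] at this
  -- The eliminants say that the `β`'s are proportional to the coefficients of `μ`, so `μ` is found
  -- by dividing by any nonzero coordinate of `a`. When `a 0 = 0`, the eliminants force `β_d = 0`
  -- and `k3` relates the remaining two.
  obtain ⟨μ, μ1, μ2, μ3⟩ : ∃ μ, β (c 1) a a + μ * a 2 = 0 ∧ β (c 2) a a - μ * a 1 = 0 ∧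
      β d a a - μ * a 0 = 0 := by
    by_cases h0 : a 0 = 0
    · rw [h0, zero_mul, zero_add] at k1
      rw [h0, zero_mul, zero_sub, neg_eq_zero] at k2
      by_cases h1 : a 1 = 0
      · have h2 : a 2 ≠ 0 := fun h2 => ha0 (funext fun i => by fin_cases i <;> assumption)
        rw [h1, zero_mul, zero_add] at k3
        refine ⟨-β (c 1) a a / a 2, by field_simp; ring, ?_, ?_⟩
        · rw [h1, mul_zero, sub_zero]; exact (mul_eq_zero.1 k3).resolve_left h2
        · rw [h0, mul_zero, sub_zero]; exact (mul_eq_zero.1 k1).resolve_left h2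
      · refine ⟨β (c 2) a a / a 1, ?_, by field_simp; ring, ?_⟩
        · field_simp
          linear_combination k3
        · rw [h0, mul_zero, sub_zero]; exact (mul_eq_zero.1 k2).resolve_left h1
    · refine ⟨β d a a / a 0, ?_, ?_, by field_simp; ring⟩
      · field_simp
        linear_combination k1
      · field_simp
        linear_combination k2
  rw [hβ] at k0 μ1 μ2 μ3
  have hsw (x y) : ω (w x y) = -ω (w y x) := by rw [alt_swap hw, map_neg]
  have hself (x) : ω (w x x) = 0 := by rw [hw, map_zero]
  have w0 : ω (w (c 0) (A a)) = 0 := by rw [hA]; simp [hself, h01, h02]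
  have w1 : ω (w (c 1) (A a)) = a 2 := by rw [hA]; simp [hself, hsw (c 1) (c 0), h01, h12]
  have w2 : ω (w (c 2) (A a)) = -a 1 := by
    rw [hA]; simp [hself, hsw (c 2) (c 0), h02, hsw (c 2) (c 1), h12]
  have wd : ω (w d (A a)) = -a 0 := by
    rw [hA]; simp [hsw d, h0d, h1d, h2d]
  refine one_ne_zero (eq_zero_of_degenerate hT hvH hHW hHB hP hc hli (ω := μ • ω - m a • ω')
    (fun x hx => by simp [hω x hx, hω' x hx]) 1 ha0 (hA a) ?_ (fun i => ?_) ?_).2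
  · simp [hvd, hvd', hm]
  · fin_cases i
    · simp [w0]; linear_combination k0
    · simp [w1]; linear_combination μ1
    · simp [w2]; linear_combination μ2
  · simp [wd]; linear_combination μ3

include hw hT hv hvH hHW hHB in
/-- A smooth section of codimension two of the Grassmannian of lines by a linear space, cut with a
quadric, does not contain a plane of lines through a point. -/
theorem not_forall_wedge_mem_of_finrank [IsAlgClosed K] [NeZero (2 : K)] [Module.Finite K E]
    (hP : Module.finrank K P = 5) (hH : 4 ≤ Module.finrank K H)
    (hW : Module.finrank K E = Module.finrank K W + 2) : False := by
  obtain ⟨c₀, h0, c₁, h1, c₂, h2, d, hli⟩ := exists_linearIndependent_five hv hvH hP hH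
  have hc (i) : (![c₀, c₁, c₂] : Fin 3 → P) i ∈ H := by
    fin_cases i
    exacts [h0, h1, h2]
  let Ω : Submodule K (E →ₗ[K] K) := W.dualAnnihilator
  have hΩ : Module.finrank K Ω = 2 := by
    have := Subspace.finrank_add_finrank_dualAnnihilator_eq W
    change Module.finrank K W + Module.finrank K Ω = _ at this
    omega
  obtain ⟨ω, hω, ω', hω', hb⟩ := exists_linearIndependent_pair_of_finrank hΩ
  rw [Submodule.mem_dualAnnihilator] at hω hω'
  have key {ω₀ ω₁ : E →ₗ[K] K} (hω₀ : ∀ x ∈ W, ω₀ x = 0) (hω₁ : ∀ x ∈ W, ω₁ x = 0) (h0 : ω₀ ≠ 0)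
      (hvd : ω₀ (w v d) = 0) (hvd' : ω₁ (w v d) ≠ 0) : False := by
    obtain ⟨c', d', hc', hd', hli', n01, n02, n12, n0d, n1d, n2d⟩ :=
      exists_normal_form hw hv hT hvH hHW hHB hP hc hli hω₀ hvd h0
    have e {ω : E →ₗ[K] K} (hω : ∀ x ∈ W, ω x = 0) : ω (w v d') = ω (w v d) := by
      have := hω _ (hHW _ hd')
      rwa [map_sub, map_sub, sub_eq_zero] at this
    refine false_of_normal_form hw hT hvH hHW hHB hP hc' hli' (ω := ω₀)
      (ω' := (ω₁ (w v d))⁻¹ • ω₁) hω₀ (fun x hx => by simp [hω₁ x hx]) ?_ ?_ n01 n02 n12 n0d n1d n2d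
    · rw [e hω₀, hvd]
    · rw [LinearMap.smul_apply, e hω₁, smul_eq_mul, inv_mul_cancel₀ hvd']
  -- If the whole pencil kills `v ∧ d`, a degenerate member contradicts independence. Otherwise some
  -- nonzero member kills `v ∧ d` and another does not, which is the situation of the normal form.
  by_cases h : ω (w v d) = 0
  · by_cases h' : ω' (w v d) = 0
    · exact not_linearIndependent_pencil hw hT hvH hHW hHB hP hc hli hω hω' h h' hb
    · exact key hω hω' (hb.ne_zero 0) h h'
  · refine key (ω₀ := ω' (w v d) • ω - ω (w v d) • ω') (fun x hx => by simp [hω x hx, hω' x hx]) hω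
      (fun h0 => ?_) (by simp; ring) h
    have := (LinearIndependent.pair_iff.1 hb (ω' (w v d)) (-ω (w v d)) (by
      rw [neg_smul, ← sub_eq_add_neg, h0])).2
    exact h (neg_eq_zero.1 this)

end Degenerate

end

end GushelMukai

namespace GushelMukai

noncomputable section

/-! ### Emptiness of the Hilbert schemes of large linear spaces -/

section Emptiness

variable {V : Type} [AddCommGroup V] [Module ℂ V] {W : Submodule ℂ (⋀[ℂ]^2 V)}
  {Q : QuadraticForm ℂ (⋀[ℂ]^2 V)} {r : ℕ} {R : CommAlgCat.{0} ℂ}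

/-- The bivectors of a linear space contained in `X` satisfy the equations of `X`. -/
lemma equations_of_mem [Module.Finite ℂ V] {K : Type} [Field K] [Algebra ℂ K]
    (Z : (hilbGM V W Q r).obj R) (f : R ⟶ CommAlgCat.of ℂ K)
    {e : CommAlgCat.of ℂ K ⊗[ℂ] (⋀[ℂ]^2 V)}
    (he : e ∈ extSub f (toSub (LinearFamily.span Z))) :
    e ∈ W.baseChange (CommAlgCat.of ℂ K) ∧ Q.baseChange (CommAlgCat.of ℂ K) e = 0 := by
  by_cases h0 : e = 0
  · rw [h0, QuadraticMap.map_zero]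
    exact ⟨Submodule.zero_mem _, rfl⟩
  obtain ⟨ε, hε⟩ := Module.Projective.exists_dual_eq_one K
    (V := K ⊗[ℂ] (⋀[ℂ]^2 V)) (x := e) h0
  obtain ⟨m, hm⟩ := exists_pp (v := e) (φ := ε) hε
  obtain ⟨y, -, hy⟩ := exists_mem_carrier_of_le Z f m (by
    rw [hm, Submodule.span_singleton_le_iff_mem]; exact he)
  have hey : e ∈ wedgeSub V (toSub y.1) (toSub y.1) := by
    change e ∈ pluecker V W Q _ y
    rw [hy, hm]
    exact Submodule.mem_span_singleton_self e
  exact ⟨y.2.1 hey, y.2.2 e hey⟩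

/-- Over an algebraically closed field, a vertex and the flag of a linear space of `σ`-type in `X`. -/
lemma exists_flag_of_nontrivial (hV : Module.finrank ℂ V = 5) (hr3 : r ≤ 3) (hR : Nontrivial R)
    (Z : (fano V W Q r).obj R) :
    ∃ (K : Type) (_ : Field K) (_ : IsAlgClosed K) (_ : Algebra ℂ K)
      (v : CommAlgCat.of ℂ K ⊗[ℂ] V) (H : Submodule K (K ⊗[ℂ] V)), v ≠ 0 ∧ v ∈ H ∧
      Module.finrank K H = r + 2 ∧
      ∀ a ∈ H, wdg v a ∈ W.baseChange (CommAlgCat.of ℂ K) ∧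
        Q.baseChange (CommAlgCat.of ℂ K) (wdg v a) = 0 := by
  have : Module.Finite ℂ V := Module.finite_of_finrank_pos (by omega)
  obtain ⟨p, hp⟩ := Ideal.exists_maximal R
  have hprime := hp.isPrime
  obtain ⟨K, _, _, _, g, _⟩ := exists_geometric_point (atPrime R p)
  have hlocK : IsLocalRing (CommAlgCat.of ℂ K) := inferInstanceAs (IsLocalRing K)
  obtain ⟨V₁, V₂, hle, hσ⟩ := Z.2 K (toAtPrime R p ≫ g)
  rw [toSub_map] at hσ
  obtain ⟨v, φ, hφ, hv⟩ := exists_unimodular (by omega) V₁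
  obtain ⟨u, hu, hu'⟩ := exists_isSplit_span (by omega) V₂
  have hvV : v ∈ toSub V₁ := by rw [hv]; exact Submodule.mem_span_singleton_self v
  refine ⟨K, inferInstance, inferInstance, inferInstance, v, toSub V₂, ?_, hle hvV, ?_,
    fun a ha => equations_of_mem Z.1 (toAtPrime R p ≫ g) ?_⟩
  · rintro rfl
    rw [map_zero] at hφ
    exact zero_ne_one (α := K) hφ
  · rw [hu']
    have := finrank_span_eq_card (R := K) (M := K ⊗[ℂ] V) hu.linearIndependent
    rwa [Fintype.card_fin] at this
  · rw [hσ]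
    exact wdg_mem_wedgeSub hvV ha

section

variable {n : ℕ} (hV : Module.finrank ℂ V = 5) (hW : Module.finrank ℂ W = n + 5)
  (hX : IsSmoothOfDim n (gm V W Q))

include hV hW hX in
-- Transversality phrased with the bilinear form alone: `B(p, p) = 2 Q(p)` and `2` is invertible, so
-- isotropy for the polar form is membership in the quadric.
lemma transverse_polarBilin {K : Type} [Field K] [Algebra ℂ K] (v a : K ⊗[ℂ] V)
    (hva : LinearIndependent K ![v, a])
    (hpW : LinearMap.BilinMap.baseChange K (wedge V) v a ∈ W.baseChange K)
    (hpQ : QuadraticMap.polarBilin (Q.baseChange K) (LinearMap.BilinMap.baseChange K (wedge V) v a)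
      (LinearMap.BilinMap.baseChange K (wedge V) v a) = 0)
    (ω : K ⊗[ℂ] (⋀[ℂ]^2 V) →ₗ[K] K) (hω : ∀ x ∈ W.baseChange K, ω x = 0) (c : K)
    (h : ∀ x y, ω (LinearMap.BilinMap.baseChange K (wedge V) x a +
        LinearMap.BilinMap.baseChange K (wedge V) v y) +
      c * QuadraticMap.polarBilin (Q.baseChange K) (LinearMap.BilinMap.baseChange K (wedge V) v a)
        (LinearMap.BilinMap.baseChange K (wedge V) x a +
          LinearMap.BilinMap.baseChange K (wedge V) v y) = 0) :
    ω = 0 ∧ c = 0 := by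
  refine transverse hV hW hX hva hpW ?_ ω hω c h
  rw [QuadraticMap.polarBilin_apply_apply, QuadraticMap.polar_self, two_smul, ← two_mul] at hpQ
  exact (isUnit_two (CommAlgCat.of ℂ K)).mul_right_eq_zero.1 hpQ

include hV hW hX in
theorem isEmpty_fano_three (hR : Nontrivial R) : IsEmpty ((fano V W Q 3).obj R) := by
  refine ⟨fun Z => ?_⟩
  obtain ⟨K, _, _, _, v, H, hv, hvH, hH, h⟩ := exists_flag_of_nontrivial hV le_rfl hR Z
  have : Module.Finite ℂ V := Module.finite_of_finrank_pos (by omega)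
  have hP : Module.finrank K (K ⊗[ℂ] V) = 5 := by rw [Module.finrank_baseChange, hV]
  -- For `r = 3` the flag space has dimension `r + 2 = 5`, so every line through the point `[v]` of
  -- `P(V)` belongs to `X`.
  have htop : H = ⊤ := Submodule.eq_top_of_finrank_eq (by rw [hH, hP])
  have h' (a) := h a (htop ▸ Submodule.mem_top)
  refine not_forall_wedge_mem (K := K) (w := LinearMap.BilinMap.baseChange K (wedge V))
    (B := QuadraticMap.polarBilin (Q.baseChange K)) (W := W.baseChange K)
    (fun x => wdg_self (R := CommAlgCat.of ℂ K) x) hv (transverse_polarBilin hV hW hX v) hP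
    (fun a => (h' a).1) fun a b => ?_
  have hab := (h' (a + b)).2
  rw [wdg_add_right] at hab
  rw [QuadraticMap.polarBilin_apply_apply, QuadraticMap.polar]
  exact sub_eq_zero.2 ((sub_eq_zero.2 (hab.trans (h' a).2.symm)).trans (h' b).2.symm)

include hV hW hX in
theorem isEmpty_fano_two (hn : n = 3) (hR : Nontrivial R) : IsEmpty ((fano V W Q 2).obj R) := by
  refine ⟨fun Z => ?_⟩
  obtain ⟨K, _, _, _, v, H, hv, hvH, hH, h⟩ := exists_flag_of_nontrivial hV (by norm_num) hR Z
  have : Module.Finite ℂ V := Module.finite_of_finrank_pos (by omega)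
  have hP : Module.finrank K (K ⊗[ℂ] V) = 5 := by rw [Module.finrank_baseChange, hV]
  have hchar : NeZero (2 : K) := ⟨(isUnit_two (CommAlgCat.of ℂ K)).ne_zero (M₀ := K)⟩
  refine not_forall_wedge_mem_of_finrank (K := K) (w := LinearMap.BilinMap.baseChange K (wedge V))
    (B := QuadraticMap.polarBilin (Q.baseChange K)) (W := W.baseChange K)
    (fun x => wdg_self (R := CommAlgCat.of ℂ K) x) hv (transverse_polarBilin hV hW hX v) hvH
    (fun a ha => (h a ha).1) (fun a ha b hb => ?_) hP hH.ge ?_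
  · have hab := (h (a + b) (H.add_mem ha hb)).2
    rw [wdg_add_right] at hab
    rw [QuadraticMap.polarBilin_apply_apply, QuadraticMap.polar]
    exact sub_eq_zero.2 ((sub_eq_zero.2 (hab.trans (h a ha).2.symm)).trans (h b hb).2.symm)
  -- For `n = 3`, `W` has dimension `8` in the ten-dimensional `⋀² V`: the equations of `W` form a
  -- pencil.
  · rw [Module.finrank_baseChange, finrank_exteriorPower_two hV, finrank_baseChange_submodule, hW, hn]

end

end Emptiness

end

end GushelMukai

open GushelMukai in
theorem proposition3p6 (V : Type) [AddCommGroup V] [Module ℂ V] (hV : Module.finrank ℂ V = 5)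
    (n : ℕ) (hn : 3 ≤ n)
    (W : Submodule ℂ (⋀[ℂ]^2 V)) (hW : Module.finrank ℂ W = n + 5)
    (Q : QuadraticForm ℂ (⋀[ℂ]^2 V)) (hX : IsSmoothOfDim n (gm V W Q)) :
    (∀ r : ℕ, 1 ≤ r → r ≤ 3 →
      ∃ σ : fano V W Q r ⟶ PP V ⋙ uliftFunctor.{1},
        (∀ (R : CommAlgCat.{0} ℂ) (Z : (fano V W Q r).obj R),
          ∃ V₂ : (Gr (r + 2) V).obj R, toSub (σ.app R Z).down ≤ toSub V₂ ∧
            toSub Z.1.span = wedgeSub V (toSub (σ.app R Z).down) (toSub V₂)) ∧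
        ∃ e : fano V W Q r ≅ hilbRho V W Q r,
          e.hom ≫ hilbRhoToPP V W Q r = σ ∧
          ∀ (R : CommAlgCat.{0} ℂ) (Z : (fano V W Q r).obj R) (R' : CommAlgCat.{0} ℂ) (f : R ⟶ R'),
            (projTautToGM V W Q).app R' '' (LinearFamily.carrier (e.hom.app R Z) f) =
              Z.1.carrier f) ∧
    (∀ R : CommAlgCat.{0} ℂ, Nontrivial R → IsEmpty ((fano V W Q 3).obj R)) ∧
    (n ≤ 3 → ∀ R : CommAlgCat.{0} ℂ, Nontrivial R → IsEmpty ((fano V W Q 2).obj R)) := by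
  have : Module.Finite ℂ V := Module.finite_of_finrank_pos (by omega)
  exact ⟨fun r hr hr3 => exists_fanoIso hV hr hr3, fun R hR => isEmpty_fano_three hV hW hX hR,
    fun h R hR => isEmpty_fano_two hV hW hX (by omega) hR⟩
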